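/- **Setting.** Consider $u_t+u_x-u_{xx}=0$ on $[0,2\pi]\times[0,T]$ with periodic boundary conditions, i.e. $u(0,t)=u(2\pi,t)$ and $q(0,t)=q(2\pi,t)$, where $q=u_x$. Let $0=x_{1/2}<\dots<x_{N+1/2}=2\pi$, $I_j=(x_{j-1/2},x_{j+1/2})$, $h_j=|I_j|$, $h=\max_jh_j$, and suppose that the mesh is quasi-uniform: $\sigma h\le h_j$ for all $j$, with a fixed $\sigma>0$. Let $V_h^k$ be the space of functions whose restriction to each $I_j$ is a polynomial of degree at most $k$. Write $(\cdot,\cdot)_j$ for the $L^2(I_j)$ inner product, $v^\mp_{j+1/2}$ for the left and right traces at $x_{j+1/2}$ (with $2\pi$ and $0$ identified), $[v]=v^+-v^-$, and $v^{(\theta)}=\theta v^-+(1-\theta)v^+$, $\tilde\theta=1-\theta$. *Scheme.* Let $\lambda\ge\frac12$ and $\theta\ne\frac12$. The LDG solution consists of $u_h(\cdot,t),q_h(\cdot,t)\in V_h^k$ such that for all $t\in[0,T]$, all $j$ and all $v,\psi\in V_h^k$ $$(u_{ht},v)_j-(u_h-q_h,v_x)_j+\big(u_h^{(\lambda)}-q_h^{(\tilde\theta)}\big)v^-\big|_{j+\frac12}-\big(u_h^{(\lambda)}-q_h^{(\tilde\theta)}\big)v^+\big|_{j-\frac12}=0,$$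 $$(q_h,\psi)_j+(u_h,\psi_x)_j-u_h^{(\theta)}\psi^-\big|_{j+\frac12}+u_h^{(\theta)}\psi^+\big|_{j-\frac12}=0 .$$ The numerical traces are $\hat u_h=u_h^{(\theta)}$ and $\hat q_h=q_h^{(\tilde\theta)}$. *Initial data.* $P_\theta z\in V_h^k$ is defined by $(P_\theta z-z,v)_j=0$ for all $v\in P^{k-1}(I_j)$ and $(P_\theta z)^{(\theta)}_{j+1/2}=z^{(\theta)}_{j+1/2}$, for all $j$; and $P^*_{\tilde\theta}q\in V_h^k$ by $(P^*_{\tilde\theta}q-q,v)_j=0$ for all $v\in P^{k-1}(I_j)$ and $(P^*_{\tilde\theta}q)^{(\tilde\theta)}_{j+1/2}=q^{(\tilde\theta)}_{j+1/2}+(\lambda-\theta)[u-P_\theta u]_{j+1/2}$ (so $P^*_{\tilde\theta}q=P_{\tilde\theta}q$ if $\lambda=\theta$). Put $w_{u,0}=u-P_\theta u$, $w_{q,0}=q-P^*_{\tilde\theta}q$, and let $w_{u,i},w_{q,i}\in V_h^k$ ($1\le i\le k$) satisfy, for all $j$ and all $v\in P^{k-1}(I_j)$, $$\big(w_{u,i}-\tfrac{h_j}2D_x^{-1}w_{q,i-1},v\big)_j=0,\quad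 (w_{u,i})^{(\theta)}_{j+\frac12}=0,$$ $$\big(w_{q,i}-w_{u,i}-\tfrac{h_j}2D_x^{-1}\partial_tw_{u,i-1},v\big)_j=0,\quad (w_{q,i})^{(\tilde\theta)}_{j+\frac12}=(w_{u,i})^{(\lambda)}_{j+\frac12},$$ where $D_x^{-1}w(x)=\frac{2}{h_j}\int_{x_{j-1/2}}^xw(\tau)\,d\tau$ on $I_j$. (If $\lambda=\theta$, the last condition reads $(w_{q,i})^{(\tilde\theta)}_{j+1/2}=0$.) Let $u_I^k=P_\theta u-\sum_{i=1}^kw_{u,i}$. **Theorem.** Let $k\ge1$, $\lambda\ge\frac12$, $\theta\neq\frac12$, $\sigma>0$ and $B\in\mathbb R$. There is a constant $C>0$, depending only on $k,\lambda,\theta,\sigma,B$, such that the following holds for every $T>0$. Let $u$ be a classical periodic solution on $[0,T]$ with $u(\cdot,t)\in W^{2k+3,\infty}(0,2\pi)$ and $\|u(\cdot,t)\|_{2k+3,\infty}\le B$ for all $t\in[0,T]$. Let $(u_h,q_h)$ be an LDG solution on a quasi-uniform mesh (with constant $\sigma$) with $u_h(\cdot,0)=u_I^k(\cdot,0)$.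 With $$\|e_{v,n}\|=\Big(\frac1N\sum_{j=1}^N\big|(v-\hat v_h)(x_{j+\frac12},t)\big|^2\Big)^{1/2},\qquad v=u,q,$$ we have for all $t\in[0,T]$ $$\|e_{u,n}\|\le C(1+t)h^{2k+1},$$ and, if $\lambda=\theta$, also $$\Big(\int_0^t\|e_{q,n}\|^2\,d\tau\Big)^{1/2}\le C(1+t)h^{2k+1}.$$ -/

import Mathlib

open Set MeasureTheory Polynomial
open scoped Real ContDiff

noncomputable section

namespace LDG

/-! ## Sobolev spaces on an interval -/

/-- `g` is the weak derivative of `f` on the open interval `(a, b)`. -/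
def IsWeakDeriv (a b : ℝ) (f g : ℝ → ℝ) : Prop :=
  LocallyIntegrableOn f (Ioo a b) ∧ LocallyIntegrableOn g (Ioo a b) ∧
    ∀ φ : ℝ → ℝ, ContDiff ℝ ∞ φ → HasCompactSupport φ → tsupport φ ⊆ Ioo a b →
      ∫ x in Ioo a b, f x * deriv φ x = -∫ x in Ioo a b, g x * φ x

/-- `f ∈ W^{m,∞}(a, b)` and `‖f‖_{W^{m,∞}(a,b)} = max_{i ≤ m} ‖f⁽ⁱ⁾‖_{L^∞(a,b)} ≤ B`;
here `D i` is the weak derivative of order `i` of `f`. -/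
def SobolevNormLE (a b : ℝ) (m : ℕ) (f : ℝ → ℝ) (B : ℝ) : Prop :=
  ∃ D : ℕ → ℝ → ℝ, D 0 = f ∧
    (∀ i < m, IsWeakDeriv a b (D i) (D (i + 1))) ∧
    ∀ i ≤ m, AEStronglyMeasurable (D i) (volume.restrict (Ioo a b)) ∧
      ∀ᵐ x ∂volume.restrict (Ioo a b), |D i x| ≤ B

/-! ## The exact solution

A function `u` of time and space is written `u t x`. -/

/-- The auxiliary variable `q = u_x` on `[0, 2π]` (one-sided derivatives at the two ends). -/
def auxVar (u : ℝ → ℝ → ℝ) (t x : ℝ) : ℝ :=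
  derivWithin (u t) (Icc 0 (2 * π)) x

/-- `u` is a classical solution of `u_t + u_x - u_xx = 0` on `[0, 2π] × [0, T]` with periodic
boundary conditions (for `u` and for the flux variable `q = u_x`). -/
structure IsPeriodicSolution (T : ℝ) (u : ℝ → ℝ → ℝ) : Prop where
  space_reg : ∀ t ∈ Icc 0 T, ContDiffOn ℝ 2 (u t) (Icc 0 (2 * π))
  time_reg : ∀ t ∈ Icc 0 T, ∀ x ∈ Icc 0 (2 * π),
    DifferentiableWithinAt ℝ (fun s => u s x) (Icc 0 T) t
  pde : ∀ t ∈ Icc 0 T, ∀ x ∈ Icc 0 (2 * π),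
    derivWithin (fun s => u s x) (Icc 0 T) t + auxVar u t x
      - derivWithin (auxVar u t) (Icc 0 (2 * π)) x = 0
  periodic : ∀ t ∈ Icc 0 T, u t 0 = u t (2 * π)
  periodic_aux : ∀ t ∈ Icc 0 T, auxVar u t 0 = auxVar u t (2 * π)

/-! ## Meshes and piecewise functions -/

/-- A partition `0 = node 0 < node 1 < ⋯ < node N = 2π` of `[0, 2π]` into `N` cells. -/
structure Mesh where
  N : ℕ
  node : Fin (N + 1) → ℝ
  strictMono_node : StrictMono node
  node_first : node 0 = 0
  node_last : node (Fin.last N) = 2 * π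

namespace Mesh

variable (𝓜 : Mesh)

/-- Left end of the cell `I_j`. -/
def left (j : Fin 𝓜.N) : ℝ := 𝓜.node j.castSucc

/-- Right end of the cell `I_j`. -/
def right (j : Fin 𝓜.N) : ℝ := 𝓜.node j.succ

/-- The length `h_j` of the cell `I_j`. -/
def size (j : Fin 𝓜.N) : ℝ := 𝓜.right j - 𝓜.left j

/-- `h = max_j h_j`. -/
def maxSize : ℝ := ⨆ j, 𝓜.size j

/-- Quasi-uniformity with constant `σ`: `σ h ≤ h_j` for all `j`. -/
def QuasiUniform (σ : ℝ) : Prop := ∀ j, σ * 𝓜.maxSize ≤ 𝓜.size j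

/-- The cell to the right of `I_j`, cyclically. -/
def next (j : Fin 𝓜.N) : Fin 𝓜.N := finRotate 𝓜.N j

/-- The cell to the left of `I_j`, cyclically. -/
def prev (j : Fin 𝓜.N) : Fin 𝓜.N := (finRotate 𝓜.N).symm j

/-- Piecewise functions: one function for each cell. Only its values on the closed cell matter;
the values at the ends of the cell are the traces taken from within that cell. -/
abbrev Broken := Fin 𝓜.N → ℝ → ℝ

/-- Piecewise polynomials: one polynomial for each cell. -/
abbrev PiecePoly := Fin 𝓜.N → ℝ[X]

/-- The piecewise function given by a piecewise polynomial. -/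
def toBroken (p : 𝓜.PiecePoly) : 𝓜.Broken := fun j x => (p j).eval x

/-- A function on `[0, 2π]` as a piecewise function. -/
def restrict (f : ℝ → ℝ) : 𝓜.Broken := fun _ => f

/-- `p` belongs to the finite element space `V_h^k`: degree at most `k` on every cell. -/
def InSpace (k : ℕ) (p : 𝓜.PiecePoly) : Prop := ∀ j, p j ∈ degreeLT ℝ (k + 1)

/-- The weighted average `v^{(θ)} = θ v⁻ + (1 - θ) v⁺` at the right end of the cell `I_j`, where
the point `2π` is identified with `0`. -/
def avg (θ : ℝ) (v : 𝓜.Broken) (j : Fin 𝓜.N) : ℝ :=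
  θ * v j (𝓜.right j) + (1 - θ) * v (𝓜.next j) (𝓜.left (𝓜.next j))

/-- The jump `[v] = v⁺ - v⁻` at the right end of the cell `I_j`. -/
def jump (v : 𝓜.Broken) (j : Fin 𝓜.N) : ℝ :=
  v (𝓜.next j) (𝓜.left (𝓜.next j)) - v j (𝓜.right j)

/-- `D_x⁻¹ v (x) = (h_j / 2)⁻¹ ∫_{x_{j-1/2}}^x v(τ) dτ` on the cell `I_j`. -/
def primitive (v : 𝓜.Broken) : 𝓜.Broken :=
  fun j x => (𝓜.size j / 2)⁻¹ * ∫ τ in 𝓜.left j..x, v j τ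

/-- Time derivative of a time dependent piecewise function on `[0, T]`. -/
def timeDeriv (T : ℝ) (v : ℝ → 𝓜.Broken) (t : ℝ) : 𝓜.Broken :=
  fun j x => derivWithin (fun s => v s j x) (Icc 0 T) t

/-! ## Gauss–Radau type projections -/

/-- `p ∈ V_h^k`, `∫_{I_j} (p - z) v = 0` for all `v ∈ P^{k-1}(I_j)`, and `p^{(θ)} = g` at the nodes
(`k ≥ 1`). -/
def IsRadau (k : ℕ) (θ : ℝ) (z : 𝓜.Broken) (g : Fin 𝓜.N → ℝ) (p : 𝓜.PiecePoly) : Prop :=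
  𝓜.InSpace k p ∧
    (∀ j, ∀ v ∈ degreeLT ℝ k,
      ∫ x in 𝓜.left j..𝓜.right j, ((p j).eval x - z j x) * v.eval x = 0) ∧
    ∀ j, 𝓜.avg θ (𝓜.toBroken p) j = g j

/-- The element `p` of `V_h^k` determined by `IsRadau`; it exists and is unique for `θ ≠ 1/2`
and `z` integrable. -/
def radau (k : ℕ) (θ : ℝ) (z : 𝓜.Broken) (g : Fin 𝓜.N → ℝ) : 𝓜.PiecePoly :=
  Classical.epsilon (𝓜.IsRadau k θ z g)

/-- The generalized Gauss–Radau projection `P_θ z`. -/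
def proj (k : ℕ) (θ : ℝ) (z : 𝓜.Broken) : 𝓜.Broken :=
  𝓜.toBroken (𝓜.radau k θ z (𝓜.avg θ z))

/-- The modified projection `P^*_{1-θ} q`, which coincides with `P_{1-θ} q` when `lam = θ`. -/
def projStar (k : ℕ) (lam θ : ℝ) (u q : 𝓜.Broken) : 𝓜.Broken :=
  𝓜.toBroken (𝓜.radau k (1 - θ) q
    (fun j => 𝓜.avg (1 - θ) q j + (lam - θ) * 𝓜.jump (u - 𝓜.proj k θ u) j))

/-! ## Correction functions -/

/-- The functions `(w_{u,i}, w_{q,i})` of time and space: `w_{u,0} = u - P_θ u`,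
`w_{q,0} = q - P^*_{1-θ} q`, and for `i ≥ 1` the elements of `V_h^k` such that, for `v ∈ P^{k-1}(I_j)`,
`(w_{u,i} - (h_j/2) D_x⁻¹ w_{q,i-1}, v)_j = 0`, `w_{u,i}^{(θ)} = 0`,
`(w_{q,i} - w_{u,i} - (h_j/2) D_x⁻¹ ∂_t w_{u,i-1}, v)_j = 0`, `w_{q,i}^{(1-θ)} = w_{u,i}^{(lam)}`. -/
def corr (k : ℕ) (lam θ T : ℝ) (u : ℝ → ℝ → ℝ) : ℕ → (ℝ → 𝓜.Broken) × (ℝ → 𝓜.Broken)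
  | 0 =>
    (fun t => 𝓜.restrict (u t) - 𝓜.proj k θ (𝓜.restrict (u t)),
     fun t => 𝓜.restrict (auxVar u t)
      - 𝓜.projStar k lam θ (𝓜.restrict (u t)) (𝓜.restrict (auxVar u t)))
  | i + 1 =>
    let w := corr k lam θ T u i
    let wu : ℝ → 𝓜.Broken := fun t => 𝓜.toBroken
      (𝓜.radau k θ (fun j x => 𝓜.size j / 2 * 𝓜.primitive (w.2 t) j x) 0)
    let wq : ℝ → 𝓜.Broken := fun t => 𝓜.toBroken
      (𝓜.radau k (1 - θ)
        (fun j x => wu t j x + 𝓜.size j / 2 * 𝓜.primitive (𝓜.timeDeriv T w.1 t) j x)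
        (𝓜.avg lam (wu t)))
    (wu, wq)

/-- The special interpolation function `u_I^ℓ = P_θ u - ∑_{i=1}^ℓ w_{u,i}` at time `t`. -/
def interp (k ℓ : ℕ) (lam θ T : ℝ) (u : ℝ → ℝ → ℝ) (t : ℝ) : 𝓜.Broken :=
  𝓜.proj k θ (𝓜.restrict (u t)) - ∑ i ∈ Finset.Icc 1 ℓ, (𝓜.corr k lam θ T u i).1 t

/-! ## The scheme -/

/-- `(uh, qh)` solves the semidiscrete LDG scheme on `[0, T]` with periodic boundary conditions and
the generalized alternating fluxes `(uh^{(lam)} - qh^{(1-θ)}, uh^{(θ)})`. -/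
structure IsLDGSolution (k : ℕ) (lam θ T : ℝ) (uh qh : ℝ → 𝓜.PiecePoly) : Prop where
  mem_u : ∀ t ∈ Icc 0 T, 𝓜.InSpace k (uh t)
  mem_q : ∀ t ∈ Icc 0 T, 𝓜.InSpace k (qh t)
  time_reg : ∀ t ∈ Icc 0 T, ∀ j x,
    DifferentiableWithinAt ℝ (fun s => (uh s j).eval x) (Icc 0 T) t
  eq_u : ∀ t ∈ Icc 0 T, ∀ j, ∀ v ∈ degreeLT ℝ (k + 1),
    (∫ x in 𝓜.left j..𝓜.right j,
        𝓜.timeDeriv T (fun s => 𝓜.toBroken (uh s)) t j x * v.eval x)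
      - (∫ x in 𝓜.left j..𝓜.right j,
          ((uh t j).eval x - (qh t j).eval x) * (derivative v).eval x)
      + (𝓜.avg lam (𝓜.toBroken (uh t)) j - 𝓜.avg (1 - θ) (𝓜.toBroken (qh t)) j)
          * v.eval (𝓜.right j)
      - (𝓜.avg lam (𝓜.toBroken (uh t)) (𝓜.prev j)
          - 𝓜.avg (1 - θ) (𝓜.toBroken (qh t)) (𝓜.prev j)) * v.eval (𝓜.left j) = 0
  eq_q : ∀ t ∈ Icc 0 T, ∀ j, ∀ v ∈ degreeLT ℝ (k + 1),
    (∫ x in 𝓜.left j..𝓜.right j, (qh t j).eval x * v.eval x)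
      + (∫ x in 𝓜.left j..𝓜.right j, (uh t j).eval x * (derivative v).eval x)
      - 𝓜.avg θ (𝓜.toBroken (uh t)) j * v.eval (𝓜.right j)
      + 𝓜.avg θ (𝓜.toBroken (uh t)) (𝓜.prev j) * v.eval (𝓜.left j) = 0

/-- Discrete `L²` norm `(N⁻¹ ∑_j |(v - vh^{(θ)})(x_{j+1/2})|²)^{1/2}` of the error between `v` and
the numerical trace `vh^{(θ)}` at the nodes. -/
def traceError (θ : ℝ) (v : ℝ → ℝ) (vh : 𝓜.PiecePoly) : ℝ :=
  √((1 / (𝓜.N : ℝ)) * ∑ j, |v (𝓜.right j) - 𝓜.avg θ (𝓜.toBroken vh) j| ^ 2)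

end Mesh

end LDG

end

noncomputable section

namespace LDG

/-! ## Polynomials on an interval -/

/-! Split the errors as u - u_h = η_u + ξ_u and q - q_h = η_q + ξ_q, where η_u and η_q are the sums
of all w_{u,i} and w_{q,i} with 0 ≤ i ≤ k (`etaU`, `etaQ`). Then ξ_u and ξ_q (`errU`, `errQ`) are
piecewise polynomials. The corrections are built so that η nearly disappears from the scheme.

The node conditions give η_u^{(θ)} = 0 and η_q^{(1-θ)} = η_u^{(λ)} (`op_nodes`), so η contributes
nothing to the numerical fluxes. For i < k the functions w_{u,i} and w_{q,i} have mean zero on every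
cell, and integration by parts turns their moment conditions into (w_{u,i+1}, v_x) = -(w_{q,i}, v)
and (w_{u,i+1} - w_{q,i+1}, v_x) = (∂_t w_{u,i}, v). Summed over i these relations telescope: ξ
solves the scheme up to w_{q,k} in the second equation and ∂_t w_{u,k} in the first. The Gauss–Radau
projections are stable in the maximum norm for θ ≠ 1/2 (`exists_radau_bound`), and every correction
step integrates over a cell, which gains a factor h. Starting from h^{k+1}, the last corrections are
therefore of size h^{2k+1} (`exists_op_bound`).

Testing the error equations with ξ_u and ξ_q cancels the diffusive fluxes and leaves the dissipation
(λ - 1/2)[ξ_u]² at the nodes (`energy_inequality`). Since ξ_u vanishes initially, ‖ξ_u‖² + ∫‖ξ_q‖²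
is bounded by a multiple of h^{2(2k+1)}(1+t)² (`energy_estimate`, `exists_energy_bound`). At the
nodes u - û_h = ξ_u^{(θ)}, and q - q̂_h = ξ_q^{(1-θ)} if λ = θ. An inverse estimate on the
quasi-uniform mesh bounds these by the L² norms (`exists_avg_bound`).

Regularity is the delicate point. The differential equation replaces ∂_t by ∂_x² - ∂_x (`advDiff`),
so that the corrections become fixed linear operators `op` on spatial jets, and spatial bounds yield
bounds in time. A bound in W^{2k+3,∞} gives only 2k+2 classical derivatives, the last of them
Lipschitz. This suffices to differentiate w_{u,i} in time for i < k, but w_{u,k} is obtained only as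
a Lipschitz function of time. Hence the energy argument differentiates ξ_u + w_{u,k}, not ξ_u, and
compares one-sided difference quotients with a barrier. -/

theorem intervalIntegrable_eval (p : ℝ[X]) (l r : ℝ) :
    IntervalIntegrable (fun x => p.eval x) volume l r :=
  p.continuous.intervalIntegrable _ _

theorem natDegree_lt_iff_degree_lt_of_pos {n : ℕ} (hn : 0 < n) {p : ℝ[X]} :
    p.natDegree < n ↔ p.degree < n := by
  by_cases hp : p = 0
  · simp [hp, hn]
  · exact natDegree_lt_iff_degree_lt hp

/-- The functional `p ↦ ∫_l^r p v`. -/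
def momentL (l r : ℝ) (v : ℝ[X]) : ℝ[X] →ₗ[ℝ] ℝ where
  toFun p := ∫ x in l..r, p.eval x * v.eval x
  map_add' p q := by
    rw [← intervalIntegral.integral_add]
    · simp [add_mul]
    · exact (p.continuous.mul v.continuous).intervalIntegrable _ _
    · exact (q.continuous.mul v.continuous).intervalIntegrable _ _
  map_smul' c p := by
    simp [mul_assoc]

theorem momentL_apply (l r : ℝ) (v p : ℝ[X]) :
    momentL l r v p = ∫ x in l..r, p.eval x * v.eval x := rfl

/-- A separating family of functionals on polynomials of degree less than `n` controls the
coefficients. -/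
theorem exists_coeff_bound {ι : Type*} [Fintype ι] (n : ℕ) (ℓ : ι → ℝ[X] →ₗ[ℝ] ℝ)
    (h : ∀ p ∈ degreeLT ℝ n, (∀ i, ℓ i p = 0) → p = 0) :
    ∃ K : ℝ, 0 < K ∧ ∀ p ∈ degreeLT ℝ n, ∀ Z : ℝ, 0 ≤ Z → (∀ i, |ℓ i p| ≤ Z) →
      ∀ m, |p.coeff m| ≤ K * Z := by
  set Φ : (Fin n → ℝ) →ₗ[ℝ] (ι → ℝ) :=
    LinearMap.pi fun i => ℓ i ∘ₗ (degreeLT ℝ n).subtype ∘ₗ (degreeLTEquiv ℝ n).symm.toLinearMap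
    with hΦ
  have hker : LinearMap.ker Φ = ⊥ := by
    rw [LinearMap.ker_eq_bot']
    intro c hc
    have h0 : (((degreeLTEquiv ℝ n).symm c : degreeLT ℝ n) : ℝ[X]) = 0 := by
      refine h _ (Subtype.property _) fun i => ?_
      have := congrFun hc i
      simpa [hΦ] using this
    have h1 : (degreeLTEquiv ℝ n).symm c = 0 := Subtype.ext h0
    simpa using h1
  obtain ⟨K, hK0, hK⟩ := Φ.exists_antilipschitzWith hker
  refine ⟨K, by exact_mod_cast hK0, fun p hp Z hZ hi m => ?_⟩
  by_cases hm : m < n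
  · set c := degreeLTEquiv ℝ n ⟨p, hp⟩ with hc
    have h1 := hK.le_mul_dist c 0
    rw [map_zero, dist_zero_right, dist_zero_right] at h1
    have h2 : ‖Φ c‖ ≤ Z := by
      rw [pi_norm_le_iff_of_nonneg hZ]
      intro i
      have : Φ c i = ℓ i p := by simp [hΦ, hc]
      rw [this]
      exact hi i
    have h3 : |p.coeff m| ≤ ‖c‖ := by
      have := norm_le_pi_norm c ⟨m, hm⟩
      simpa [hc, degreeLTEquiv] using this
    exact h3.trans (h1.trans (mul_le_mul_of_nonneg_left h2 K.2))
  · have : p.coeff m = 0 := by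
      apply coeff_eq_zero_of_degree_lt
      exact (mem_degreeLT.1 hp).trans_le (by exact_mod_cast not_lt.1 hm)
    rw [this, abs_zero]
    positivity

theorem eval_eq_sum_of_mem_degreeLT {n : ℕ} {p : ℝ[X]} (hp : p ∈ degreeLT ℝ n) (x : ℝ) :
    p.eval x = ∑ m ∈ Finset.range n, p.coeff m * x ^ m := by
  rcases Nat.eq_zero_or_pos n with rfl | hn
  · have : p = 0 := by simpa [mem_degreeLT, Polynomial.degree_eq_bot] using hp
    simp [this]
  · exact eval_eq_sum_range' ((natDegree_lt_iff_degree_lt_of_pos hn).2 (mem_degreeLT.1 hp)) x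

theorem abs_eval_le_of_coeff {n : ℕ} {p : ℝ[X]} (hp : p ∈ degreeLT ℝ n) {A : ℝ}
    (hA : ∀ m, |p.coeff m| ≤ A) {x : ℝ} (hx : x ∈ Icc (0 : ℝ) 1) : |p.eval x| ≤ n * A := by
  rw [eval_eq_sum_of_mem_degreeLT hp]
  calc |∑ m ∈ Finset.range n, p.coeff m * x ^ m| ≤ ∑ m ∈ Finset.range n, |p.coeff m * x ^ m| :=
        Finset.abs_sum_le_sum_abs _ _
    _ ≤ ∑ m ∈ Finset.range n, A := by
        refine Finset.sum_le_sum fun m _ => ?_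
        rw [abs_mul]
        have h1 : |x ^ m| ≤ 1 := by
          rw [abs_of_nonneg (pow_nonneg hx.1 _)]
          exact pow_le_one₀ hx.1 hx.2
        have := hA m
        nlinarith [abs_nonneg (p.coeff m), abs_nonneg (x ^ m)]
    _ = n * A := by simp

theorem derivative_mem_degreeLT {n : ℕ} {p : ℝ[X]} (hp : p ∈ degreeLT ℝ (n + 1)) :
    derivative p ∈ degreeLT ℝ n := by
  rw [mem_degreeLT, degree_lt_iff_coeff_zero] at hp ⊢
  intro m hm
  rw [coeff_derivative, hp (m + 1) (by omega), zero_mul]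

theorem degreeLT_le {m n : ℕ} (h : m ≤ n) {p : ℝ[X]} (hp : p ∈ degreeLT ℝ m) :
    p ∈ degreeLT ℝ n := degreeLT_mono h hp

theorem X_pow_mem_degreeLT {m n : ℕ} (h : m < n) : (X ^ m : ℝ[X]) ∈ degreeLT ℝ n := by
  rw [mem_degreeLT, degree_X_pow]
  exact_mod_cast h

theorem exists_antiderivative {n : ℕ} {p : ℝ[X]} (hp : p ∈ degreeLT ℝ n) :
    ∃ P ∈ degreeLT ℝ (n + 1), derivative P = p := by
  refine ⟨∑ m ∈ Finset.range n, C (p.coeff m / (m + 1)) * X ^ (m + 1), ?_, ?_⟩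
  · refine Submodule.sum_mem _ fun m hm => ?_
    rw [← smul_eq_C_mul]
    exact Submodule.smul_mem _ _ (X_pow_mem_degreeLT (by have := Finset.mem_range.1 hm; omega))
  · rw [derivative_sum]
    refine Polynomial.funext fun x => ?_
    rw [eval_eq_sum_of_mem_degreeLT hp, eval_finsetSum]
    refine Finset.sum_congr rfl fun m _ => ?_
    have : (m : ℝ) + 1 ≠ 0 := by positivity
    simp
    field_simp

/-- Cauchy–Schwarz for continuous functions on an interval. -/
theorem sq_integral_mul_le {l r : ℝ} (hlr : l ≤ r) {f g : ℝ → ℝ} (hf : ContinuousOn f (Icc l r))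
    (hg : ContinuousOn g (Icc l r)) :
    (∫ x in l..r, f x * g x) ^ 2 ≤ (∫ x in l..r, f x ^ 2) * ∫ x in l..r, g x ^ 2 := by
  rw [← uIcc_of_le hlr] at hf hg
  set a := ∫ x in l..r, f x ^ 2
  set b := ∫ x in l..r, f x * g x
  set c := ∫ x in l..r, g x ^ 2
  have key : ∀ s t : ℝ, 0 ≤ s ^ 2 * a - 2 * s * t * b + t ^ 2 * c := by
    intro s t
    have h0 : 0 ≤ ∫ x in l..r, (s * f x - t * g x) ^ 2 :=
      intervalIntegral.integral_nonneg hlr fun x _ => sq_nonneg _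
    have e : (∫ x in l..r, (s * f x - t * g x) ^ 2) = s ^ 2 * a - 2 * s * t * b + t ^ 2 * c := by
      have : ∀ x, (s * f x - t * g x) ^ 2
          = s ^ 2 * f x ^ 2 - (2 * s * t) * (f x * g x) + t ^ 2 * g x ^ 2 := fun x => by ring
      simp_rw [this]
      have i1 : IntervalIntegrable (fun x => s ^ 2 * f x ^ 2) volume l r :=
        ((hf.pow 2).intervalIntegrable).const_mul _
      have i2 : IntervalIntegrable (fun x => (2 * s * t) * (f x * g x)) volume l r :=
        ((hf.mul hg).intervalIntegrable).const_mul _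
      have i3 : IntervalIntegrable (fun x => t ^ 2 * g x ^ 2) volume l r :=
        ((hg.pow 2).intervalIntegrable).const_mul _
      rw [intervalIntegral.integral_add (i1.sub i2) i3, intervalIntegral.integral_sub i1 i2]
      simp only [intervalIntegral.integral_const_mul, a, b, c]
    rwa [e] at h0
  have hc : 0 ≤ c := intervalIntegral.integral_nonneg hlr fun x _ => sq_nonneg _
  rcases hc.eq_or_lt with hc | hc
  · have ha : 0 ≤ a := intervalIntegral.integral_nonneg hlr fun x _ => sq_nonneg _
    have hb : b = 0 := by
      by_contra hb
      -- With c = 0 this choice makes the quadratic form equal to a - 2(a + 1) < 0.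
      have h1 := key 1 ((a + 1) / b)
      have h2 : 2 * 1 * ((a + 1) / b) * b = 2 * (a + 1) := by field_simp
      rw [← hc, h2] at h1
      linarith
    rw [hb, ← hc]
    simp
  · have h1 := key c b
    have h2 : 0 ≤ c * (a * c - b ^ 2) := by nlinarith
    nlinarith [nonneg_of_mul_nonneg_right h2 hc]

theorem eq_zero_of_integral_sq_eq_zero {l r : ℝ} (hlr : l < r) {p : ℝ[X]}
    (h : ∫ x in l..r, p.eval x ^ 2 = 0) : p = 0 := by
  by_contra hp
  have hev : ∀ x ∈ Icc l r, p.eval x = 0 := by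
    intro x hx
    by_contra hne
    have : 0 < ∫ x in l..r, p.eval x ^ 2 :=
      intervalIntegral.integral_pos hlr (p.continuous.pow 2).continuousOn
        (fun y _ => sq_nonneg _) ⟨x, hx, by positivity⟩
    linarith
  refine hp (Polynomial.eq_zero_of_infinite_isRoot p ((Icc_infinite hlr).mono fun x hx => ?_))
  exact hev x hx

theorem integral_mul_eq_zero_of_monomials {l r : ℝ} {n : ℕ} {f : ℝ → ℝ}
    (hf : IntervalIntegrable f volume l r)
    (h : ∀ m < n, ∫ x in l..r, f x * x ^ m = 0) {v : ℝ[X]} (hv : v ∈ degreeLT ℝ n) :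
    ∫ x in l..r, f x * v.eval x = 0 := by
  simp_rw [eval_eq_sum_of_mem_degreeLT hv, Finset.mul_sum]
  rw [intervalIntegral.integral_finsetSum]
  · refine Finset.sum_eq_zero fun m hm => ?_
    have : ∀ x, f x * (v.coeff m * x ^ m) = v.coeff m * (f x * x ^ m) := fun x => by ring
    simp_rw [this, intervalIntegral.integral_const_mul, h m (Finset.mem_range.1 hm), mul_zero]
  · intro m _
    exact hf.mul_continuousOn (by fun_prop)

/-- On the unit interval, a polynomial of degree at most `k` is controlled by its moments of order
less than `k` and its value at the right end. -/
theorem exists_unit_bound_of_moments (k : ℕ) : ∃ K : ℝ, 0 < K ∧ ∀ p ∈ degreeLT ℝ (k + 1),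
    ∀ Z : ℝ, 0 ≤ Z → (∀ m < k, |∫ x in (0 : ℝ)..1, p.eval x * x ^ m| ≤ Z) → |p.eval 1| ≤ Z →
      ∀ x ∈ Icc (0 : ℝ) 1, |p.eval x| ≤ K * Z ∧ |(derivative p).eval x| ≤ K * Z := by
  obtain ⟨K, hK0, hK⟩ := exists_coeff_bound (k + 1)
    (fun i : Option (Fin k) => i.elim (Polynomial.leval 1)
      fun m => momentL 0 1 (X ^ (m : ℕ))) (by
    intro p hp h0
    have h1 : p.eval 1 = 0 := h0 none
    have h2 : ∀ m < k, ∫ x in (0 : ℝ)..1, p.eval x * x ^ m = 0 := by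
      intro m hm
      have := h0 (some ⟨m, hm⟩)
      simpa [momentL_apply] using this
    -- Splitting off the root 1 leaves a quotient r of degree less than k, which is an admissible
    -- test function. The moment condition becomes ∫ (1 - x) r² = 0 and forces r = 0.
    obtain ⟨r, hr⟩ := dvd_iff_isRoot.2 h1
    have hrk : r ∈ degreeLT ℝ k := by
      rw [mem_degreeLT] at hp ⊢
      by_cases hr0 : r = 0
      · simp only [hr0, degree_zero]
        exact WithBot.bot_lt_coe k
      · rw [hr, degree_mul, degree_X_sub_C, degree_eq_natDegree hr0] at hp
        rw [degree_eq_natDegree hr0]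
        have : 1 + r.natDegree < k + 1 := by exact_mod_cast hp
        exact_mod_cast (by omega : r.natDegree < k)
    have h3 := integral_mul_eq_zero_of_monomials (intervalIntegrable_eval p 0 1) h2 hrk
    have hr0 : r = 0 := by
      by_contra hr0
      have h4 : ∃ x ∈ Ioo (0 : ℝ) 1, r.eval x ≠ 0 := by
        by_contra hcon
        push Not at hcon
        exact hr0 (Polynomial.eq_zero_of_infinite_isRoot r
          ((Ioo_infinite one_pos).mono fun x hx => hcon x hx))
      obtain ⟨x, hx, hxr⟩ := h4
      have : 0 < ∫ x in (0 : ℝ)..1, (1 - x) * r.eval x ^ 2 :=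
        intervalIntegral.integral_pos one_pos (by fun_prop)
          (fun y hy => mul_nonneg (by linarith [hy.2]) (sq_nonneg _))
          ⟨x, ⟨hx.1.le, hx.2.le⟩, mul_pos (by linarith [hx.2]) (by positivity)⟩
      have e : (∫ x in (0 : ℝ)..1, (1 - x) * r.eval x ^ 2)
          = -∫ x in (0 : ℝ)..1, p.eval x * r.eval x := by
        rw [← intervalIntegral.integral_neg]
        congr 1
        ext x
        rw [hr]
        simp
        ring
      rw [e, h3] at this
      simp at this
    rw [hr, hr0, mul_zero])
  -- One factor k + 1 comes from summing the coefficients, the other from differentiating the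
  -- monomials.
  refine ⟨(k + 1 : ℕ) * ((k + 1 : ℕ) * K), by positivity, fun p hp Z hZ hm h1 x hx => ?_⟩
  have hc : ∀ m, |p.coeff m| ≤ K * Z := by
    refine hK p hp Z hZ fun i => ?_
    cases i with
    | none => exact h1
    | some m => simpa [momentL_apply] using hm m m.2
  have hKZ : 0 ≤ K * Z := by positivity
  have hk1 : (1 : ℝ) ≤ (k + 1 : ℕ) := by push_cast; linarith [Nat.cast_nonneg (α := ℝ) k]
  constructor
  · have := abs_eval_le_of_coeff hp hc hx
    have h3 : ((k + 1 : ℕ) : ℝ) * (K * Z) ≤ (k + 1 : ℕ) * ((k + 1 : ℕ) * (K * Z)) := by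
      apply mul_le_mul_of_nonneg_left _ (by positivity)
      nlinarith
    linarith
  · have h2 : ∀ m, |(derivative p).coeff m| ≤ (k + 1 : ℕ) * (K * Z) := by
      intro m
      by_cases hmk : m < k + 1
      · rw [coeff_derivative, abs_mul, mul_comm]
        have : |(m : ℝ) + 1| ≤ (k + 1 : ℕ) := by
          rw [abs_of_nonneg (by positivity)]
          exact_mod_cast hmk
        exact mul_le_mul this (hc _) (abs_nonneg _) (by positivity)
      · have : (derivative p).coeff m = 0 := by
          apply coeff_eq_zero_of_degree_lt
          refine (mem_degreeLT.1 (derivative_mem_degreeLT hp)).trans_le ?_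
          exact_mod_cast (by omega : k ≤ m)
        rw [this, abs_zero]
        positivity
    have := abs_eval_le_of_coeff (degreeLT_le (Nat.le_succ k) (derivative_mem_degreeLT hp)) h2 hx
    linarith

/-! ### Scaling from the unit interval to a cell. -/

/-- The affine pull-back of a polynomial to the unit interval. -/
def pull (l h : ℝ) (p : ℝ[X]) : ℝ[X] := p.comp (C h * X + C l)

theorem pull_eval (l h : ℝ) (p : ℝ[X]) (x : ℝ) : (pull l h p).eval x = p.eval (h * x + l) := by
  simp [pull]

theorem pull_mem {n : ℕ} (l h : ℝ) {p : ℝ[X]} (hp : p ∈ degreeLT ℝ n) :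
    pull l h p ∈ degreeLT ℝ n := by
  rcases Nat.eq_zero_or_pos n with rfl | hn
  · have : p = 0 := by simpa [mem_degreeLT, Polynomial.degree_eq_bot] using hp
    simp [this, pull]
  · rw [mem_degreeLT] at hp ⊢
    rw [← natDegree_lt_iff_degree_lt_of_pos hn] at hp ⊢
    refine lt_of_le_of_lt ?_ hp
    calc (pull l h p).natDegree ≤ p.natDegree * (C h * X + C l : ℝ[X]).natDegree :=
          natDegree_comp_le
      _ ≤ p.natDegree * 1 := Nat.mul_le_mul_left _ natDegree_linear_le
      _ = _ := mul_one _

theorem integral_pull {l h : ℝ} (f : ℝ → ℝ) :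
    h * (∫ s in (0 : ℝ)..1, f (h * s + l)) = ∫ x in l..(l + h), f x := by
  have := intervalIntegral.smul_integral_comp_mul_add (a := 0) (b := 1) f h l
  rw [smul_eq_mul] at this
  rw [this]
  congr 1 <;> ring

/-- A polynomial of degree at most `k` on a cell is controlled by the moments of order less than
`k` and its value at the right end. -/
theorem exists_cell_bound_of_moments (k : ℕ) : ∃ K : ℝ, 0 < K ∧ ∀ p ∈ degreeLT ℝ (k + 1),
    ∀ l r : ℝ, l < r → ∀ Z : ℝ, 0 ≤ Z →
      (∀ v ∈ degreeLT ℝ k, |∫ x in l..r, p.eval x * v.eval x| ≤ Z * ∫ x in l..r, |v.eval x|) →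
      ∀ x ∈ Icc l r, |p.eval x| ≤ K * (Z + |p.eval r|) ∧
        (r - l) * |(derivative p).eval x| ≤ K * (Z + |p.eval r|) := by
  obtain ⟨K, hK0, hK⟩ := exists_unit_bound_of_moments k
  refine ⟨K, hK0, fun p hp l r hlr Z hZ hv x hx => ?_⟩
  have hh : 0 < r - l := sub_pos.2 hlr
  set h := r - l with hdef
  have hr : l + h = r := by rw [hdef]; ring
  have h1 := hK (pull l h p) (pull_mem l h hp) (Z + |p.eval r|) (by positivity) (by
    intro m hm
    -- The test polynomial is the monomial in the normalised variable (x - l) / h. The hypothesis is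
    -- scale invariant because Z is multiplied by the L¹ norm of the test function.
    have hw : pull (-l / h) h⁻¹ (X ^ m) ∈ degreeLT ℝ k := pull_mem _ _ (X_pow_mem_degreeLT hm)
    have h2 := hv _ hw
    rw [← hr, ← integral_pull (fun x => p.eval x * (pull (-l / h) h⁻¹ (X ^ m)).eval x),
      ← integral_pull (fun x => |(pull (-l / h) h⁻¹ (X ^ m)).eval x|)] at h2
    have e : ∀ s : ℝ, (pull (-l / h) h⁻¹ (X ^ m)).eval (h * s + l) = s ^ m := by
      intro s
      rw [pull_eval]
      simp only [eval_pow, eval_X]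
      congr 1
      field_simp
      ring
    simp_rw [e] at h2
    have h3 : (∫ s in (0 : ℝ)..1, |s ^ m|) ≤ 1 := by
      have : (∫ s in (0 : ℝ)..1, |s ^ m|) ≤ ∫ s in (0 : ℝ)..1, (1 : ℝ) := by
        refine intervalIntegral.integral_mono_on zero_le_one ?_ ?_ ?_
        · exact (by fun_prop : Continuous fun s : ℝ => |s ^ m|).intervalIntegrable _ _
        · exact intervalIntegrable_const
        · intro s hs
          rw [abs_of_nonneg (pow_nonneg hs.1 _)]
          exact pow_le_one₀ hs.1 hs.2
      simpa using this
    rw [abs_mul, abs_of_pos hh] at h2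
    simp_rw [pull_eval]
    have h4 : h * |∫ s in (0 : ℝ)..1, p.eval (h * s + l) * s ^ m| ≤ h * Z := by
      refine h2.trans ?_
      calc Z * (h * ∫ s in (0 : ℝ)..1, |s ^ m|) ≤ Z * (h * 1) := by gcongr
        _ = h * Z := by ring
    have h5 := le_of_mul_le_mul_left h4 hh
    linarith [abs_nonneg (p.eval r)]) (by
    rw [pull_eval, mul_one, add_comm, hr]
    linarith) ((x - l) / h) ⟨div_nonneg (by linarith [hx.1]) hh.le,
      (div_le_one hh).2 (by linarith [hx.2])⟩
  have e1 : h * ((x - l) / h) + l = x := by field_simp; ring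
  rw [pull_eval, e1] at h1
  refine ⟨h1.1, ?_⟩
  have e2 : (derivative (pull l h p)).eval ((x - l) / h) = h * (derivative p).eval x := by
    rw [pull, derivative_comp, eval_mul, eval_comp]
    have : (C h * X + C l : ℝ[X]).eval ((x - l) / h) = x := by simpa using e1
    rw [this]
    simp
  rw [e2, abs_mul, abs_of_pos hh] at h1
  exact h1.2

/-- If the moments of order less than `k` are at most `Z`, the values of `p` at the two ends have
almost the same size. -/
theorem exists_endpoint_bound (k : ℕ) : ∃ K : ℝ, 0 < K ∧ ∀ p ∈ degreeLT ℝ (k + 1),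
    ∀ l r : ℝ, l < r → ∀ Z : ℝ, 0 ≤ Z →
      (∀ v ∈ degreeLT ℝ k, |∫ x in l..r, p.eval x * v.eval x| ≤ Z * ∫ x in l..r, |v.eval x|) →
      (∀ x ∈ Icc l r, |p.eval x| ≤ K * (Z + |p.eval r|)) ∧
      |p.eval l| ≤ |p.eval r| + K * Z ∧ |p.eval r| ≤ |p.eval l| + K * Z := by
  obtain ⟨K, hK0, hK⟩ := exists_cell_bound_of_moments k
  refine ⟨2 * K + 1, by positivity, fun p hp l r hlr Z hZ hv => ?_⟩
  have hb := hK p hp l r hlr Z hZ hv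
  have hh : 0 < r - l := sub_pos.2 hlr
  set y := |p.eval r| with hy
  have hy0 : 0 ≤ y := abs_nonneg _
  have hd : ∫ x in l..r, |(derivative p).eval x| ≤ K * (Z + y) := by
    have : ∫ x in l..r, |(derivative p).eval x| ≤ ∫ x in l..r, K * (Z + y) / (r - l) := by
      refine intervalIntegral.integral_mono_on hlr.le ?_ ?_ ?_
      · exact ((derivative p).continuous.abs).intervalIntegrable _ _
      · exact intervalIntegrable_const
      · intro x hx
        rw [le_div_iff₀ hh, mul_comm]
        exact (hb x hx).2
    rw [intervalIntegral.integral_const, smul_eq_mul, mul_div_cancel₀ _ hh.ne'] at this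
    exact this
  -- The decisive choice of test function: p' has degree less than k, and 2∫ p p' is the difference
  -- of the squared end values. That difference is at most 2ZK(Z + |p(r)|), only linear in |p(r)|,
  -- so the end values themselves differ by O(Z).
  have hm := hv _ (derivative_mem_degreeLT hp)
  have hsq : p.eval r ^ 2 - p.eval l ^ 2 = 2 * ∫ x in l..r, p.eval x * (derivative p).eval x := by
    rw [← intervalIntegral.integral_const_mul]
    rw [intervalIntegral.integral_eq_sub_of_hasDerivAt (f := fun x => p.eval x ^ 2)]
    · intro x _
      exact ((p.hasDerivAt x).fun_pow 2).congr_deriv (by norm_num; ring)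
    · exact ((by fun_prop : Continuous fun x => 2 * (p.eval x * (derivative p).eval x))
        ).intervalIntegrable _ _
  have hm2 : |∫ x in l..r, p.eval x * (derivative p).eval x| ≤ Z * (K * (Z + y)) :=
    hm.trans (mul_le_mul_of_nonneg_left hd hZ)
  rw [abs_le] at hm2
  have hyr : p.eval r ^ 2 = y ^ 2 := (sq_abs _).symm
  set w := |p.eval l| with hw
  have hw0 : 0 ≤ w := abs_nonneg _
  have hwl : p.eval l ^ 2 = w ^ 2 := (sq_abs _).symm
  rw [hyr, hwl] at hsq
  have hKZ : 0 ≤ K * Z := by positivity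
  refine ⟨fun x hx => (hb x hx).1.trans ?_, ?_, ?_⟩
  · have : 0 ≤ Z + y := by positivity
    nlinarith
  · apply le_of_sq_le_sq _ (by positivity)
    nlinarith [mul_nonneg hKZ hy0, mul_nonneg hZ hy0, mul_nonneg hKZ hZ, mul_nonneg hKZ hKZ,
      mul_nonneg hZ hZ]
  · by_contra hcon
    push Not at hcon
    nlinarith [mul_nonneg hKZ hy0, mul_nonneg hZ hy0, mul_nonneg hKZ hZ, mul_nonneg hKZ hKZ,
      mul_nonneg hZ hZ, mul_nonneg hKZ hw0, mul_nonneg hZ hw0]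

/-- Inverse estimate between the maximum norm and the `L²` norm on a cell. -/
theorem exists_sq_eval_le (n : ℕ) : ∃ K : ℝ, 0 < K ∧ ∀ p ∈ degreeLT ℝ n,
    ∀ l r : ℝ, l < r → ∀ x ∈ Icc l r,
      (r - l) * p.eval x ^ 2 ≤ K * ∫ y in l..r, p.eval y ^ 2 := by
  obtain ⟨K, hK0, hK⟩ := exists_coeff_bound n (fun m : Fin n => momentL 0 1 (X ^ (m : ℕ))) (by
    intro p hp h0
    have h2 : ∀ m < n, ∫ x in (0 : ℝ)..1, p.eval x * x ^ m = 0 := by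
      intro m hm
      simpa [momentL_apply] using h0 ⟨m, hm⟩
    have h3 := integral_mul_eq_zero_of_monomials (intervalIntegrable_eval p 0 1) h2 hp
    apply eq_zero_of_integral_sq_eq_zero one_pos
    simpa [sq] using h3)
  -- The summand 1 keeps the constant positive for n = 0.
  refine ⟨(n * K) ^ 2 + 1, by positivity, fun p hp l r hlr x hx => ?_⟩
  have hh : 0 < r - l := sub_pos.2 hlr
  set h := r - l with hdef
  have hr : l + h = r := by rw [hdef]; ring
  set S := ∫ s in (0 : ℝ)..1, (pull l h p).eval s ^ 2 with hS
  have hS0 : 0 ≤ S := intervalIntegral.integral_nonneg zero_le_one fun _ _ => sq_nonneg _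
  have hc := hK (pull l h p) (pull_mem l h hp) (√S) (Real.sqrt_nonneg _) (by
    intro m
    apply Real.abs_le_sqrt
    rw [momentL_apply]
    have h1 := sq_integral_mul_le zero_le_one (f := fun s => (pull l h p).eval s)
      (g := fun s => (X ^ (m : ℕ) : ℝ[X]).eval s) (by fun_prop) (by fun_prop)
    refine h1.trans ?_
    have h2 : (∫ s in (0 : ℝ)..1, (X ^ (m : ℕ) : ℝ[X]).eval s ^ 2) ≤ 1 := by
      have : (∫ s in (0 : ℝ)..1, (X ^ (m : ℕ) : ℝ[X]).eval s ^ 2) ≤ ∫ s in (0 : ℝ)..1, (1 : ℝ) := by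
        refine intervalIntegral.integral_mono_on zero_le_one ?_ ?_ ?_
        · exact ((X ^ (m : ℕ) : ℝ[X]).continuous.pow 2).intervalIntegrable _ _
        · exact intervalIntegrable_const
        · intro s hs
          simp only [eval_pow, eval_X]
          exact pow_le_one₀ (pow_nonneg hs.1 _) (pow_le_one₀ hs.1 hs.2)
      simpa using this
    calc S * _ ≤ S * 1 := mul_le_mul_of_nonneg_left h2 hS0
      _ = S := mul_one S)
  have h1 := abs_eval_le_of_coeff (pull_mem l h hp) hc (x := (x - l) / h)
    ⟨div_nonneg (by linarith [hx.1]) hh.le, (div_le_one hh).2 (by linarith [hx.2])⟩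
  have e1 : h * ((x - l) / h) + l = x := by field_simp; ring
  rw [pull_eval, e1] at h1
  have h2 : p.eval x ^ 2 ≤ (n * K) ^ 2 * S := by
    calc p.eval x ^ 2 = |p.eval x| ^ 2 := (sq_abs _).symm
      _ ≤ (n * (K * √S)) ^ 2 := by gcongr
      _ = (n * K) ^ 2 * (√S) ^ 2 := by ring
      _ = _ := by rw [Real.sq_sqrt hS0]
  have e2 : h * S = ∫ y in l..r, p.eval y ^ 2 := by
    rw [hS, ← hr, ← integral_pull (fun y => p.eval y ^ 2)]
    simp_rw [pull_eval]
  rw [← e2]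
  nlinarith [mul_le_mul_of_nonneg_left h2 hh.le, mul_nonneg hh.le hS0]

/-- Interpolation at nodes in a given interval. -/
theorem exists_interpolation (n : ℕ) {l r : ℝ} (hlr : l < r) :
    ∃ (x : Fin n → ℝ) (b : Fin n → ℝ[X]), (∀ i, x i ∈ Icc l r) ∧ (∀ i, b i ∈ degreeLT ℝ n) ∧
      ∀ p ∈ degreeLT ℝ n, ∀ y, p.eval y = ∑ i, p.eval (x i) * (b i).eval y := by
  obtain ⟨s, hs, hcard⟩ := (Icc_infinite hlr).exists_subset_card_eq n
  set e := s.equivFinOfCardEq hcard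
  have hinj : Set.InjOn (fun i => (e.symm i : ℝ)) (Finset.univ : Finset (Fin n)) := by
    intro i _ j _ hij
    exact e.symm.injective (Subtype.ext hij)
  refine ⟨fun i => (e.symm i : ℝ),
    fun i => Lagrange.basis Finset.univ (fun i => (e.symm i : ℝ)) i,
    fun i => hs (e.symm i).2, fun i => ?_, fun p hp y => ?_⟩
  · rw [mem_degreeLT, Lagrange.degree_basis hinj (Finset.mem_univ i), Finset.card_univ,
      Fintype.card_fin]
    have : 0 < n := i.pos
    exact_mod_cast (by omega : n - 1 < n)
  · have h1 := Lagrange.eq_interpolate (f := p) hinj (by simpa [mem_degreeLT] using hp)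
    conv_lhs => rw [h1]
    rw [Lagrange.interpolate_apply, eval_finsetSum]
    simp

/-- Taylor approximation from the left end of an interval. -/
theorem exists_poly_approx {l r : ℝ} (hlr : l ≤ r) (M : ℝ) (n : ℕ) : ∀ F : ℕ → ℝ → ℝ,
    (∀ i < n, ∀ x ∈ Icc l r, HasDerivWithinAt (F i) (F (i + 1) x) (Icc l r) x) →
    (∀ x ∈ Icc l r, |F n x| ≤ M) →
    ∃ p ∈ degreeLT ℝ n, ∀ x ∈ Icc l r, |F 0 x - p.eval x| ≤ M * (r - l) ^ n := by
  induction n with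
  | zero =>
    intro F _ hM
    exact ⟨0, Submodule.zero_mem _, fun x hx => by simpa using hM x hx⟩
  | succ n ih =>
    intro F hF hM
    -- The derivative is approximated first. Its approximation is integrated with the constant that
    -- makes the error vanish at l, and the mean value inequality then supplies the next factor r -
    -- l.
    obtain ⟨p, hp, hpM⟩ := ih (fun i => F (i + 1)) (fun i hi => hF (i + 1) (by omega)) hM
    obtain ⟨P, hP, hPp⟩ := exists_antiderivative hp
    refine ⟨P + C (F 0 l - P.eval l), Submodule.add_mem _ hP ?_, fun x hx => ?_⟩
    · rw [mem_degreeLT]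
      exact degree_C_le.trans_lt (by exact_mod_cast Nat.succ_pos n)
    · have hder : ∀ y ∈ Icc l r, HasDerivWithinAt
          (fun y => F 0 y - (P + C (F 0 l - P.eval l)).eval y) (F 1 y - p.eval y) (Icc l r) y := by
        intro y hy
        refine (hF 0 (by omega) y hy).sub ?_
        have := ((P + C (F 0 l - P.eval l)).hasDerivAt y).hasDerivWithinAt (s := Icc l r)
        simpa [hPp] using this
      have := (convex_Icc l r).norm_image_sub_le_of_norm_hasDerivWithin_le hder
        (fun y hy => by simpa using hpM y hy) (left_mem_Icc.2 hlr) hx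
      have e : F 0 l - (P + C (F 0 l - P.eval l)).eval l = 0 := by simp
      rw [e, sub_zero, Real.norm_eq_abs, Real.norm_eq_abs, abs_of_nonneg (sub_nonneg.2 hx.1)]
        at this
      refine this.trans ?_
      have h0 : 0 ≤ M * (r - l) ^ n := (abs_nonneg _).trans (hpM l (left_mem_Icc.2 hlr))
      calc M * (r - l) ^ n * (x - l) ≤ M * (r - l) ^ n * (r - l) := by
            apply mul_le_mul_of_nonneg_left _ h0
            linarith [hx.2]
        _ = _ := by ring

namespace Mesh

variable (𝓜 : Mesh)

/-! ## Meshes -/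

theorem N_pos : 0 < 𝓜.N := by
  rcases Nat.eq_zero_or_pos 𝓜.N with h | h
  · exfalso
    have h1 : (Fin.last 𝓜.N) = 0 := by
      ext
      simp [h]
    have h2 := 𝓜.node_last
    rw [h1, 𝓜.node_first] at h2
    linarith [Real.pi_pos]
  · exact h

theorem nonempty_cells : Nonempty (Fin 𝓜.N) := ⟨⟨0, 𝓜.N_pos⟩⟩

theorem left_lt_right (j : Fin 𝓜.N) : 𝓜.left j < 𝓜.right j :=
  𝓜.strictMono_node (Fin.castSucc_lt_succ)

theorem left_le_right (j : Fin 𝓜.N) : 𝓜.left j ≤ 𝓜.right j := (𝓜.left_lt_right j).le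

/-- The closed cell with index `j`. -/
def cell (j : Fin 𝓜.N) : Set ℝ := Icc (𝓜.left j) (𝓜.right j)

theorem left_mem_cell (j : Fin 𝓜.N) : 𝓜.left j ∈ 𝓜.cell j := left_mem_Icc.2 (𝓜.left_le_right j)

theorem right_mem_cell (j : Fin 𝓜.N) : 𝓜.right j ∈ 𝓜.cell j := right_mem_Icc.2 (𝓜.left_le_right j)

theorem cell_subset (j : Fin 𝓜.N) : 𝓜.cell j ⊆ Icc 0 (2 * π) := by
  refine Icc_subset_Icc ?_ ?_
  · rw [← 𝓜.node_first]
    exact 𝓜.strictMono_node.monotone (Fin.zero_le _)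
  · rw [← 𝓜.node_last]
    exact 𝓜.strictMono_node.monotone (Fin.le_last _)

theorem size_pos (j : Fin 𝓜.N) : 0 < 𝓜.size j := sub_pos.2 (𝓜.left_lt_right j)

theorem size_le_maxSize (j : Fin 𝓜.N) : 𝓜.size j ≤ 𝓜.maxSize :=
  le_ciSup (Finite.bddAbove_range 𝓜.size) j

theorem maxSize_pos : 0 < 𝓜.maxSize := by
  obtain ⟨j⟩ := 𝓜.nonempty_cells
  exact (𝓜.size_pos j).trans_le (𝓜.size_le_maxSize j)

theorem sum_size : ∑ j, 𝓜.size j = 2 * π := by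
  have h : ∀ (n : ℕ) (f : Fin (n + 1) → ℝ),
      ∑ j : Fin n, (f j.succ - f j.castSucc) = f (Fin.last n) - f 0 := by
    intro n
    induction n with
    | zero => intro f; simp
    | succ n ih =>
      intro f
      rw [Fin.sum_univ_castSucc]
      have := ih (fun i => f i.castSucc)
      simp only [Fin.succ_castSucc] at this ⊢
      rw [this]
      simp
  have h1 := h 𝓜.N 𝓜.node
  rw [𝓜.node_first, 𝓜.node_last, sub_zero] at h1
  exact h1

/-- Converts the weight 1/N of the discrete norm into the mesh size. -/
theorem two_pi_le : 2 * π ≤ 𝓜.N * 𝓜.maxSize := by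
  rw [← 𝓜.sum_size]
  calc ∑ j, 𝓜.size j ≤ ∑ _j : Fin 𝓜.N, 𝓜.maxSize :=
        Finset.sum_le_sum fun j _ => 𝓜.size_le_maxSize j
    _ = _ := by simp

theorem next_prev (j : Fin 𝓜.N) : 𝓜.next (𝓜.prev j) = j := (finRotate 𝓜.N).apply_symm_apply j

theorem prev_next (j : Fin 𝓜.N) : 𝓜.prev (𝓜.next j) = j := (finRotate 𝓜.N).symm_apply_apply j

theorem sum_next (f : Fin 𝓜.N → ℝ) : ∑ j, f (𝓜.next j) = ∑ j, f j :=
  Equiv.sum_comp (finRotate 𝓜.N) f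

theorem left_next (j : Fin 𝓜.N) : 𝓜.left (𝓜.next j) = 𝓜.right j ∨
    (𝓜.right j = 2 * π ∧ 𝓜.left (𝓜.next j) = 0) := by
  obtain ⟨N, node, h1, h2, h3⟩ := 𝓜
  simp only [left, right, next]
  cases N with
  | zero => exact j.elim0
  | succ n =>
    rcases eq_or_ne j (Fin.last n) with rfl | hj
    · right
      rw [finRotate_last]
      exact ⟨by simpa using h3, by simpa using h2⟩
    · left
      congr 1
      have hlt : (j : ℕ) < n := lt_of_le_of_ne (Nat.lt_succ_iff.1 j.2) fun h => hj (Fin.ext h)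
      ext
      exact coe_finRotate_of_ne_last hj

theorem eval_left_next {f : ℝ → ℝ} (hf : f 0 = f (2 * π)) (j : Fin 𝓜.N) :
    f (𝓜.left (𝓜.next j)) = f (𝓜.right j) := by
  rcases 𝓜.left_next j with h | ⟨h1, h2⟩
  · rw [h]
  · rw [h1, h2, hf]

theorem avg_restrict {f : ℝ → ℝ} (hf : f 0 = f (2 * π)) (θ : ℝ) (j : Fin 𝓜.N) :
    𝓜.avg θ (𝓜.restrict f) j = f (𝓜.right j) := by
  simp only [avg, restrict, 𝓜.eval_left_next hf]
  ring

theorem avg_add (θ : ℝ) (v w : 𝓜.Broken) (j : Fin 𝓜.N) :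
    𝓜.avg θ (v + w) j = 𝓜.avg θ v j + 𝓜.avg θ w j := by
  simp only [avg, Pi.add_apply]; ring

theorem avg_sub (θ : ℝ) (v w : 𝓜.Broken) (j : Fin 𝓜.N) :
    𝓜.avg θ (v - w) j = 𝓜.avg θ v j - 𝓜.avg θ w j := by
  simp only [avg, Pi.sub_apply]; ring

theorem avg_smul (θ c : ℝ) (v : 𝓜.Broken) (j : Fin 𝓜.N) :
    𝓜.avg θ (c • v) j = c * 𝓜.avg θ v j := by
  simp only [avg, Pi.smul_apply, smul_eq_mul]; ring

theorem avg_sum {ι : Type*} (s : Finset ι) (θ : ℝ) (v : ι → 𝓜.Broken) (j : Fin 𝓜.N) :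
    𝓜.avg θ (∑ i ∈ s, v i) j = ∑ i ∈ s, 𝓜.avg θ (v i) j := by
  simp only [avg, Finset.sum_apply, Finset.mul_sum, Finset.sum_add_distrib]

theorem avg_congr {v w : 𝓜.Broken} (h : ∀ j, EqOn (v j) (w j) (𝓜.cell j)) (θ : ℝ) (j : Fin 𝓜.N) :
    𝓜.avg θ v j = 𝓜.avg θ w j := by
  simp only [avg, h _ (𝓜.right_mem_cell _), h _ (𝓜.left_mem_cell _)]

theorem abs_avg_le (θ : ℝ) {v : 𝓜.Broken} {M : ℝ} (h : ∀ j, ∀ x ∈ 𝓜.cell j, |v j x| ≤ M)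
    (j : Fin 𝓜.N) : |𝓜.avg θ v j| ≤ (|θ| + |1 - θ|) * M := by
  have h1 := h _ _ (𝓜.right_mem_cell j)
  have h2 := h _ _ (𝓜.left_mem_cell (𝓜.next j))
  calc |𝓜.avg θ v j| ≤ |θ * v j (𝓜.right j)|
        + |(1 - θ) * v (𝓜.next j) (𝓜.left (𝓜.next j))| := abs_add_le _ _
    _ = |θ| * |v j (𝓜.right j)| + |1 - θ| * |v (𝓜.next j) (𝓜.left (𝓜.next j))| := by
        rw [abs_mul, abs_mul]
    _ ≤ |θ| * M + |1 - θ| * M := by gcongr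
    _ = _ := by ring

/-- Continuity of a piecewise function on every closed cell. -/
def CellCont (v : 𝓜.Broken) : Prop := ∀ j, ContinuousOn (v j) (𝓜.cell j)

theorem cellCont_toBroken (p : 𝓜.PiecePoly) : 𝓜.CellCont (𝓜.toBroken p) :=
  fun j => (p j).continuous.continuousOn

variable {𝓜}

theorem CellCont.intervalIntegrable {v : 𝓜.Broken} (hv : 𝓜.CellCont v) (j : Fin 𝓜.N) :
    IntervalIntegrable (v j) volume (𝓜.left j) (𝓜.right j) :=
  ContinuousOn.intervalIntegrable_of_Icc (𝓜.left_le_right j) (hv j)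

theorem CellCont.add {v w : 𝓜.Broken} (hv : 𝓜.CellCont v) (hw : 𝓜.CellCont w) :
    𝓜.CellCont (v + w) := fun j => (hv j).add (hw j)

theorem CellCont.sub {v w : 𝓜.Broken} (hv : 𝓜.CellCont v) (hw : 𝓜.CellCont w) :
    𝓜.CellCont (v - w) := fun j => (hv j).sub (hw j)

theorem CellCont.smul {v : 𝓜.Broken} (hv : 𝓜.CellCont v) (c : ℝ) :
    𝓜.CellCont (c • v) := fun j => (hv j).const_smul c

variable (𝓜)

/-! ## Gauss–Radau projections -/

/-- The stability of the Gauss–Radau projection in the maximum norm. -/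
theorem exists_radau_bound (k : ℕ) {θ : ℝ} (hθ : θ ≠ 1 / 2) : ∃ K : ℝ, 0 < K ∧
    ∀ (𝓜 : Mesh) (z : 𝓜.Broken) (g : Fin 𝓜.N → ℝ) (p : 𝓜.PiecePoly) (Z : ℝ), 0 ≤ Z →
      𝓜.CellCont z → (∀ j, ∀ x ∈ 𝓜.cell j, |z j x| ≤ Z) → (∀ j, |g j| ≤ Z) →
      𝓜.IsRadau k θ z g p → ∀ j, ∀ x ∈ 𝓜.cell j, |(p j).eval x| ≤ K * Z := by
  obtain ⟨K, hK0, hK⟩ := exists_endpoint_bound k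
  -- The only place where θ ≠ 1/2 enters the stability: one of the two traces at a node carries the
  -- strictly larger weight, and the node condition bounds it by the other one.
  have hδ : |θ| - |1 - θ| ≠ 0 := by
    intro h
    rcases abs_eq_abs.1 (sub_eq_zero.1 h) with h | h
    · exact hθ (by linarith)
    · linarith
  set δ := abs (|θ| - |1 - θ|) with hδd
  have hδ0 : 0 < δ := abs_pos.2 hδ
  refine ⟨K * (1 + (1 + |1 - θ| * K) / δ), by positivity, ?_⟩
  intro 𝓜 z g p Z hZ hzc hz hg hp j x hx
  have hmom : ∀ j, ∀ v ∈ degreeLT ℝ k,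
      |∫ x in 𝓜.left j..𝓜.right j, (p j).eval x * v.eval x|
        ≤ Z * ∫ x in 𝓜.left j..𝓜.right j, |v.eval x| := by
    intro j v hv
    have hi := hzc.intervalIntegrable j
    have h1 := hp.2.1 j v hv
    simp_rw [sub_mul] at h1
    have i1 : IntervalIntegrable (fun x => (p j).eval x * v.eval x) volume
        (𝓜.left j) (𝓜.right j) := (by fun_prop : Continuous _).intervalIntegrable _ _
    have i2 : IntervalIntegrable (fun x => z j x * v.eval x) volume (𝓜.left j) (𝓜.right j) :=
      hi.mul_continuousOn (by fun_prop)
    rw [intervalIntegral.integral_sub i1 i2, sub_eq_zero] at h1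
    rw [h1, ← intervalIntegral.integral_const_mul]
    refine (intervalIntegral.abs_integral_le_integral_abs (𝓜.left_le_right j)).trans ?_
    refine intervalIntegral.integral_mono_on (𝓜.left_le_right j) i2.abs ?_ ?_
    · exact (by fun_prop : Continuous fun x => Z * |v.eval x|).intervalIntegrable _ _
    · intro x hx
      rw [abs_mul]
      exact mul_le_mul_of_nonneg_right (hz j x hx) (abs_nonneg _)
  have hb := fun j => hK (p j) (hp.1 j) _ _ (𝓜.left_lt_right j) Z hZ (hmom j)
  have hav : ∀ j, |θ| * |(p j).eval (𝓜.right j)|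
        ≤ Z + |1 - θ| * |(p (𝓜.next j)).eval (𝓜.left (𝓜.next j))| ∧
      |1 - θ| * |(p (𝓜.next j)).eval (𝓜.left (𝓜.next j))|
        ≤ Z + |θ| * |(p j).eval (𝓜.right j)| := by
    intro j
    have h1 := hp.2.2 j
    simp only [avg, toBroken] at h1
    have h2 := hg j
    rw [← h1] at h2
    rw [← abs_mul, ← abs_mul]
    constructor
    · have := abs_sub_abs_le_abs_sub (θ * (p j).eval (𝓜.right j))
        (-((1 - θ) * (p (𝓜.next j)).eval (𝓜.left (𝓜.next j))))
      rw [abs_neg, sub_neg_eq_add] at this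
      linarith
    · have := abs_sub_abs_le_abs_sub ((1 - θ) * (p (𝓜.next j)).eval (𝓜.left (𝓜.next j)))
        (-(θ * (p j).eval (𝓜.right j)))
      rw [abs_neg, sub_neg_eq_add, add_comm ((1 - θ) * _)] at this
      linarith
  have := 𝓜.nonempty_cells
  -- At the cell with the largest right-end value y, the two ends of a cell have nearly equal size.
  -- Going once around a node therefore gives max(|θ|, |1-θ|) y ≤ min(|θ|, |1-θ|) y + O(Z). The node
  -- to the right of `j0` is used if |θ| is larger, the node to its left otherwise.
  obtain ⟨j0, hj0⟩ := Finite.exists_max fun j => |(p j).eval (𝓜.right j)|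
  set y := |(p j0).eval (𝓜.right j0)| with hy
  have hy1 : δ * y ≤ Z * (1 + |1 - θ| * K) := by
    rcases lt_or_gt_of_ne hδ with h | h
    · rw [hδd, abs_of_neg h]
      have h1 := (hav (𝓜.prev j0)).2
      rw [𝓜.next_prev] at h1
      have h2 := (hb j0).2.2
      have h3 := hj0 (𝓜.prev j0)
      have h4 := mul_le_mul_of_nonneg_left h3 (abs_nonneg θ)
      have h5 := mul_le_mul_of_nonneg_left h2 (abs_nonneg (1 - θ))
      linarith
    · rw [hδd, abs_of_pos h]
      have h1 := (hav j0).1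
      have h2 := (hb (𝓜.next j0)).2.1
      have h3 := hj0 (𝓜.next j0)
      have h5 := mul_le_mul_of_nonneg_left (h2.trans (add_le_add_left h3 _)) (abs_nonneg (1 - θ))
      linarith
  have hy2 : y ≤ (1 + |1 - θ| * K) / δ * Z := by
    rw [div_mul_eq_mul_div, le_div_iff₀ hδ0]
    linarith
  calc |(p j).eval x| ≤ K * (Z + |(p j).eval (𝓜.right j)|) := (hb j).1 x hx
    _ ≤ K * (Z + (1 + |1 - θ| * K) / δ * Z) := by
        have := (hj0 j).trans hy2
        gcongr
    _ = _ := by ring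

theorem poly_eq_of_eqOn_cell {p q : ℝ[X]} (j : Fin 𝓜.N)
    (h : ∀ x ∈ Ioo (𝓜.left j) (𝓜.right j), p.eval x = q.eval x) : p = q := by
  rw [← sub_eq_zero]
  refine Polynomial.eq_zero_of_infinite_isRoot _ ((Ioo_infinite (𝓜.left_lt_right j)).mono ?_)
  intro x hx
  simp [h x hx]

theorem IsRadau.congr {k : ℕ} {θ : ℝ} {z z' : 𝓜.Broken} {g g' : Fin 𝓜.N → ℝ}
    (hz : ∀ j, EqOn (z j) (z' j) (𝓜.cell j)) (hg : g = g') (p : 𝓜.PiecePoly) :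
    𝓜.IsRadau k θ z g p ↔ 𝓜.IsRadau k θ z' g' p := by
  subst hg
  have : ∀ j, ∀ v : ℝ[X], (∫ x in 𝓜.left j..𝓜.right j, ((p j).eval x - z j x) * v.eval x)
      = ∫ x in 𝓜.left j..𝓜.right j, ((p j).eval x - z' j x) * v.eval x := by
    intro j v
    refine intervalIntegral.integral_congr fun x hx => ?_
    rw [uIcc_of_le (𝓜.left_le_right j)] at hx
    simp only [hz j hx]
  simp only [IsRadau, this]

/-- `radau` is a choice from the predicate `IsRadau`, which sees z only on the closed cells. Equal
predicates give literally the same choice, so values outside the cells never matter. -/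
theorem radau_congr {k : ℕ} {θ : ℝ} {z z' : 𝓜.Broken} {g g' : Fin 𝓜.N → ℝ}
    (hz : ∀ j, EqOn (z j) (z' j) (𝓜.cell j)) (hg : g = g') :
    𝓜.radau k θ z g = 𝓜.radau k θ z' g' := by
  have : 𝓜.IsRadau k θ z g = 𝓜.IsRadau k θ z' g' :=
    funext fun p => propext (IsRadau.congr 𝓜 hz hg p)
  rw [radau, radau, this]

theorem IsRadau.add_smul {k : ℕ} {θ : ℝ} {z z' : 𝓜.Broken} {g g' : Fin 𝓜.N → ℝ}
    {p p' : 𝓜.PiecePoly} (hz : 𝓜.CellCont z) (hz' : 𝓜.CellCont z')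
    (hp : 𝓜.IsRadau k θ z g p) (hp' : 𝓜.IsRadau k θ z' g' p') (c : ℝ) :
    𝓜.IsRadau k θ (z + c • z') (g + c • g') (p + c • p') := by
  refine ⟨fun j => Submodule.add_mem _ (hp.1 j) (Submodule.smul_mem _ _ (hp'.1 j)), ?_, ?_⟩
  · intro j v hv
    have h1 := hp.2.1 j v hv
    have h2 := hp'.2.1 j v hv
    have e : ∀ x, (((p + c • p') j).eval x - (z + c • z') j x) * v.eval x
        = ((p j).eval x - z j x) * v.eval x + c * (((p' j).eval x - z' j x) * v.eval x) := by
      intro x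
      simp
      ring
    simp_rw [e]
    rw [intervalIntegral.integral_add, intervalIntegral.integral_const_mul, h1, h2]
    · ring
    · exact ((intervalIntegrable_eval _ _ _).sub (hz.intervalIntegrable j)).mul_continuousOn
        (by fun_prop)
    · exact (((intervalIntegrable_eval _ _ _).sub (hz'.intervalIntegrable j)).mul_continuousOn
        (by fun_prop)).const_mul _
  · intro j
    have h1 := hp.2.2 j
    have h2 := hp'.2.2 j
    simp only [avg, toBroken, Pi.add_apply, Pi.smul_apply, eval_add, eval_smul, smul_eq_mul]
      at h1 h2 ⊢
    rw [← h1, ← h2]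
    ring

/-- The difference of two candidates is a projection of zero data, and stability with bound 0
annihilates it. -/
theorem IsRadau.unique {k : ℕ} {θ : ℝ} (hθ : θ ≠ 1 / 2) {z : 𝓜.Broken} {g : Fin 𝓜.N → ℝ}
    {p p' : 𝓜.PiecePoly} (hz : 𝓜.CellCont z) (hp : 𝓜.IsRadau k θ z g p)
    (hp' : 𝓜.IsRadau k θ z g p') : p = p' := by
  obtain ⟨K, -, hK⟩ := exists_radau_bound k hθ
  have h1 := IsRadau.add_smul 𝓜 hz hz hp hp' (-1)
  have h2 := hK 𝓜 _ _ _ 0 le_rfl (hz.add (hz.smul (-1))) (by simp) (by simp) h1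
  funext j
  refine 𝓜.poly_eq_of_eqOn_cell j fun x hx => ?_
  have := h2 j x (Ioo_subset_Icc_self hx)
  simp at this
  linarith

/-- With k moments and one node condition per cell the system is square, so uniqueness implies
solvability. -/
theorem exists_isRadau (k : ℕ) {θ : ℝ} (hθ : θ ≠ 1 / 2) {z : 𝓜.Broken} (hz : 𝓜.CellCont z)
    (g : Fin 𝓜.N → ℝ) : ∃ p, 𝓜.IsRadau k θ z g p := by
  set P : (Fin 𝓜.N → Fin (k + 1) → ℝ) → 𝓜.PiecePoly :=
    fun c j => ((degreeLTEquiv ℝ (k + 1)).symm (c j) : ℝ[X]) with hP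
  have hPmem : ∀ c, 𝓜.InSpace k (P c) := fun c j => Subtype.property _
  have hPadd : ∀ c d, P (c + d) = P c + P d := fun c d => by funext j; simp [hP]
  have hPsmul : ∀ (a : ℝ) c, P (a • c) = a • P c := fun a c => by funext j; simp [hP]
  set Ψ : (Fin 𝓜.N → Fin (k + 1) → ℝ) →ₗ[ℝ] (Fin 𝓜.N → Option (Fin k) → ℝ) :=
    { toFun := fun c j o => o.elim (𝓜.avg θ (𝓜.toBroken (P c)) j)
        fun m => momentL (𝓜.left j) (𝓜.right j) (X ^ (m : ℕ)) (P c j)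
      map_add' := by
        intro c d
        funext j o
        rw [hPadd]
        cases o with
        | none => simp [avg, toBroken]; ring
        | some m => simp
      map_smul' := by
        intro a c
        funext j o
        rw [hPsmul]
        cases o with
        | none => simp [avg, toBroken]; ring
        | some m => simp } with hΨ
  have hrad : ∀ c (z : 𝓜.Broken) (g : Fin 𝓜.N → ℝ), 𝓜.CellCont z →
      (∀ j, Ψ c j none = g j) →
      (∀ j (m : Fin k), Ψ c j (some m) = ∫ x in 𝓜.left j..𝓜.right j, z j x * x ^ (m : ℕ)) →
      𝓜.IsRadau k θ z g (P c) := by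
    intro c z g hz h1 h2
    refine ⟨hPmem c, fun j v hv => ?_, h1⟩
    refine integral_mul_eq_zero_of_monomials
      ((intervalIntegrable_eval _ _ _).sub (hz.intervalIntegrable j)) (fun m hm => ?_) hv
    have := h2 j ⟨m, hm⟩
    simp only [hΨ, LinearMap.coe_mk, AddHom.coe_mk, Option.elim, momentL_apply, eval_pow, eval_X]
      at this
    simp_rw [sub_mul]
    rw [intervalIntegral.integral_sub, this, sub_self]
    · exact (by fun_prop : Continuous _).intervalIntegrable _ _
    · exact (hz.intervalIntegrable j).mul_continuousOn (by fun_prop)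
  have h0 : 𝓜.CellCont 0 := fun j => continuousOn_const
  have hinj : Function.Injective Ψ := by
    rw [← LinearMap.ker_eq_bot, LinearMap.ker_eq_bot']
    intro c hc
    have h1 := hrad c 0 0 h0 (fun j => by rw [hc]; rfl) fun j m => by rw [hc]; simp
    have h2 : 𝓜.IsRadau k θ 0 0 0 :=
      ⟨fun j => Submodule.zero_mem _, by simp, fun j => by simp [avg, toBroken]⟩
    have h3 := IsRadau.unique 𝓜 hθ h0 h1 h2
    funext j
    have h4 : ((degreeLTEquiv ℝ (k + 1)).symm (c j) : ℝ[X]) = 0 := congrFun h3 j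
    have h5 : (degreeLTEquiv ℝ (k + 1)).symm (c j) = 0 := Subtype.ext h4
    simpa using h5
  have hsurj : Function.Surjective Ψ := by
    refine (LinearMap.injective_iff_surjective_of_finrank_eq_finrank ?_).1 hinj
    simp [Module.finrank_pi_fintype]
  obtain ⟨c, hc⟩ := hsurj fun j o => o.elim (g j)
    fun m => ∫ x in 𝓜.left j..𝓜.right j, z j x * x ^ (m : ℕ)
  exact ⟨P c, hrad c z g hz (fun j => by rw [hc]; rfl) fun j m => by rw [hc]; rfl⟩

theorem radau_spec (k : ℕ) {θ : ℝ} (hθ : θ ≠ 1 / 2) {z : 𝓜.Broken} (hz : 𝓜.CellCont z)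
    (g : Fin 𝓜.N → ℝ) : 𝓜.IsRadau k θ z g (𝓜.radau k θ z g) :=
  Classical.epsilon_spec (𝓜.exists_isRadau k hθ hz g)

/-- A choice function need not be linear; here uniqueness makes it so. -/
theorem radau_add_smul (k : ℕ) {θ : ℝ} (hθ : θ ≠ 1 / 2) {z z' : 𝓜.Broken} (hz : 𝓜.CellCont z)
    (hz' : 𝓜.CellCont z') (g g' : Fin 𝓜.N → ℝ) (c : ℝ) :
    𝓜.radau k θ (z + c • z') (g + c • g') = 𝓜.radau k θ z g + c • 𝓜.radau k θ z' g' :=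
  IsRadau.unique 𝓜 hθ (hz.add (hz'.smul c)) (𝓜.radau_spec k hθ (hz.add (hz'.smul c)) _)
    (IsRadau.add_smul 𝓜 hz hz' (𝓜.radau_spec k hθ hz g) (𝓜.radau_spec k hθ hz' g') c)

end Mesh

/-! ## Weak derivatives on an interval -/

/-- A test function with vanishing integral is the derivative of a test function. -/
theorem exists_test_primitive {a b : ℝ} {g : ℝ → ℝ} (hg : ContDiff ℝ ∞ g)
    (hgc : HasCompactSupport g) (hgs : tsupport g ⊆ Ioo a b) (hg0 : ∫ x in Ioo a b, g x = 0) :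
    ∃ φ : ℝ → ℝ, ContDiff ℝ ∞ φ ∧ HasCompactSupport φ ∧ tsupport φ ⊆ Ioo a b ∧ deriv φ = g := by
  by_cases hK : (tsupport g).Nonempty
  · have hKc : IsCompact (tsupport g) := hgc
    obtain ⟨c, hcK, hc⟩ := hKc.exists_isLeast hK
    obtain ⟨d, hdK, hd⟩ := hKc.exists_isGreatest hK
    have hac := (hgs hcK).1
    have hdb := (hgs hdK).2
    have hgz : ∀ x, x ∉ Icc c d → g x = 0 := fun x hx => by
      by_contra hne
      exact hx ⟨hc (subset_tsupport g hne), hd (subset_tsupport g hne)⟩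
    have hder : ∀ x, HasDerivAt (fun x => ∫ y in a..x, g y) (g x) x := fun x =>
      hg.continuous.integral_hasStrictDerivAt a x |>.hasDerivAt
    have hderiv : deriv (fun x => ∫ y in a..x, g y) = g := funext fun x => (hder x).deriv
    -- To the left of the support of g the primitive has not started; to the right it equals the
    -- total integral, which is zero.
    have hsupp : Function.support (fun x => ∫ y in a..x, g y) ⊆ Icc c d := by
      intro x hx
      by_contra hxn
      apply hx
      rcases lt_or_ge x c with h | h
      · have : ∀ y ∈ uIcc a x, g y = 0 := fun y hy => hgz y fun hy' => by
          exact not_lt.2 hy'.1 (hy.2.trans_lt (max_lt hac h))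
        simpa using intervalIntegral.integral_congr (g := fun _ => (0 : ℝ)) this
      · have h2 : d < x := by
          by_contra h3
          exact hxn ⟨h, not_lt.1 h3⟩
        have h4 : ∫ y in a..b, g y = 0 := by
          rw [intervalIntegral.integral_of_le (hac.le.trans ((hc hdK).trans hdb.le)),
            integral_Ioc_eq_integral_Ioo, hg0]
        have h5 : ∫ y in b..x, g y = 0 := by
          have : ∀ y ∈ uIcc b x, g y = 0 := fun y hy => hgz y fun hy' => by
            exact not_lt.2 hy'.2 ((lt_min hdb h2).trans_le hy.1)
          simpa using intervalIntegral.integral_congr (g := fun _ => (0 : ℝ)) this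
        change ∫ y in a..x, g y = 0
        rw [← intervalIntegral.integral_add_adjacent_intervals
          (hg.continuous.intervalIntegrable a b) (hg.continuous.intervalIntegrable b x), h4, h5,
          add_zero]
    have hts : tsupport (fun x => ∫ y in a..x, g y) ⊆ Icc c d := closure_minimal hsupp isClosed_Icc
    refine ⟨fun x => ∫ y in a..x, g y, ?_, isCompact_Icc.of_isClosed_subset (isClosed_tsupport _) hts,
      hts.trans fun x hx => ⟨hac.trans_le hx.1, hx.2.trans_lt hdb⟩, hderiv⟩
    rw [contDiff_infty_iff_deriv, hderiv]
    exact ⟨fun x => (hder x).differentiableAt, hg⟩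
  · have hg0 : g = 0 := by
      rw [not_nonempty_iff_eq_empty, tsupport_eq_empty_iff] at hK
      exact hK
    refine ⟨0, contDiff_const, HasCompactSupport.zero, ?_, ?_⟩
    · simp [tsupport_eq_empty_iff.2 rfl]
    · rw [hg0]
      funext x
      simp

theorem integrableOn_mul_test {a b : ℝ} {f g : ℝ → ℝ} (hf : LocallyIntegrableOn f (Ioo a b))
    (hg : Continuous g) (hgc : HasCompactSupport g) (hgs : tsupport g ⊆ Ioo a b) :
    IntegrableOn (fun x => f x * g x) (Ioo a b) := by
  have h1 : IntegrableOn (fun x => f x * g x) (tsupport g) :=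
    (hf.integrableOn_compact_subset hgs hgc).mul_continuousOn hg.continuousOn hgc
  have h2 : Integrable (fun x => f x * g x) := by
    rw [← integrableOn_iff_integrable_of_support_subset (s := tsupport g)]
    · exact h1
    · intro x hx
      apply subset_tsupport g
      intro h0
      exact hx (by simp [h0])
  exact h2.integrableOn

/-- The lemma of du Bois-Reymond. -/
theorem ae_eq_const_of_integral_mul_deriv_eq_zero {a b : ℝ} (hab : a < b) {f : ℝ → ℝ}
    (hf : LocallyIntegrableOn f (Ioo a b))
    (h : ∀ φ : ℝ → ℝ, ContDiff ℝ ∞ φ → HasCompactSupport φ → tsupport φ ⊆ Ioo a b →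
      ∫ x in Ioo a b, f x * deriv φ x = 0) :
    ∃ c, ∀ᵐ x ∂volume.restrict (Ioo a b), f x = c := by
  obtain ⟨η, hη, hηc, hηs, hη1⟩ : ∃ η : ℝ → ℝ, ContDiff ℝ ∞ η ∧ HasCompactSupport η ∧
      tsupport η ⊆ Ioo a b ∧ ∫ x in Ioo a b, η x = 1 := by
    let B : ContDiffBump ((a + b) / 2) := ⟨(b - a) / 8, (b - a) / 4, by linarith, by linarith⟩
    have hs : tsupport (B.normed volume) ⊆ Ioo a b := by
      rw [B.tsupport_normed_eq, Real.closedBall_eq_Icc]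
      intro x hx
      have : B.rOut = (b - a) / 4 := rfl
      rw [this] at hx
      exact ⟨by linarith [hx.1], by linarith [hx.2]⟩
    refine ⟨B.normed volume, B.contDiff_normed, B.hasCompactSupport_normed, hs, ?_⟩
    rw [setIntegral_eq_integral_of_forall_compl_eq_zero, B.integral_normed]
    intro x hx
    by_contra hne
    exact hx (hs (subset_tsupport _ hne))
  set c := ∫ x in Ioo a b, f x * η x with hc
  refine ⟨c, ?_⟩
  have hfc : LocallyIntegrableOn (fun x => f x - c) (Ioo a b) :=
    hf.sub (locallyIntegrableOn_const c)
  have key : ∀ᵐ x, x ∈ Ioo a b → f x - c = 0 := by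
    refine isOpen_Ioo.ae_eq_zero_of_integral_contDiff_smul_eq_zero hfc fun g hg hgc hgs => ?_
    set m := ∫ x in Ioo a b, g x with hm
    have ig : IntegrableOn g (Ioo a b) := (hg.continuous.integrable_of_hasCompactSupport hgc).integrableOn
    have iη : IntegrableOn η (Ioo a b) :=
      (hη.continuous.integrable_of_hasCompactSupport hηc).integrableOn
    have hsub : tsupport (fun x => g x - m * η x) ⊆ tsupport g ∪ tsupport η := by
      refine closure_minimal (fun x hx => ?_) ((isClosed_tsupport _).union (isClosed_tsupport _))
      by_contra hn
      rw [mem_union, not_or] at hn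
      exact hx (by simp [image_eq_zero_of_notMem_tsupport hn.1,
        image_eq_zero_of_notMem_tsupport hn.2])
    -- Subtracting m η removes the mean of g, so the remainder is the derivative of a test function
    -- and is annihilated by f.
    obtain ⟨φ, hφ, hφc, hφs, hφd⟩ := exists_test_primitive (a := a) (b := b)
      (g := fun x => g x - m * η x) (hg.sub (contDiff_const.mul hη))
      ((hgc.isCompact.union hηc.isCompact).of_isClosed_subset (isClosed_tsupport _) hsub)
      (hsub.trans (union_subset hgs hηs)) (by
        rw [integral_sub ig (iη.const_mul m), integral_const_mul, hη1, hm]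
        ring)
    have h1 := h φ hφ hφc hφs
    rw [hφd] at h1
    have e : ∀ x, f x * (g x - m * η x) = f x * g x - m * (f x * η x) := fun x => by ring
    simp_rw [e] at h1
    have i1 := integrableOn_mul_test hf hg.continuous hgc hgs
    have i2 := integrableOn_mul_test hf hη.continuous hηc hηs
    rw [integral_sub i1 (i2.const_mul m), integral_const_mul, ← hc] at h1
    have h2 : ∫ x, g x • (f x - c) = ∫ x in Ioo a b, (f x * g x - c * g x) := by
      rw [setIntegral_eq_integral_of_forall_compl_eq_zero]
      · congr 1
        ext x
        rw [smul_eq_mul]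
        ring
      · intro x hx
        have : g x = 0 := by
          by_contra hne
          exact hx (hgs (subset_tsupport _ hne))
        simp [this]
    rw [h2, integral_sub i1 (ig.const_mul c), integral_const_mul, ← hm]
    linarith
  rw [ae_restrict_iff' measurableSet_Ioo]
  filter_upwards [key] with x hx hxI
  linarith [hx hxI]

/-- A function with an integrable weak derivative is almost everywhere a primitive of it. -/
theorem IsWeakDeriv.ae_eq_primitive {a b : ℝ} (hab : a < b) {f g : ℝ → ℝ}
    (h : IsWeakDeriv a b f g) (hg : IntervalIntegrable g volume a b) :
    ∃ c, ∀ᵐ x ∂volume.restrict (Ioo a b), f x = c + ∫ y in a..x, g y := by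
  obtain ⟨hf, -, hφ⟩ := h
  have hAC := hg.absolutelyContinuousOnInterval_intervalIntegral (c := a) left_mem_uIcc
  have hcont : ContinuousOn (fun x => ∫ y in a..x, g y) (Icc a b) := by
    rw [← uIcc_of_le hab.le]
    exact hAC.continuousOn
  have hGloc : LocallyIntegrableOn (fun x => ∫ y in a..x, g y) (Ioo a b) :=
    (hcont.mono Ioo_subset_Icc_self).locallyIntegrableOn measurableSet_Ioo
  -- The primitive of g is absolutely continuous with derivative g almost everywhere, so f minus
  -- this primitive has weak derivative zero.
  obtain ⟨c, hc⟩ := ae_eq_const_of_integral_mul_deriv_eq_zero hab (hf.sub hGloc) (by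
    intro φ hφ1 hφ2 hφ3
    have hdc : HasCompactSupport (deriv φ) := hφ2.deriv
    have hds : tsupport (deriv φ) ⊆ Ioo a b := (tsupport_deriv_subset (𝕜 := ℝ)).trans hφ3
    have hdcont : Continuous (deriv φ) := hφ1.continuous_deriv (by simp)
    have i1 := integrableOn_mul_test hf hdcont hdc hds
    have i2 := integrableOn_mul_test hGloc hdcont hdc hds
    simp only [Pi.sub_apply, sub_mul]
    rw [integral_sub i1 i2, hφ φ hφ1 hφ2 hφ3]
    have hφAC : AbsolutelyContinuousOnInterval φ a b :=
      ContDiffOn.absolutelyContinuousOnInterval ((hφ1.of_le (by simp)).contDiffOn)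
    have hz : ∀ x, x ∉ Ioo a b → φ x = 0 := fun x hx => by
      by_contra hne
      exact hx (hφ3 (subset_tsupport _ hne))
    have h1 := AbsolutelyContinuousOnInterval.integral_mul_deriv_eq_deriv_mul hAC hφAC
    rw [hz b (by simp), hz a (by simp)] at h1
    have h2 : ∫ x in a..b, deriv (fun x => ∫ y in a..x, g y) x * φ x = ∫ x in a..b, g x * φ x := by
      apply intervalIntegral.integral_congr_ae
      filter_upwards [hg.ae_hasDerivAt_integral] with x hx hxI
      rw [(hx (uIoc_subset_uIcc hxI) a left_mem_uIcc).deriv]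
    rw [h2] at h1
    simp only [intervalIntegral.integral_of_le hab.le, integral_Ioc_eq_integral_Ioo] at h1
    rw [h1]
    ring)
  refine ⟨c, ?_⟩
  filter_upwards [hc] with x hx
  simp only [Pi.sub_apply] at hx
  linarith

/-- The inequality is coded as the equation max |E| B = B, because continuous functions that agree
almost everywhere agree on the whole closed interval. -/
theorem abs_le_of_ae_eq {a b : ℝ} (hab : a < b) {E D : ℝ → ℝ} {B : ℝ}
    (hE : ContinuousOn E (Icc a b)) (h : ∀ᵐ x ∂volume.restrict (Ioo a b), E x = D x)
    (hB : ∀ᵐ x ∂volume.restrict (Ioo a b), |D x| ≤ B) : ∀ x ∈ Icc a b, |E x| ≤ B := by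
  have h1 : (fun x => max |E x| B) =ᵐ[volume.restrict (Icc a b)] fun _ => B := by
    rw [Filter.EventuallyEq, ← restrict_Ioo_eq_restrict_Icc]
    filter_upwards [h, hB] with x hx hBx
    rw [hx, max_eq_right hBx]
  have h2 := Measure.eqOn_Icc_of_ae_eq volume hab.ne h1 (hE.abs.sup continuousOn_const) continuousOn_const
  intro x hx
  have := h2 hx
  exact (le_max_left _ _).trans this.le

/-- Integration from the top downwards. The weak derivative of order n + 1 is merely bounded, so its
primitive is Lipschitz; every lower derivative is the primitive of a continuous representative and
is therefore classically differentiable up to the end points. -/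
theorem exists_classical_derivatives {a b : ℝ} (hab : a < b) (B : ℝ) (n : ℕ) :
    ∀ D : ℕ → ℝ → ℝ, (∀ i < n + 1, IsWeakDeriv a b (D i) (D (i + 1))) →
      (∀ i ≤ n + 1, AEStronglyMeasurable (D i) (volume.restrict (Ioo a b)) ∧
        ∀ᵐ x ∂volume.restrict (Ioo a b), |D i x| ≤ B) →
      ∃ E : ℕ → ℝ → ℝ, (∀ i ≤ n, ContinuousOn (E i) (Icc a b) ∧
          (∀ᵐ x ∂volume.restrict (Ioo a b), E i x = D i x) ∧ ∀ x ∈ Icc a b, |E i x| ≤ B) ∧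
        (∀ i < n, ∀ x ∈ Icc a b, HasDerivWithinAt (E i) (E (i + 1) x) (Icc a b) x) ∧
        ∀ x ∈ Icc a b, ∀ y ∈ Icc a b, |E n x - E n y| ≤ B * |x - y| := by
  have hint : ∀ f : ℝ → ℝ, AEStronglyMeasurable f (volume.restrict (Ioo a b)) →
      (∀ᵐ x ∂volume.restrict (Ioo a b), |f x| ≤ B) → IntervalIntegrable f volume a b := by
    intro f hf hfB
    rw [intervalIntegrable_iff_integrableOn_Ioo_of_le hab.le]
    exact Integrable.of_bound hf B hfB
  induction n with
  | zero =>
    intro D hD hB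
    obtain ⟨hm, hb⟩ := hB 1 le_rfl
    have hi := hint _ hm hb
    obtain ⟨c, hc⟩ := (hD 0 (by omega)).ae_eq_primitive hab hi
    have hlip : ∀ x ∈ Icc a b, ∀ y ∈ Icc a b,
        |(c + ∫ t in a..x, D 1 t) - (c + ∫ t in a..y, D 1 t)| ≤ B * |x - y| := by
      intro x hx y hy
      rw [add_sub_add_left_eq_sub, intervalIntegral.integral_interval_sub_left, ← Real.norm_eq_abs]
      · refine intervalIntegral.norm_integral_le_of_norm_le_const_ae ?_
        rw [ae_restrict_iff' measurableSet_Ioo] at hb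
        have hb' : ∀ᵐ z, z ≠ b := by simp [ae_iff]
        filter_upwards [hb, hb'] with z hz hzb hzI
        have h1 : a < z := by
          have := hzI.1
          exact (le_min hy.1 hx.1).trans_lt this
        have h2 : z ≤ b := hzI.2.trans (max_le hy.2 hx.2)
        exact hz ⟨h1, lt_of_le_of_ne h2 hzb⟩
      · exact hi.mono_set (by rw [uIcc_of_le hab.le]; exact uIcc_subset_Icc ⟨le_rfl, hab.le⟩ hx)
      · exact hi.mono_set (by rw [uIcc_of_le hab.le]; exact uIcc_subset_Icc ⟨le_rfl, hab.le⟩ hy)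
    have hcont : ContinuousOn (fun x => c + ∫ t in a..x, D 1 t) (Icc a b) := by
      refine continuousOn_const.add ?_
      rw [← uIcc_of_le hab.le]
      exact (hi.absolutelyContinuousOnInterval_intervalIntegral (c := a)
        left_mem_uIcc).continuousOn
    have hae : ∀ᵐ x ∂volume.restrict (Ioo a b), (c + ∫ t in a..x, D 1 t) = D 0 x := by
      filter_upwards [hc] with x hx using hx.symm
    refine ⟨fun _ x => c + ∫ t in a..x, D 1 t, ?_, by simp, hlip⟩
    intro i hi
    obtain rfl : i = 0 := by omega
    exact ⟨hcont, hae, abs_le_of_ae_eq hab hcont hae (hB 0 (by omega)).2⟩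
  | succ n ih =>
    intro D hD hB
    obtain ⟨E, hE1, hE2, hE3⟩ := ih (fun i => D (i + 1)) (fun i hi => hD (i + 1) (by omega))
      fun i hi => hB (i + 1) (by omega)
    obtain ⟨hm, hb⟩ := hB 1 (by omega)
    have hi := hint _ hm hb
    obtain ⟨c, hc⟩ := (hD 0 (by omega)).ae_eq_primitive hab hi
    obtain ⟨hE0c, hE0a, hE0b⟩ := hE1 0 (by omega)
    set g : ℝ → ℝ := IccExtend hab.le ((Icc a b).domRestrict (E 0)) with hg
    have hgc : Continuous g := (continuousOn_iff_continuous_domRestrict.1 hE0c).Icc_extend'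
    have hgE : ∀ x ∈ Icc a b, g x = E 0 x := fun x hx => by
      rw [hg, IccExtend_of_mem hab.le _ hx]
      rfl
    have hder : ∀ x, HasDerivAt (fun x => c + ∫ y in a..x, g y) (g x) x := fun x =>
      ((hgc.integral_hasStrictDerivAt a x).hasDerivAt).const_add c
    have hcont : ContinuousOn (fun x => c + ∫ y in a..x, g y) (Icc a b) :=
      fun x _ => (hder x).continuousAt.continuousWithinAt
    have hae : ∀ᵐ x ∂volume.restrict (Ioo a b), (c + ∫ t in a..x, g t) = D 0 x := by
      rw [ae_restrict_iff' measurableSet_Ioo] at hc ⊢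
      filter_upwards [hc] with x hx hxI
      rw [hx hxI]
      congr 1
      apply intervalIntegral.integral_congr_ae
      rw [ae_restrict_iff' measurableSet_Ioo] at hE0a
      filter_upwards [hE0a] with y hy hyI
      rw [uIoc_of_le hxI.1.le] at hyI
      have hyI' : y ∈ Ioo a b := ⟨hyI.1, hyI.2.trans_lt hxI.2⟩
      rw [hgE y (Ioo_subset_Icc_self hyI'), hy hyI']
    refine ⟨fun i => Nat.casesOn i (fun x => c + ∫ y in a..x, g y) E, ?_, ?_, hE3⟩
    · intro i hi
      cases i with
      | zero => exact ⟨hcont, hae, abs_le_of_ae_eq hab hcont hae (hB 0 (by omega)).2⟩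
      | succ i => exact hE1 i (by omega)
    · intro i hi x hx
      cases i with
      | zero =>
        have := (hder x).hasDerivWithinAt (s := Icc a b)
        rw [hgE x hx] at this
        exact this
      | succ i => exact hE2 i (by omega) x hx

/-- A continuous function in `W^{n+1,∞}` is `n` times continuously differentiable, with Lipschitz
continuous derivative of order `n`. -/
theorem SobolevNormLE.exists_classical {a b : ℝ} (hab : a < b) {n : ℕ} {f : ℝ → ℝ} {B : ℝ}
    (h : SobolevNormLE a b (n + 1) f B) (hf : ContinuousOn f (Icc a b)) :
    ∃ E : ℕ → ℝ → ℝ, E 0 = f ∧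
      (∀ i ≤ n, ContinuousOn (E i) (Icc a b) ∧ ∀ x ∈ Icc a b, |E i x| ≤ B) ∧
      (∀ i < n, ∀ x ∈ Icc a b, HasDerivWithinAt (E i) (E (i + 1) x) (Icc a b) x) ∧
      ∀ x ∈ Icc a b, ∀ y ∈ Icc a b, |E n x - E n y| ≤ B * |x - y| := by
  obtain ⟨D, hD0, hD1, hD2⟩ := h
  obtain ⟨E, hE1, hE2, hE3⟩ := exists_classical_derivatives hab B n D hD1 hD2
  have h0 : EqOn (E 0) f (Icc a b) := by
    refine Measure.eqOn_Icc_of_ae_eq volume hab.ne ?_ (hE1 0 (by omega)).1 hf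
    rw [Filter.EventuallyEq, ← restrict_Ioo_eq_restrict_Icc, ← hD0]
    exact (hE1 0 (by omega)).2.1
  -- The representative of order 0 agrees with f on the interval only. It is replaced by f itself so
  -- that the equality holds as functions.
  have hEq : ∀ i, EqOn (Function.update E 0 f i) (E i) (Icc a b) := by
    intro i
    rcases eq_or_ne i 0 with rfl | hi
    · rw [Function.update_self]
      exact h0.symm
    · rw [Function.update_of_ne hi]
      exact eqOn_refl _ _
  refine ⟨Function.update E 0 f, Function.update_self _ _ _, fun i hi => ⟨?_, fun x hx => ?_⟩,
    fun i hi x hx => ?_, fun x hx y hy => ?_⟩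
  · exact (hE1 i hi).1.congr (hEq i)
  · rw [hEq i hx]
    exact (hE1 i hi).2.2 x hx
  · rw [hEq (i + 1) hx]
    exact (hE2 i hi x hx).congr (hEq i) (hEq i hx)
  · rw [hEq n hx, hEq n hy]
    exact hE3 x hx y hy

/-! ## Jets and regularity in time -/

/-- `F 0, …, F m` are a function on `[0, 2π]` and its derivatives up to order `m`, all continuous
and bounded by `M`. -/
structure IsJet (m : ℕ) (F : ℕ → ℝ → ℝ) (M : ℝ) : Prop where
  deriv : ∀ i < m, ∀ x ∈ Icc 0 (2 * π), HasDerivWithinAt (F i) (F (i + 1) x) (Icc 0 (2 * π)) x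
  cont : ∀ i ≤ m, ContinuousOn (F i) (Icc 0 (2 * π))
  bound : ∀ i ≤ m, ∀ x ∈ Icc 0 (2 * π), |F i x| ≤ M

/-- The jet of `f'' - f'`. -/
def advDiff (F : ℕ → ℝ → ℝ) : ℕ → ℝ → ℝ := fun i x => F (i + 2) x - F (i + 1) x

theorem two_pi_pos' : (0 : ℝ) < 2 * π := by positivity

theorem IsJet.mono {m n : ℕ} (hmn : m ≤ n) {F : ℕ → ℝ → ℝ} {M : ℝ} (h : IsJet n F M) :
    IsJet m F M :=
  ⟨fun i hi => h.deriv i (by omega), fun i hi => h.cont i (by omega),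
    fun i hi => h.bound i (by omega)⟩

theorem IsJet.of_bound {m : ℕ} {F : ℕ → ℝ → ℝ} {M M' : ℝ} (h : IsJet m F M)
    (h' : ∀ i ≤ m, ∀ x ∈ Icc 0 (2 * π), |F i x| ≤ M') : IsJet m F M' :=
  ⟨h.deriv, h.cont, h'⟩

theorem IsJet.nonneg {m : ℕ} {F : ℕ → ℝ → ℝ} {M : ℝ} (h : IsJet m F M) : 0 ≤ M :=
  (abs_nonneg _).trans (h.bound 0 (Nat.zero_le _) 0 (left_mem_Icc.2 two_pi_pos'.le))

theorem IsJet.sub {m : ℕ} {F G : ℕ → ℝ → ℝ} {M M' : ℝ} (hF : IsJet m F M) (hG : IsJet m G M') :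
    IsJet m (F - G) (M + M') :=
  ⟨fun i hi x hx => (hF.deriv i hi x hx).sub (hG.deriv i hi x hx),
    fun i hi => (hF.cont i hi).sub (hG.cont i hi),
    fun i hi x hx => (abs_sub _ _).trans (add_le_add (hF.bound i hi x hx) (hG.bound i hi x hx))⟩

theorem IsJet.smul {m : ℕ} {F : ℕ → ℝ → ℝ} {M : ℝ} (hF : IsJet m F M) (c : ℝ) :
    IsJet m (c • F) (|c| * M) :=
  ⟨fun i hi x hx => (hF.deriv i hi x hx).const_smul c,
    fun i hi => (hF.cont i hi).const_smul c,
    fun i hi x hx => by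
      simp only [Pi.smul_apply, smul_eq_mul, abs_mul]
      exact mul_le_mul_of_nonneg_left (hF.bound i hi x hx) (abs_nonneg c)⟩

theorem IsJet.shift {m : ℕ} {F : ℕ → ℝ → ℝ} {M : ℝ} (hF : IsJet (m + 1) F M) :
    IsJet m (fun i => F (i + 1)) M :=
  ⟨fun i hi => hF.deriv (i + 1) (by omega), fun i hi => hF.cont (i + 1) (by omega),
    fun i hi => hF.bound (i + 1) (by omega)⟩

theorem IsJet.advDiff {m : ℕ} {F : ℕ → ℝ → ℝ} {M : ℝ} (hF : IsJet (m + 2) F M) :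
    IsJet m (advDiff F) (2 * M) := by
  rw [two_mul]
  exact hF.shift.shift.sub (hF.mono (Nat.le_succ _)).shift

theorem IsJet.lipschitz {m : ℕ} {F : ℕ → ℝ → ℝ} {M : ℝ} (hF : IsJet m F M) {i : ℕ} (hi : i < m) :
    ∀ x ∈ Icc 0 (2 * π), ∀ y ∈ Icc 0 (2 * π), |F i x - F i y| ≤ M * |x - y| := by
  intro x hx y hy
  exact (convex_Icc _ _).norm_image_sub_le_of_norm_hasDerivWithin_le (hF.deriv i hi)
    (fun z hz => hF.bound (i + 1) hi z hz) hy hx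

/-- Serves to pass estimates from one spatial order to the next: a small Lipschitz constant in x for
a remainder of order m is a bound for the remainder of order m + 1. -/
theorem abs_deriv_le_of_lipschitz {f : ℝ → ℝ} {f' K x : ℝ} (hx : x ∈ Icc 0 (2 * π))
    (hf : HasDerivWithinAt f f' (Icc 0 (2 * π)) x)
    (hK : ∀ y ∈ Icc 0 (2 * π), |f y - f x| ≤ K * |y - x|) : |f'| ≤ K := by
  have h1 := (hasDerivWithinAt_iff_tendsto_slope.1 hf).abs
  have hne : (nhdsWithin x (Icc 0 (2 * π) \ {x})).NeBot := by
    rw [← accPt_principal_iff_nhdsWithin]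
    exact uniqueDiffWithinAt_iff_accPt.1 (uniqueDiffOn_Icc two_pi_pos' x hx)
  refine le_of_tendsto h1 ?_
  filter_upwards [self_mem_nhdsWithin] with y hy
  rw [slope_def_field, abs_div, div_le_iff₀ (abs_pos.2 (sub_ne_zero.2 hy.2))]
  exact hK y hy.1

/-- An interpolation inequality of Landau type. -/
theorem abs_deriv_le_of_small {f f' : ℝ → ℝ} {K η d : ℝ} (hd : 0 < d) (hdπ : d ≤ π) (hK : 0 ≤ K)
    (hf : ∀ x ∈ Icc 0 (2 * π), HasDerivWithinAt f (f' x) (Icc 0 (2 * π)) x)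
    (hη : ∀ x ∈ Icc 0 (2 * π), |f x| ≤ η)
    (hl : ∀ x ∈ Icc 0 (2 * π), ∀ y ∈ Icc 0 (2 * π), |f' x - f' y| ≤ K * |x - y|) :
    ∀ x ∈ Icc 0 (2 * π), |f' x| ≤ 2 * η / d + K * d := by
  intro x hx
  -- Since d ≤ π, a step of length d from x stays in the interval on at least one side.
  obtain ⟨y, hy, hyx⟩ : ∃ y ∈ Icc 0 (2 * π), |y - x| = d := by
    rcases le_total x π with h | h
    · exact ⟨x + d, ⟨by linarith [hx.1], by linarith⟩, by simp [abs_of_pos hd]⟩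
    · exact ⟨x - d, ⟨by linarith, by linarith [hx.2]⟩, by simp [abs_of_pos hd]⟩
  have hsub : uIcc x y ⊆ Icc 0 (2 * π) := uIcc_subset_Icc hx hy
  have h1 := (convex_uIcc x y).norm_image_sub_le_of_norm_hasDerivWithin_le
    (f := fun z => f z - f' x * z) (f' := fun z => f' z - f' x) (C := K * d)
    (fun z hz => ((hf z (hsub hz)).mono hsub).sub (by
      simpa using ((hasDerivAt_id z).const_mul (f' x)).hasDerivWithinAt))
    (fun z hz => by
      refine (hl z (hsub hz) x hx).trans (mul_le_mul_of_nonneg_left ?_ hK)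
      rw [← hyx]
      exact abs_sub_left_of_mem_uIcc hz) left_mem_uIcc right_mem_uIcc
  rw [Real.norm_eq_abs, Real.norm_eq_abs, hyx] at h1
  have h2 : |f' x * (y - x)| ≤ 2 * η + K * d * d := by
    have e : f' x * (y - x) = f y - f x - (f y - f' x * y - (f x - f' x * x)) := by ring
    rw [e]
    have a1 := abs_sub (f y - f x) (f y - f' x * y - (f x - f' x * x))
    have a2 := abs_sub (f y) (f x)
    linarith [hη x hx, hη y hy]
  rw [abs_mul, hyx] at h2
  rw [div_add' _ _ _ hd.ne', le_div_iff₀ hd]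
  exact h2

/-! ### Time regularity of the spatial derivatives. -/

section TimeRegularity

variable {n : ℕ} {T B : ℝ} {D : ℝ → ℕ → ℝ → ℝ}

/-- A curve of jets that solves `∂_t D 0 = D 2 - D 1`. -/
structure IsJetSolution (n : ℕ) (T B : ℝ) (D : ℝ → ℕ → ℝ → ℝ) : Prop where
  jet : ∀ t ∈ Icc 0 T, IsJet (n + 2) (D t) B
  lip : ∀ t ∈ Icc 0 T, ∀ x ∈ Icc 0 (2 * π), ∀ y ∈ Icc 0 (2 * π),
    |D t (n + 2) x - D t (n + 2) y| ≤ B * |x - y|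
  pde : ∀ t ∈ Icc 0 T, ∀ x ∈ Icc 0 (2 * π),
    HasDerivWithinAt (fun s => D s 0 x) (D t 2 x - D t 1 x) (Icc 0 T) t

theorem IsJetSolution.lipschitz (h : IsJetSolution n T B D) {t : ℝ} (ht : t ∈ Icc 0 T) {i : ℕ}
    (hi : i ≤ n + 2) : ∀ x ∈ Icc 0 (2 * π), ∀ y ∈ Icc 0 (2 * π),
      |D t i x - D t i y| ≤ B * |x - y| := by
  rcases hi.eq_or_lt with rfl | hi
  · exact h.lip t ht
  · exact (h.jet t ht).lipschitz hi

/-- Order 0 is Lipschitz in time by the equation. Each further order follows by interpolation: the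
difference of two jets is small at order m and uniformly Lipschitz in x at order m + 1. -/
theorem IsJetSolution.equicontinuous (h : IsJetSolution n T B D) (m : ℕ) (hm : m ≤ n + 2) :
    ∀ ε > 0, ∃ δ > 0, ∀ s ∈ Icc 0 T, ∀ t ∈ Icc 0 T, |s - t| < δ →
      ∀ x ∈ Icc 0 (2 * π), |D s m x - D t m x| ≤ ε := by
  rcases lt_or_ge T 0 with hT | hT
  · intro ε hε
    exact ⟨1, one_pos, fun s hs => absurd (hs.1.trans hs.2) (not_le.2 hT)⟩
  have hB : 0 ≤ B := (h.jet 0 (left_mem_Icc.2 hT)).nonneg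
  induction m with
  | zero =>
    intro ε hε
    refine ⟨ε / (2 * B + 1), by positivity, fun s hs t ht hst x hx => ?_⟩
    have h1 := (convex_Icc 0 T).norm_image_sub_le_of_norm_hasDerivWithin_le (C := 2 * B)
      (fun τ hτ => h.pde τ hτ x hx) (fun τ hτ => by
        have := (h.jet τ hτ).bound 2 (by omega) x hx
        have := (h.jet τ hτ).bound 1 (by omega) x hx
        rw [Real.norm_eq_abs]
        linarith [abs_sub (D τ 2 x) (D τ 1 x)]) ht hs
    rw [Real.norm_eq_abs, Real.norm_eq_abs] at h1
    rw [lt_div_iff₀ (by positivity)] at hst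
    nlinarith [abs_nonneg (s - t)]
  | succ m ih =>
    intro ε hε
    -- This step length balances the Landau inequality: 2η/d = ε/2 for η = εd/4, and 2Bd ≤ ε/2.
    set d := min π (ε / (4 * B + 1)) with hd
    have hd0 : 0 < d := lt_min Real.pi_pos (by positivity)
    obtain ⟨δ, hδ, hδ'⟩ := ih (by omega) (ε * d / 4) (by positivity)
    refine ⟨δ, hδ, fun s hs t ht hst x hx => ?_⟩
    have h1 := abs_deriv_le_of_small (f := fun x => D s m x - D t m x)
      (f' := fun x => D s (m + 1) x - D t (m + 1) x) (K := 2 * B) (η := ε * d / 4) hd0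
      (min_le_left _ _) (by positivity)
      (fun x hx => ((h.jet s hs).deriv m (by omega) x hx).sub
        ((h.jet t ht).deriv m (by omega) x hx)) (hδ' s hs t ht hst) (by
      intro x hx y hy
      have a1 := h.lipschitz hs hm x hx y hy
      have a2 := h.lipschitz ht hm x hx y hy
      have e : D s (m + 1) x - D t (m + 1) x - (D s (m + 1) y - D t (m + 1) y)
        = D s (m + 1) x - D s (m + 1) y - (D t (m + 1) x - D t (m + 1) y) := by ring
      rw [e]
      linarith [abs_sub (D s (m + 1) x - D s (m + 1) y) (D t (m + 1) x - D t (m + 1) y)]) x hx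
    refine h1.trans ?_
    have h2 : d * (4 * B + 1) ≤ ε := by
      rw [← le_div_iff₀ (by positivity)]
      exact min_le_right _ _
    have h3 : 2 * (ε * d / 4) / d = ε / 2 := by field_simp; ring
    rw [h3]
    linarith

/-- The time derivatives exist uniformly in space. -/
theorem IsJetSolution.uniform_deriv (h : IsJetSolution n T B D) (m : ℕ) (hm : m ≤ n) :
    ∀ ε > 0, ∃ δ > 0, ∀ s ∈ Icc 0 T, ∀ t ∈ Icc 0 T, |s - t| < δ →
      ∀ x ∈ Icc 0 (2 * π),
        |D s m x - D t m x - (s - t) * advDiff (D t) m x| ≤ ε * |s - t| := by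
  have hA : ∀ m ≤ n, ∀ ε > 0, ∃ δ > 0, ∀ s ∈ Icc 0 T, ∀ t ∈ Icc 0 T, |s - t| < δ →
      ∀ x ∈ Icc 0 (2 * π), |advDiff (D s) m x - advDiff (D t) m x| ≤ ε := by
    intro m hm ε hε
    obtain ⟨δ₁, h1, h1'⟩ := h.equicontinuous (m + 1) (by omega) (ε / 2) (by positivity)
    obtain ⟨δ₂, h2, h2'⟩ := h.equicontinuous (m + 2) (by omega) (ε / 2) (by positivity)
    refine ⟨min δ₁ δ₂, lt_min h1 h2, fun s hs t ht hst x hx => ?_⟩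
    have a1 := h1' s hs t ht (hst.trans_le (min_le_left _ _)) x hx
    have a2 := h2' s hs t ht (hst.trans_le (min_le_right _ _)) x hx
    simp only [advDiff]
    have e : D s (m + 2) x - D s (m + 1) x - (D t (m + 2) x - D t (m + 1) x)
      = D s (m + 2) x - D t (m + 2) x - (D s (m + 1) x - D t (m + 1) x) := by ring
    rw [e]
    linarith [abs_sub (D s (m + 2) x - D t (m + 2) x) (D s (m + 1) x - D t (m + 1) x)]
  induction m with
  | zero =>
    intro ε hε
    obtain ⟨δ, hδ, hδ'⟩ := hA 0 (by omega) ε hε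
    refine ⟨δ, hδ, fun s hs t ht hst x hx => ?_⟩
    have hsub : uIcc t s ⊆ Icc 0 T := uIcc_subset_Icc ht hs
    have h1 := (convex_uIcc t s).norm_image_sub_le_of_norm_hasDerivWithin_le
      (f := fun τ => D τ 0 x - τ * advDiff (D t) 0 x)
      (f' := fun τ => advDiff (D τ) 0 x - advDiff (D t) 0 x) (C := ε)
      (fun τ hτ => ((h.pde τ (hsub hτ) x hx).mono hsub).sub (by
        simpa using ((hasDerivAt_id τ).mul_const (advDiff (D t) 0 x)).hasDerivWithinAt))
      (fun τ hτ => hδ' τ (hsub hτ) t ht ((abs_sub_left_of_mem_uIcc hτ).trans_lt hst)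
        x hx) left_mem_uIcc right_mem_uIcc
    rw [Real.norm_eq_abs, Real.norm_eq_abs] at h1
    convert h1 using 2
    ring
  | succ m ih =>
    have ih := ih (by omega)
    have hder : ∀ t ∈ Icc 0 T, ∀ x ∈ Icc 0 (2 * π),
        HasDerivWithinAt (fun s => D s m x) (advDiff (D t) m x) (Icc 0 T) t := by
      intro t ht x hx
      rw [hasDerivWithinAt_iff_isLittleO, Asymptotics.isLittleO_iff]
      intro ε hε
      obtain ⟨δ, hδ, hδ'⟩ := ih ε hε
      filter_upwards [self_mem_nhdsWithin, mem_nhdsWithin_of_mem_nhds (Metric.ball_mem_nhds t hδ)]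
        with s hs hst
      exact hδ' s hs t ht hst x hx
    intro ε hε
    obtain ⟨δ, hδ, hδ'⟩ := hA (m + 1) hm ε hε
    refine ⟨δ, hδ, fun s hs t ht hst => ?_⟩
    have hsub : uIcc t s ⊆ Icc 0 T := uIcc_subset_Icc ht hs
    have hclose : ∀ τ ∈ uIcc t s, |τ - t| < δ := fun τ hτ =>
      (abs_sub_left_of_mem_uIcc hτ).trans_lt hst
    -- The x-derivative of `advDiff (D τ) m` is of order m + 1 and uniformly continuous in time, so
    -- its change from t to τ has Lipschitz constant ε in x. The mean value inequality in time then
    -- gives the remainder of order m the Lipschitz constant ε|s - t| in x, and its x-derivative is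
    -- the remainder of order m + 1.
    have hAl : ∀ τ ∈ uIcc t s, ∀ x ∈ Icc 0 (2 * π), ∀ y ∈ Icc 0 (2 * π),
        |advDiff (D τ) m x - advDiff (D t) m x - (advDiff (D τ) m y - advDiff (D t) m y)|
          ≤ ε * |x - y| := by
      intro τ hτ x hx y hy
      have hj := fun σ (hσ : σ ∈ Icc 0 T) =>
        (((h.jet σ hσ).mono (by omega : m + 1 + 2 ≤ n + 2)).advDiff).deriv m (by omega)
      exact (convex_Icc _ _).norm_image_sub_le_of_norm_hasDerivWithin_le
        (f := fun x => advDiff (D τ) m x - advDiff (D t) m x)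
        (fun z hz => (hj τ (hsub hτ) z hz).sub (hj t ht z hz))
        (fun z hz => hδ' τ (hsub hτ) t ht (hclose τ hτ) z hz) hy hx
    have hR : ∀ x ∈ Icc 0 (2 * π), ∀ y ∈ Icc 0 (2 * π),
        |(D s m y - D t m y - (s - t) * advDiff (D t) m y)
          - (D s m x - D t m x - (s - t) * advDiff (D t) m x)| ≤ ε * |s - t| * |y - x| := by
      intro x hx y hy
      have h1 := (convex_uIcc t s).norm_image_sub_le_of_norm_hasDerivWithin_le
        (f := fun τ => D τ m y - D τ m x - τ * (advDiff (D t) m y - advDiff (D t) m x))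
        (f' := fun τ => advDiff (D τ) m y - advDiff (D τ) m x
          - (advDiff (D t) m y - advDiff (D t) m x)) (C := ε * |y - x|)
        (fun τ hτ => (((hder τ (hsub hτ) y hy).sub (hder τ (hsub hτ) x hx)).mono hsub).sub (by
          simpa using ((hasDerivAt_id τ).mul_const
            (advDiff (D t) m y - advDiff (D t) m x)).hasDerivWithinAt))
        (fun τ hτ => by
          have := hAl τ hτ y hy x hx
          rw [Real.norm_eq_abs]
          convert this using 2
          ring) left_mem_uIcc right_mem_uIcc
      rw [Real.norm_eq_abs, Real.norm_eq_abs] at h1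
      convert h1 using 1
      · congr 1
        ring
      · ring
    intro x hx
    refine abs_deriv_le_of_lipschitz (f := fun x => D s m x - D t m x
      - (s - t) * advDiff (D t) m x) hx ?_ (fun y hy => hR x hx y hy)
    exact (((h.jet s hs).deriv m (by omega) x hx).sub ((h.jet t ht).deriv m (by omega) x hx)).sub
      (((((h.jet t ht).mono (by omega : m + 1 + 2 ≤ n + 2)).advDiff).deriv m
        (by omega) x hx).const_mul (s - t))

theorem IsJetSolution.hasDerivWithinAt (h : IsJetSolution n T B D) {m : ℕ} (hm : m ≤ n) {t : ℝ}
    (ht : t ∈ Icc 0 T) {x : ℝ} (hx : x ∈ Icc 0 (2 * π)) :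
    HasDerivWithinAt (fun s => D s m x) (advDiff (D t) m x) (Icc 0 T) t := by
  rw [hasDerivWithinAt_iff_isLittleO, Asymptotics.isLittleO_iff]
  intro ε hε
  obtain ⟨δ, hδ, hδ'⟩ := h.uniform_deriv m hm ε hε
  filter_upwards [self_mem_nhdsWithin, mem_nhdsWithin_of_mem_nhds (Metric.ball_mem_nhds t hδ)]
    with s hs hst
  exact hδ' s hs t ht hst x hx

theorem exists_uniform_delta {N : ℕ} {P : ℕ → ℝ → Prop}
    (hP : ∀ i ≤ N, ∃ δ > 0, ∀ r < δ, P i r) : ∃ δ > 0, ∀ r < δ, ∀ i ≤ N, P i r := by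
  induction N with
  | zero =>
    obtain ⟨δ, hδ, h⟩ := hP 0 le_rfl
    refine ⟨δ, hδ, fun r hr i hi => ?_⟩
    obtain rfl : i = 0 := by omega
    exact h r hr
  | succ N ih =>
    obtain ⟨δ₁, h1, h1'⟩ := ih fun i hi => hP i (by omega)
    obtain ⟨δ₂, h2, h2'⟩ := hP (N + 1) le_rfl
    refine ⟨min δ₁ δ₂, lt_min h1 h2, fun r hr i hi => ?_⟩
    rcases hi.eq_or_lt with rfl | hi
    · exact h2' r (hr.trans_le (min_le_right _ _))
    · exact h1' r (hr.trans_le (min_le_left _ _)) i (by omega)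

theorem IsJetSolution.jet_continuous (h : IsJetSolution n T B D) :
    ∀ ε > 0, ∃ δ > 0, ∀ s ∈ Icc 0 T, ∀ t ∈ Icc 0 T, |s - t| < δ →
      IsJet (n + 2) (D s - D t) ε := by
  intro ε hε
  obtain ⟨δ, hδ, h'⟩ := exists_uniform_delta (N := n + 2) (P := fun i r => ∀ s ∈ Icc 0 T,
    ∀ t ∈ Icc 0 T, |s - t| = r → ∀ x ∈ Icc 0 (2 * π), |D s i x - D t i x| ≤ ε) (by
      intro i hi
      obtain ⟨δ, hδ, h'⟩ := h.equicontinuous i hi ε hε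
      exact ⟨δ, hδ, fun r hr s hs t ht hst => h' s hs t ht (hst ▸ hr)⟩)
  exact ⟨δ, hδ, fun s hs t ht hst => ((h.jet s hs).sub (h.jet t ht)).of_bound
    fun i hi => h' _ hst i hi s hs t ht rfl⟩

/-- The form needed for operators on jets: the whole remainder is a jet with a small bound, so a
bounded linear operator can be applied to it. -/
theorem IsJetSolution.jet_deriv (h : IsJetSolution n T B D) :
    ∀ ε > 0, ∃ δ > 0, ∀ s ∈ Icc 0 T, ∀ t ∈ Icc 0 T, |s - t| < δ →
      IsJet n (D s - D t - (s - t) • advDiff (D t)) (ε * |s - t|) := by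
  intro ε hε
  obtain ⟨δ, hδ, h'⟩ := exists_uniform_delta (N := n) (P := fun i r => ∀ s ∈ Icc 0 T,
    ∀ t ∈ Icc 0 T, |s - t| = r → ∀ x ∈ Icc 0 (2 * π),
      |D s i x - D t i x - (s - t) * advDiff (D t) i x| ≤ ε * |s - t|) (by
      intro i hi
      obtain ⟨δ, hδ, h'⟩ := h.uniform_deriv i hi ε hε
      exact ⟨δ, hδ, fun r hr s hs t ht hst => h' s hs t ht (hst ▸ hr)⟩)
  exact ⟨δ, hδ, fun s hs t ht hst =>
    ((((h.jet s hs).sub (h.jet t ht)).mono (by omega)).sub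
      ((h.jet t ht).advDiff.smul (s - t))).of_bound fun i hi => h' _ hst i hi s hs t ht rfl⟩

/-- Goes one order beyond the time derivative. At order n + 1 the bound comes from order n, whose
time derivative is Lipschitz in x with constant 2B. -/
theorem IsJetSolution.jet_lipschitz (h : IsJetSolution n T B D) {s t : ℝ} (hs : s ∈ Icc 0 T)
    (ht : t ∈ Icc 0 T) : IsJet (n + 1) (D s - D t) (2 * B * |s - t|) := by
  refine (((h.jet s hs).sub (h.jet t ht)).mono (by omega)).of_bound fun i hi x hx => ?_
  rcases hi.eq_or_lt with rfl | hi
  · refine abs_deriv_le_of_lipschitz (f := fun x => D s n x - D t n x) hx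
      (((h.jet s hs).deriv n (by omega) x hx).sub ((h.jet t ht).deriv n (by omega) x hx)) ?_
    intro y hy
    have h1 := (convex_Icc 0 T).norm_image_sub_le_of_norm_hasDerivWithin_le
      (f := fun τ => D τ n y - D τ n x) (C := 2 * B * |y - x|)
      (fun τ hτ => (h.hasDerivWithinAt le_rfl hτ hy).sub (h.hasDerivWithinAt le_rfl hτ hx))
      (fun τ hτ => by
        have a1 := h.lipschitz hτ (le_refl (n + 2)) y hy x hx
        have a2 := h.lipschitz hτ (by omega : n + 1 ≤ n + 2) y hy x hx
        simp only [advDiff, Real.norm_eq_abs]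
        have e : D τ (n + 2) y - D τ (n + 1) y - (D τ (n + 2) x - D τ (n + 1) x)
          = D τ (n + 2) y - D τ (n + 2) x - (D τ (n + 1) y - D τ (n + 1) x) := by ring
        rw [e]
        linarith [abs_sub (D τ (n + 2) y - D τ (n + 2) x) (D τ (n + 1) y - D τ (n + 1) x)]) ht hs
    rw [Real.norm_eq_abs, Real.norm_eq_abs] at h1
    convert h1 using 1
    · congr 1
      ring
    · ring
  · exact (convex_Icc 0 T).norm_image_sub_le_of_norm_hasDerivWithin_le
      (f := fun τ => D τ i x) (C := 2 * B)
      (fun τ hτ => h.hasDerivWithinAt (by omega) hτ hx)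
      (fun τ hτ => by
        have := (h.jet τ hτ).advDiff.bound i (by omega) x hx
        exact this) ht hs

end TimeRegularity

/-- A periodic solution that is bounded in `W^{n+3,∞}` defines a curve of jets. -/
theorem IsPeriodicSolution.exists_jetSolution {n : ℕ} {T B : ℝ} {u : ℝ → ℝ → ℝ}
    (hu : IsPeriodicSolution T u)
    (hB : ∀ t ∈ Icc 0 T, SobolevNormLE 0 (2 * π) (n + 3) (u t) B) :
    ∃ D : ℝ → ℕ → ℝ → ℝ, IsJetSolution n T B D ∧ (∀ t ∈ Icc 0 T, D t 0 = u t) ∧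
      ∀ t ∈ Icc 0 T, EqOn (auxVar u t) (D t 1) (Icc 0 (2 * π)) := by
  have hex : ∀ t, ∃ E : ℕ → ℝ → ℝ, t ∈ Icc 0 T → E 0 = u t ∧ IsJet (n + 2) E B ∧
      ∀ x ∈ Icc 0 (2 * π), ∀ y ∈ Icc 0 (2 * π), |E (n + 2) x - E (n + 2) y| ≤ B * |x - y| := by
    intro t
    by_cases ht : t ∈ Icc 0 T
    · obtain ⟨E, h0, h1, h2, h3⟩ := (hB t ht).exists_classical two_pi_pos'
        (hu.space_reg t ht).continuousOn
      exact ⟨E, fun _ => ⟨h0, ⟨h2, fun i hi => (h1 i hi).1, fun i hi => (h1 i hi).2⟩, h3⟩⟩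
    · exact ⟨0, fun h => absurd h ht⟩
  choose D hD using hex
  have hq : ∀ t ∈ Icc 0 T, EqOn (auxVar u t) (D t 1) (Icc 0 (2 * π)) := by
    intro t ht x hx
    obtain ⟨h0, hj, -⟩ := hD t ht
    have := (hj.deriv 0 (by omega) x hx).derivWithin (uniqueDiffOn_Icc two_pi_pos' x hx)
    rw [h0] at this
    exact this
  refine ⟨D, ⟨fun t ht => (hD t ht).2.1, fun t ht => (hD t ht).2.2, fun t ht x hx => ?_⟩,
    fun t ht => (hD t ht).1, hq⟩
  have h1 := hu.pde t ht x hx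
  have h2 : derivWithin (auxVar u t) (Icc 0 (2 * π)) x = D t 2 x :=
    (((hD t ht).2.1.deriv 1 (by omega) x hx).congr (hq t ht) (hq t ht hx)).derivWithin
      (uniqueDiffOn_Icc two_pi_pos' x hx)
  rw [h2, hq t ht hx] at h1
  have h3 := (hu.time_reg t ht x hx).hasDerivWithinAt
  have e : derivWithin (fun s => u s x) (Icc 0 T) t = D t 2 x - D t 1 x := by linarith
  rw [e] at h3
  refine h3.congr (fun s hs => ?_) ?_
  · rw [(hD s hs).1]
  · rw [(hD t ht).1]

namespace Mesh

/-! ## Correction operators -/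

section Operators

variable (𝓜 : Mesh) (k : ℕ) (lam θ : ℝ)

/-- The antiderivative `∫_{x_{j-1/2}}^x w` on every cell. -/
def cellPrim (w : 𝓜.Broken) : 𝓜.Broken := fun j x => 𝓜.size j / 2 * 𝓜.primitive w j x

theorem cellPrim_apply (w : 𝓜.Broken) (j : Fin 𝓜.N) (x : ℝ) :
    𝓜.cellPrim w j x = ∫ τ in 𝓜.left j..x, w j τ := by
  have h : 𝓜.size j / 2 ≠ 0 := (half_pos (𝓜.size_pos j)).ne'
  rw [cellPrim, primitive, ← mul_assoc, mul_inv_cancel₀ h, one_mul]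

/-- The step from `w_{q,i}` to `w_{u,i+1}`. -/
def stepU (w : 𝓜.Broken) : 𝓜.PiecePoly := 𝓜.radau k θ (𝓜.cellPrim w) 0

/-- The step from `w_{u,i+1}` and `∂_t w_{u,i}` to `w_{q,i+1}`. -/
def stepQ (wu w : 𝓜.Broken) : 𝓜.PiecePoly :=
  𝓜.radau k (1 - θ) (wu + 𝓜.cellPrim w) (𝓜.avg lam wu)

/-- The pair `(w_{u,i}, w_{q,i})` as a linear operator on spatial jets, with `advDiff` in place of
the time derivative. -/
def op : ℕ → (ℕ → ℝ → ℝ) → 𝓜.Broken × 𝓜.Broken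
  | 0, F =>
    (𝓜.restrict (F 0) - 𝓜.proj k θ (𝓜.restrict (F 0)),
      𝓜.restrict (F 1) - 𝓜.projStar k lam θ (𝓜.restrict (F 0)) (𝓜.restrict (F 1)))
  | i + 1, F =>
    (𝓜.toBroken (𝓜.stepU k θ (op i F).2),
      𝓜.toBroken (𝓜.stepQ k lam θ (𝓜.toBroken (𝓜.stepU k θ (op i F).2)) (op i (advDiff F)).1))

variable {𝓜 k lam θ}

theorem exists_continuous_eqOn (j : Fin 𝓜.N) {w : ℝ → ℝ} (hw : ContinuousOn w (𝓜.cell j)) :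
    ∃ g : ℝ → ℝ, Continuous g ∧ EqOn w g (𝓜.cell j) := by
  refine ⟨IccExtend (𝓜.left_le_right j) ((Icc (𝓜.left j) (𝓜.right j)).domRestrict w),
    (continuousOn_iff_continuous_domRestrict.1 hw).Icc_extend', fun x hx => ?_⟩
  rw [IccExtend_of_mem (𝓜.left_le_right j) _ hx]
  rfl

theorem integral_left_congr {j : Fin 𝓜.N} {w g : ℝ → ℝ} (h : EqOn w g (𝓜.cell j)) {x : ℝ}
    (hx : x ∈ 𝓜.cell j) : ∫ τ in 𝓜.left j..x, w τ = ∫ τ in 𝓜.left j..x, g τ := by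
  refine intervalIntegral.integral_congr fun y hy => h ?_
  rw [uIcc_of_le hx.1] at hy
  exact ⟨hy.1, hy.2.trans hx.2⟩

theorem cell_integral_congr {j : Fin 𝓜.N} {f g : ℝ → ℝ} (h : EqOn f g (𝓜.cell j)) :
    ∫ x in 𝓜.left j..𝓜.right j, f x = ∫ x in 𝓜.left j..𝓜.right j, g x :=
  integral_left_congr h (𝓜.right_mem_cell j)

theorem CellCont.cellPrim {w : 𝓜.Broken} (hw : 𝓜.CellCont w) : 𝓜.CellCont (𝓜.cellPrim w) := by
  intro j
  obtain ⟨g, hg, hwg⟩ := exists_continuous_eqOn j (hw j)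
  have h1 : ContinuousOn (fun x => ∫ τ in 𝓜.left j..x, g τ) (𝓜.cell j) := fun x _ =>
    (hg.integral_hasStrictDerivAt (𝓜.left j) x).hasDerivAt.continuousAt.continuousWithinAt
  refine h1.congr fun x hx => ?_
  rw [cellPrim_apply, integral_left_congr hwg hx]

theorem cellPrim_congr {v w : 𝓜.Broken} (h : ∀ j, EqOn (v j) (w j) (𝓜.cell j)) (j : Fin 𝓜.N) :
    EqOn (𝓜.cellPrim v j) (𝓜.cellPrim w j) (𝓜.cell j) := fun x hx => by
  rw [cellPrim_apply, cellPrim_apply, integral_left_congr (h j) hx]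

theorem cellPrim_add_smul {v w : 𝓜.Broken} (hv : 𝓜.CellCont v) (hw : 𝓜.CellCont w) (c : ℝ)
    (j : Fin 𝓜.N) : EqOn (𝓜.cellPrim (v + c • w) j) ((𝓜.cellPrim v + c • 𝓜.cellPrim w) j)
      (𝓜.cell j) := fun x hx => by
  simp only [Pi.add_apply, Pi.smul_apply, smul_eq_mul, cellPrim_apply]
  have hsub : uIcc (𝓜.left j) x ⊆ 𝓜.cell j := uIcc_subset_Icc (𝓜.left_mem_cell j) hx
  rw [← intervalIntegral.integral_const_mul, ← intervalIntegral.integral_add]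
  · exact ((hv j).mono hsub).intervalIntegrable
  · exact (((hw j).mono hsub).intervalIntegrable).const_mul c

theorem abs_cellPrim_le {w : 𝓜.Broken} {M : ℝ} {j : Fin 𝓜.N} (h : ∀ x ∈ 𝓜.cell j, |w j x| ≤ M) :
    ∀ x ∈ 𝓜.cell j, |𝓜.cellPrim w j x| ≤ 𝓜.maxSize * M := by
  intro x hx
  rw [cellPrim_apply, mul_comm]
  have h0 : 0 ≤ M := (abs_nonneg _).trans (h x hx)
  have h1 := intervalIntegral.norm_integral_le_of_norm_le_const (a := 𝓜.left j) (b := x)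
    (f := w j) (C := M) fun y hy => h y (by
      rw [uIoc_of_le hx.1] at hy
      exact ⟨hy.1.le, hy.2.trans hx.2⟩)
  refine h1.trans (mul_le_mul_of_nonneg_left ?_ h0)
  rw [abs_of_nonneg (sub_nonneg.2 hx.1)]
  have := 𝓜.size_le_maxSize j
  rw [size] at this
  linarith [hx.2]

/-- Integration by parts with a cell primitive. -/
theorem integral_cellPrim_mul {w : 𝓜.Broken} {j : Fin 𝓜.N} (hw : ContinuousOn (w j) (𝓜.cell j))
    (V : ℝ[X]) : ∫ x in 𝓜.left j..𝓜.right j, 𝓜.cellPrim w j x * (derivative V).eval x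
      = (∫ x in 𝓜.left j..𝓜.right j, w j x) * V.eval (𝓜.right j)
        - ∫ x in 𝓜.left j..𝓜.right j, w j x * V.eval x := by
  obtain ⟨g, hg, hwg⟩ := exists_continuous_eqOn j hw
  have e1 : ∫ x in 𝓜.left j..𝓜.right j, 𝓜.cellPrim w j x * (derivative V).eval x
      = ∫ x in 𝓜.left j..𝓜.right j, (∫ τ in 𝓜.left j..x, g τ) * (derivative V).eval x := by
    refine cell_integral_congr fun x hx => ?_
    simp only [cellPrim_apply, integral_left_congr hwg hx]
  have e2 : ∫ x in 𝓜.left j..𝓜.right j, w j x * V.eval x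
      = ∫ x in 𝓜.left j..𝓜.right j, g x * V.eval x :=
    cell_integral_congr fun x hx => by simp only [hwg hx]
  rw [e1, e2, cell_integral_congr hwg]
  rw [intervalIntegral.integral_mul_deriv_eq_deriv_mul (u' := g) (v := fun x => V.eval x)
    (fun x _ => (hg.integral_hasStrictDerivAt (𝓜.left j) x).hasDerivAt)
    (fun x _ => V.hasDerivAt x) (hg.intervalIntegrable _ _) (intervalIntegrable_eval _ _ _)]
  simp

/-- Integrate by parts against x^(m+1)/(m+1). The boundary term contains the mean of w, which
vanishes; the primitive loses one order of orthogonality. -/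
theorem orthogonal_cellPrim {w : 𝓜.Broken} {j : Fin 𝓜.N} (hw : ContinuousOn (w j) (𝓜.cell j))
    {n : ℕ} (h : ∀ m < n, ∫ x in 𝓜.left j..𝓜.right j, w j x * x ^ m = 0) {m : ℕ}
    (hm : m + 1 < n) : ∫ x in 𝓜.left j..𝓜.right j, 𝓜.cellPrim w j x * x ^ m = 0 := by
  have h1 := integral_cellPrim_mul hw (C ((m : ℝ) + 1)⁻¹ * X ^ (m + 1))
  have hm0 : (m : ℝ) + 1 ≠ 0 := by positivity
  have e : ∀ x : ℝ, (derivative (C ((m : ℝ) + 1)⁻¹ * X ^ (m + 1) : ℝ[X])).eval x = x ^ m := by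
    intro x
    simp
    field_simp
  simp_rw [e] at h1
  have h2 := h 0 (by omega)
  simp only [pow_zero, mul_one] at h2
  rw [h1, h2, zero_mul, zero_sub, neg_eq_zero]
  have e2 : ∀ x, w j x * (C ((m : ℝ) + 1)⁻¹ * X ^ (m + 1) : ℝ[X]).eval x
      = ((m : ℝ) + 1)⁻¹ * (w j x * x ^ (m + 1)) := by
    intro x
    simp
    ring
  simp_rw [e2, intervalIntegral.integral_const_mul, h (m + 1) hm, mul_zero]

theorem IsRadau.integral_mul_eq {z : 𝓜.Broken} {g : Fin 𝓜.N → ℝ} {p : 𝓜.PiecePoly}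
    (hz : 𝓜.CellCont z) (hp : 𝓜.IsRadau k θ z g p) (j : Fin 𝓜.N) {v : ℝ[X]}
    (hv : v ∈ degreeLT ℝ k) : ∫ x in 𝓜.left j..𝓜.right j, (p j).eval x * v.eval x
      = ∫ x in 𝓜.left j..𝓜.right j, z j x * v.eval x := by
  have h := hp.2.1 j v hv
  simp_rw [sub_mul] at h
  rw [intervalIntegral.integral_sub, sub_eq_zero] at h
  · exact h
  · exact (by fun_prop : Continuous _).intervalIntegrable _ _
  · exact (hz.intervalIntegrable j).mul_continuousOn (by fun_prop)

theorem _root_.LDG.IsJet.cellCont {m : ℕ} {F : ℕ → ℝ → ℝ} {M : ℝ} (hF : IsJet m F M) {i : ℕ} (hi : i ≤ m) :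
    𝓜.CellCont (𝓜.restrict (F i)) := fun j => (hF.cont i hi).mono (𝓜.cell_subset j)

theorem exists_taylor {n : ℕ} {F : ℕ → ℝ → ℝ} {M : ℝ} (hF : IsJet (n + 1) F M) :
    ∃ τ : 𝓜.PiecePoly, 𝓜.InSpace n τ ∧ ∀ j, ∀ x ∈ 𝓜.cell j,
      |F 0 x - (τ j).eval x| ≤ M * 𝓜.maxSize ^ (n + 1) := by
  have h := fun j => exists_poly_approx (𝓜.left_le_right j) M (n + 1) F
    (fun i hi x hx => (hF.deriv i hi x (𝓜.cell_subset j hx)).mono (𝓜.cell_subset j))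
    (fun x hx => hF.bound (n + 1) le_rfl x (𝓜.cell_subset j hx))
  choose τ h1 h2 using h
  refine ⟨τ, h1, fun j x hx => (h2 j x hx).trans (mul_le_mul_of_nonneg_left ?_ hF.nonneg)⟩
  exact pow_le_pow_left₀ (𝓜.size_pos j).le (𝓜.size_le_maxSize j) _

/-- The projection reproduces τ, so its error is z - τ minus the projection of z - τ with the
corresponding node data, and stability bounds the latter. -/
theorem exists_radau_error (k : ℕ) {θ : ℝ} (hθ : θ ≠ 1 / 2) : ∃ K : ℝ, 0 < K ∧
    ∀ (𝓜 : Mesh) (z : 𝓜.Broken) (g : Fin 𝓜.N → ℝ) (τ : 𝓜.PiecePoly) (Z : ℝ), 0 ≤ Z →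
      𝓜.CellCont z → 𝓜.InSpace k τ → (∀ j, ∀ x ∈ 𝓜.cell j, |z j x - (τ j).eval x| ≤ Z) →
      (∀ j, |g j - 𝓜.avg θ (𝓜.toBroken τ) j| ≤ Z) → ∀ j, ∀ x ∈ 𝓜.cell j,
        |z j x - (𝓜.radau k θ z g j).eval x| ≤ K * Z := by
  obtain ⟨K, hK0, hK⟩ := exists_radau_bound k hθ
  refine ⟨K + 1, by positivity, fun 𝓜 z g τ Z hZ hz hτ hzτ hg j x hx => ?_⟩
  have h1 : 𝓜.IsRadau k θ (𝓜.toBroken τ) (𝓜.avg θ (𝓜.toBroken τ)) τ :=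
    ⟨hτ, by simp [toBroken], fun _ => rfl⟩
  have h2 := IsRadau.add_smul 𝓜 hz (𝓜.cellCont_toBroken τ) (𝓜.radau_spec k hθ hz g) h1 (-1)
  have h3 := hK 𝓜 _ _ _ Z hZ (hz.add ((𝓜.cellCont_toBroken τ).smul (-1)))
    (fun j x hx => by simpa [toBroken, ← sub_eq_add_neg] using hzτ j x hx)
    (fun j => by simpa [← sub_eq_add_neg] using hg j) h2 j x hx
  simp only [Pi.add_apply, Pi.smul_apply, eval_add, eval_smul, smul_eq_mul, neg_one_mul,
    ← sub_eq_add_neg] at h3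
  have e : z j x - (𝓜.radau k θ z g j).eval x
      = z j x - (τ j).eval x - ((𝓜.radau k θ z g j).eval x - (τ j).eval x) := by ring
  rw [e]
  linarith [abs_sub (z j x - (τ j).eval x) ((𝓜.radau k θ z g j).eval x - (τ j).eval x),
    hzτ j x hx]

theorem one_sub_ne_half (hθ : θ ≠ 1 / 2) : 1 - θ ≠ 1 / 2 := fun h => hθ (by linarith)

theorem cellCont_op (i : ℕ) (F : ℕ → ℝ → ℝ) (M : ℝ) (hF : IsJet 1 F M) :
    𝓜.CellCont (𝓜.op k lam θ i F).1 ∧ 𝓜.CellCont (𝓜.op k lam θ i F).2 := by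
  cases i with
  | zero =>
    exact ⟨(hF.cellCont (by omega)).sub (𝓜.cellCont_toBroken _),
      (hF.cellCont (by omega)).sub (𝓜.cellCont_toBroken _)⟩
  | succ i => exact ⟨𝓜.cellCont_toBroken _, 𝓜.cellCont_toBroken _⟩

/-- Taylor polynomials serve as comparison functions. The node data of w_{q,0} contain the jump of
w_{u,0}, so the bound for w_{u,0} has to come first. -/
theorem exists_op_bound_zero (k : ℕ) (lam : ℝ) (hθ : θ ≠ 1 / 2) : ∃ C : ℝ, 0 < C ∧
    ∀ (𝓜 : Mesh) (F : ℕ → ℝ → ℝ) (M : ℝ),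
      (IsJet (k + 1) F M → ∀ j, ∀ x ∈ 𝓜.cell j,
        |(𝓜.op k lam θ 0 F).1 j x| ≤ C * 𝓜.maxSize ^ (k + 1) * M) ∧
      (IsJet (k + 2) F M → ∀ j, ∀ x ∈ 𝓜.cell j,
        |(𝓜.op k lam θ 0 F).2 j x| ≤ C * 𝓜.maxSize ^ (k + 1) * M) := by
  obtain ⟨K₁, hK₁, h₁⟩ := exists_radau_error k hθ
  obtain ⟨K₂, hK₂, h₂⟩ := exists_radau_error k (one_sub_ne_half hθ)
  set A := 1 + |θ| + |1 - θ| with hA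
  have hA1 : 1 ≤ A := by linarith [abs_nonneg θ, abs_nonneg (1 - θ)]
  set E := A + |lam - θ| * (2 * (K₁ * A)) with hE
  have hE0 : 0 ≤ |lam - θ| * (2 * (K₁ * A)) := by positivity
  have hU : ∀ (𝓜 : Mesh) (F : ℕ → ℝ → ℝ) (M : ℝ), IsJet (k + 1) F M → ∀ j, ∀ x ∈ 𝓜.cell j,
        |(𝓜.op k lam θ 0 F).1 j x| ≤ K₁ * A * 𝓜.maxSize ^ (k + 1) * M := by
    intro 𝓜 F M hF j x hx
    obtain ⟨τ, hτ, hτF⟩ := exists_taylor (𝓜 := 𝓜) hF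
    have hM := hF.nonneg
    have hh := 𝓜.maxSize_pos
    have hZ0 : 0 ≤ M * 𝓜.maxSize ^ (k + 1) := by positivity
    have := h₁ 𝓜 (𝓜.restrict (F 0)) (𝓜.avg θ (𝓜.restrict (F 0))) τ
      (A * (M * 𝓜.maxSize ^ (k + 1))) (by positivity) (hF.cellCont (by omega)) hτ
      (fun j x hx => (hτF j x hx).trans (by nlinarith)) (fun j => by
        rw [← avg_sub]
        refine (𝓜.abs_avg_le θ (v := 𝓜.restrict (F 0) - 𝓜.toBroken τ) hτF j).trans ?_
        apply mul_le_mul_of_nonneg_right _ hZ0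
        linarith) j x hx
    calc _ ≤ K₁ * (A * (M * 𝓜.maxSize ^ (k + 1))) := this
      _ = _ := by ring
  refine ⟨K₁ * A + K₂ * E, by positivity, fun 𝓜 F M => ⟨fun hF j x hx => ?_, fun hF j x hx => ?_⟩⟩
  · have hM := hF.nonneg
    have hh := 𝓜.maxSize_pos
    refine (hU 𝓜 F M hF j x hx).trans ?_
    have : 0 ≤ K₂ * E := by positivity
    gcongr
    linarith
  · have hM := hF.nonneg
    have hh := 𝓜.maxSize_pos
    obtain ⟨τ, hτ, hτF⟩ := exists_taylor (𝓜 := 𝓜) hF.shift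
    have hZ0 : 0 ≤ M * 𝓜.maxSize ^ (k + 1) := by positivity
    have hu := hU 𝓜 F M (hF.mono (by omega))
    have := h₂ 𝓜 (𝓜.restrict (F 1)) (fun j => 𝓜.avg (1 - θ) (𝓜.restrict (F 1)) j
        + (lam - θ) * 𝓜.jump (𝓜.op k lam θ 0 F).1 j) τ
      (E * (M * 𝓜.maxSize ^ (k + 1))) (by positivity) (hF.cellCont (by omega)) hτ
      (fun j x hx => (hτF j x hx).trans (by nlinarith)) (fun j => by
        rw [add_sub_right_comm, ← avg_sub]
        have a1 := 𝓜.abs_avg_le (1 - θ) (v := 𝓜.restrict (F 1) - 𝓜.toBroken τ) hτF j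
        rw [sub_sub_cancel] at a1
        have a2 : |𝓜.jump (𝓜.op k lam θ 0 F).1 j| ≤ 2 * (K₁ * A * 𝓜.maxSize ^ (k + 1) * M) := by
          rw [jump]
          refine (abs_sub _ _).trans ?_
          linarith [hu _ _ (𝓜.left_mem_cell (𝓜.next j)), hu _ _ (𝓜.right_mem_cell j)]
        have a3 : |(lam - θ) * 𝓜.jump (𝓜.op k lam θ 0 F).1 j|
            ≤ |lam - θ| * (2 * (K₁ * A * 𝓜.maxSize ^ (k + 1) * M)) := by
          rw [abs_mul]
          exact mul_le_mul_of_nonneg_left a2 (abs_nonneg _)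
        refine (abs_add_le _ _).trans ((add_le_add a1 a3).trans ?_)
        have e : E * (M * 𝓜.maxSize ^ (k + 1)) = (1 + |θ| + |1 - θ|) * (M * 𝓜.maxSize ^ (k + 1))
            + |lam - θ| * (2 * (K₁ * A * 𝓜.maxSize ^ (k + 1) * M)) := by
          rw [hE, hA]
          ring
        rw [e]
        linarith) j x hx
    have e : (𝓜.op k lam θ 0 F).2 j x = 𝓜.restrict (F 1) j x
        - (𝓜.radau k (1 - θ) (𝓜.restrict (F 1)) (fun j => 𝓜.avg (1 - θ) (𝓜.restrict (F 1)) j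
        + (lam - θ) * 𝓜.jump (𝓜.op k lam θ 0 F).1 j) j).eval x := rfl
    rw [e]
    refine this.trans ?_
    have h3 : 0 ≤ K₁ * A * (M * 𝓜.maxSize ^ (k + 1)) := by positivity
    have e2 : (K₁ * A + K₂ * E) * 𝓜.maxSize ^ (k + 1) * M
        = K₁ * A * (M * 𝓜.maxSize ^ (k + 1)) + K₂ * (E * (M * 𝓜.maxSize ^ (k + 1))) := by ring
    rw [e2]
    linarith

/-- The correction functions gain one order of the mesh size at every step. -/
theorem exists_op_bound (k : ℕ) (lam : ℝ) (hθ : θ ≠ 1 / 2) (i : ℕ) : ∃ C : ℝ, 0 < C ∧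
    ∀ (𝓜 : Mesh) (F : ℕ → ℝ → ℝ) (M : ℝ),
      (IsJet (k + 1 + i) F M → ∀ j, ∀ x ∈ 𝓜.cell j,
        |(𝓜.op k lam θ i F).1 j x| ≤ C * 𝓜.maxSize ^ (k + 1 + i) * M) ∧
      (IsJet (k + 2 + i) F M → ∀ j, ∀ x ∈ 𝓜.cell j,
        |(𝓜.op k lam θ i F).2 j x| ≤ C * 𝓜.maxSize ^ (k + 1 + i) * M) := by
  induction i with
  | zero => exact exists_op_bound_zero k lam hθ
  | succ i ih =>
    obtain ⟨C, hC0, hC⟩ := ih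
    obtain ⟨K₁, hK₁, h₁⟩ := exists_radau_bound k hθ
    obtain ⟨K₂, hK₂, h₂⟩ := exists_radau_bound k (one_sub_ne_half hθ)
    set A := 1 + |lam| + |1 - lam| with hA
    have hU : ∀ (𝓜 : Mesh) (F : ℕ → ℝ → ℝ) (M : ℝ), IsJet (k + 1 + (i + 1)) F M →
        ∀ j, ∀ x ∈ 𝓜.cell j,
          |(𝓜.op k lam θ (i + 1) F).1 j x| ≤ K₁ * C * 𝓜.maxSize ^ (k + 1 + (i + 1)) * M := by
      intro 𝓜 F M hF j x hx
      have hM := hF.nonneg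
      have hh := 𝓜.maxSize_pos
      have hw := (hC 𝓜 F M).2 (hF.mono (by omega))
      have hc := (cellCont_op (𝓜 := 𝓜) (k := k) (lam := lam) (θ := θ) i F M
        (hF.mono (by omega))).2.cellPrim
      have := h₁ 𝓜 (𝓜.cellPrim (𝓜.op k lam θ i F).2) 0 _
        (𝓜.maxSize * (C * 𝓜.maxSize ^ (k + 1 + i) * M)) (by positivity) hc
        (fun j => abs_cellPrim_le (hw j)) (fun j => by simp; positivity)
        (𝓜.radau_spec k hθ hc 0) j x hx
      refine this.trans (le_of_eq ?_)
      ring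
    refine ⟨K₁ * C + K₂ * (A * (K₁ * C) + 2 * C), by positivity, fun 𝓜 F M =>
      ⟨fun hF j x hx => ?_, fun hF j x hx => ?_⟩⟩
    · have hM := hF.nonneg
      have hh := 𝓜.maxSize_pos
      refine (hU 𝓜 F M hF j x hx).trans ?_
      have : 0 ≤ K₂ * (A * (K₁ * C) + 2 * C) := by positivity
      gcongr
      linarith
    · have hM := hF.nonneg
      have hh := 𝓜.maxSize_pos
      have hu := hU 𝓜 F M (hF.mono (by omega))
      -- Here the extra derivative in the bound of the second component is consumed: order k + 1 + i
      -- of F'' - F' requires order k + 2 + (i + 1) of F.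
      have hFA : IsJet (k + 1 + i) (advDiff F) (2 * M) :=
        (hF.mono (by omega : k + 1 + i + 2 ≤ _)).advDiff
      have hw := (hC 𝓜 (advDiff F) (2 * M)).1 hFA
      have hc := (𝓜.cellCont_toBroken (𝓜.stepU k θ (𝓜.op k lam θ i F).2)).add
        (cellCont_op (𝓜 := 𝓜) (k := k) (lam := lam) (θ := θ) i (advDiff F) (2 * M)
          (hFA.mono (by omega))).1.cellPrim
      set H := 𝓜.maxSize ^ (k + 1 + (i + 1)) * M with hH
      have hH0 : 0 ≤ H := by positivity
      have hu' : ∀ j, ∀ x ∈ 𝓜.cell j, |(𝓜.op k lam θ (i + 1) F).1 j x| ≤ K₁ * C * H := by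
        intro j x hx
        refine (hu j x hx).trans (le_of_eq ?_)
        rw [hH]
        ring
      have hKC : 0 ≤ K₁ * C * H := by positivity
      have hCH : 0 ≤ C * H := by positivity
      have hA1 : 0 ≤ (|lam| + |1 - lam|) * (K₁ * C * H) := by positivity
      have := h₂ 𝓜 _ _ _ ((A * (K₁ * C) + 2 * C) * H) (by positivity) hc
        (fun j x hx => by
          refine (abs_add_le _ _).trans ((add_le_add (hu' j x hx)
            (abs_cellPrim_le (hw j) x hx)).trans ?_)
          have e : 𝓜.maxSize * (C * 𝓜.maxSize ^ (k + 1 + i) * (2 * M)) = 2 * C * H := by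
            rw [hH]
            ring
          rw [e, hA]
          linarith) (fun j => by
          refine (𝓜.abs_avg_le lam hu' j).trans ?_
          rw [hA]
          linarith) (𝓜.radau_spec k (one_sub_ne_half hθ) hc _) j x hx
      refine this.trans ?_
      have e2 : (K₁ * C + K₂ * (A * (K₁ * C) + 2 * C)) * 𝓜.maxSize ^ (k + 1 + (i + 1)) * M
          = K₁ * C * H + K₂ * ((A * (K₁ * C) + 2 * C) * H) := by
        rw [hH]
        ring
      rw [e2]
      linarith

/-! ### Linearity of the correction operators in the jet. -/

theorem advDiff_add_smul (F G : ℕ → ℝ → ℝ) (c : ℝ) :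
    advDiff (F + c • G) = advDiff F + c • advDiff G := by
  funext i x
  simp only [advDiff, Pi.add_apply, Pi.smul_apply, smul_eq_mul]
  ring

theorem jump_add_smul (v w : 𝓜.Broken) (c : ℝ) (j : Fin 𝓜.N) :
    𝓜.jump (v + c • w) j = 𝓜.jump v j + c * 𝓜.jump w j := by
  simp only [jump, Pi.add_apply, Pi.smul_apply, smul_eq_mul]
  ring

theorem avg_add_smul (α : ℝ) (v w : 𝓜.Broken) (c : ℝ) :
    𝓜.avg α (v + c • w) = 𝓜.avg α v + c • 𝓜.avg α w := by
  funext j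
  rw [avg_add, avg_smul]
  rfl

theorem toBroken_add_smul (p q : 𝓜.PiecePoly) (c : ℝ) :
    𝓜.toBroken (p + c • q) = 𝓜.toBroken p + c • 𝓜.toBroken q := by
  funext j x
  simp [toBroken]

/-- The order 1 + 2i counts the derivatives that occur in `op`: one for q, and two for each
application of `advDiff`. Equality is claimed on the cells only, where primitives and projections
are determined. -/
theorem op_add_smul (hθ : θ ≠ 1 / 2) (i : ℕ) : ∀ (F G : ℕ → ℝ → ℝ) (M M' c : ℝ),
    IsJet (1 + 2 * i) F M → IsJet (1 + 2 * i) G M' → ∀ j,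
      EqOn ((𝓜.op k lam θ i (F + c • G)).1 j)
        (((𝓜.op k lam θ i F).1 + c • (𝓜.op k lam θ i G).1) j) (𝓜.cell j) ∧
      EqOn ((𝓜.op k lam θ i (F + c • G)).2 j)
        (((𝓜.op k lam θ i F).2 + c • (𝓜.op k lam θ i G).2) j) (𝓜.cell j) := by
  induction i with
  | zero =>
    intro F G M M' c hF hG j
    have h1 : (𝓜.op k lam θ 0 (F + c • G)).1
        = (𝓜.op k lam θ 0 F).1 + c • (𝓜.op k lam θ 0 G).1 := by
      have e : 𝓜.proj k θ (𝓜.restrict ((F + c • G) 0))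
          = 𝓜.proj k θ (𝓜.restrict (F 0)) + c • 𝓜.proj k θ (𝓜.restrict (G 0)) := by
        have : 𝓜.restrict ((F + c • G) 0) = 𝓜.restrict (F 0) + c • 𝓜.restrict (G 0) := rfl
        rw [proj, this, avg_add_smul, 𝓜.radau_add_smul k hθ (hF.cellCont (by omega))
          (hG.cellCont (by omega)), toBroken_add_smul]
        rfl
      simp only [op, e]
      funext j x
      simp [restrict]
      ring
    refine ⟨fun x _ => by rw [h1], fun x _ => ?_⟩
    have e : 𝓜.projStar k lam θ (𝓜.restrict ((F + c • G) 0)) (𝓜.restrict ((F + c • G) 1))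
        = 𝓜.projStar k lam θ (𝓜.restrict (F 0)) (𝓜.restrict (F 1))
          + c • 𝓜.projStar k lam θ (𝓜.restrict (G 0)) (𝓜.restrict (G 1)) := by
      rw [projStar, projStar, projStar, ← toBroken_add_smul, ← 𝓜.radau_add_smul k
        (one_sub_ne_half hθ) (hF.cellCont (by omega)) (hG.cellCont (by omega))]
      congr 2
      funext j
      have h2 : 𝓜.jump (𝓜.op k lam θ 0 (F + c • G)).1 j
          = 𝓜.jump (𝓜.op k lam θ 0 F).1 j + c * 𝓜.jump (𝓜.op k lam θ 0 G).1 j := by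
        rw [h1, jump_add_smul]
      have h3 : 𝓜.avg (1 - θ) (𝓜.restrict ((F + c • G) 1)) j
          = 𝓜.avg (1 - θ) (𝓜.restrict (F 1)) j + c * 𝓜.avg (1 - θ) (𝓜.restrict (G 1)) j :=
        congrFun (avg_add_smul (1 - θ) (𝓜.restrict (F 1)) (𝓜.restrict (G 1)) c) j
      simp only [op] at h2
      rw [h2, h3]
      simp only [Pi.add_apply, Pi.smul_apply, smul_eq_mul]
      ring
    simp only [op, e]
    simp [restrict]
    ring
  | succ i ih =>
    intro F G M M' c hF hG j
    have ih1 := ih F G M M' c (hF.mono (by omega)) (hG.mono (by omega))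
    have hFA := (hF.mono (by omega : 1 + 2 * i + 2 ≤ _)).advDiff
    have hGA := (hG.mono (by omega : 1 + 2 * i + 2 ≤ _)).advDiff
    have ih2 := ih (advDiff F) (advDiff G) _ _ c hFA hGA
    have hcF := cellCont_op (𝓜 := 𝓜) (k := k) (lam := lam) (θ := θ) i F M (hF.mono (by omega))
    have hcG := cellCont_op (𝓜 := 𝓜) (k := k) (lam := lam) (θ := θ) i G M' (hG.mono (by omega))
    have hcFA := cellCont_op (𝓜 := 𝓜) (k := k) (lam := lam) (θ := θ) i (advDiff F) _
      (hFA.mono (by omega))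
    have hcGA := cellCont_op (𝓜 := 𝓜) (k := k) (lam := lam) (θ := θ) i (advDiff G) _
      (hGA.mono (by omega))
    have h1 : 𝓜.stepU k θ (𝓜.op k lam θ i (F + c • G)).2
        = 𝓜.stepU k θ (𝓜.op k lam θ i F).2 + c • 𝓜.stepU k θ (𝓜.op k lam θ i G).2 := by
      rw [stepU, stepU, stepU, ← 𝓜.radau_add_smul k hθ hcF.2.cellPrim hcG.2.cellPrim]
      refine 𝓜.radau_congr (fun j => ?_) (by simp)
      exact (cellPrim_congr (fun j => (ih1 j).2) j).trans (cellPrim_add_smul hcF.2 hcG.2 c j)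
    have h2 : 𝓜.stepQ k lam θ (𝓜.toBroken (𝓜.stepU k θ (𝓜.op k lam θ i (F + c • G)).2))
          (𝓜.op k lam θ i (advDiff (F + c • G))).1
        = 𝓜.stepQ k lam θ (𝓜.toBroken (𝓜.stepU k θ (𝓜.op k lam θ i F).2))
            (𝓜.op k lam θ i (advDiff F)).1
          + c • 𝓜.stepQ k lam θ (𝓜.toBroken (𝓜.stepU k θ (𝓜.op k lam θ i G).2))
            (𝓜.op k lam θ i (advDiff G)).1 := by
      rw [h1, stepQ, stepQ, stepQ, ← 𝓜.radau_add_smul k (one_sub_ne_half hθ)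
        ((𝓜.cellCont_toBroken _).add hcFA.1.cellPrim) ((𝓜.cellCont_toBroken _).add hcGA.1.cellPrim)]
      refine 𝓜.radau_congr (fun j => ?_) (by rw [toBroken_add_smul, avg_add_smul])
      intro x hx
      rw [advDiff_add_smul, toBroken_add_smul]
      have := ((cellPrim_congr (fun j => (ih2 j).1) j).trans
        (cellPrim_add_smul hcFA.1 hcGA.1 c j)) hx
      simp only [Pi.add_apply, Pi.smul_apply, smul_eq_mul] at this ⊢
      rw [this]
      ring
    exact ⟨fun x _ => by simp only [op, h1, toBroken_add_smul],
      fun x _ => by simp only [op, h2, toBroken_add_smul]⟩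

end Operators

end Mesh

namespace Mesh

/-! ### Orthogonality, node conditions and time dependence of the corrections. -/

section OperatorProperties

variable {𝓜 : Mesh} {k : ℕ} {lam θ : ℝ}

/-- The initial projection errors are orthogonal to degrees below k, and each primitive costs one
order. -/
theorem op_orthogonal (hθ : θ ≠ 1 / 2) (i : ℕ) : ∀ (F : ℕ → ℝ → ℝ) (M : ℝ),
    IsJet (1 + 2 * i) F M → ∀ m, m + i < k → ∀ j,
      ∫ x in 𝓜.left j..𝓜.right j, (𝓜.op k lam θ i F).1 j x * x ^ m = 0 ∧
      ∫ x in 𝓜.left j..𝓜.right j, (𝓜.op k lam θ i F).2 j x * x ^ m = 0 := by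
  induction i with
  | zero =>
    intro F M hF m hm j
    have hX : (X ^ m : ℝ[X]) ∈ degreeLT ℝ k := X_pow_mem_degreeLT (by omega)
    have aux : ∀ (f : ℝ → ℝ) (α : ℝ) (g : Fin 𝓜.N → ℝ), α ≠ 1 / 2 → 𝓜.CellCont (𝓜.restrict f) →
        ∫ x in 𝓜.left j..𝓜.right j,
          (f x - (𝓜.radau k α (𝓜.restrict f) g j).eval x) * x ^ m = 0 := by
      intro f α g hα hf
      have h := (𝓜.radau_spec k hα hf g).2.1 j _ hX
      have e : ∀ x, (f x - (𝓜.radau k α (𝓜.restrict f) g j).eval x) * x ^ m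
          = -(((𝓜.radau k α (𝓜.restrict f) g j).eval x - 𝓜.restrict f j x)
            * (X ^ m : ℝ[X]).eval x) := by
        intro x
        simp [restrict]
        ring
      simp_rw [e]
      rw [intervalIntegral.integral_neg, h, neg_zero]
    exact ⟨aux _ _ _ hθ (hF.cellCont (by omega)),
      aux _ _ _ (one_sub_ne_half hθ) (hF.cellCont (by omega))⟩
  | succ i ih =>
    intro F M hF m hm j
    have hX : (X ^ m : ℝ[X]) ∈ degreeLT ℝ k := X_pow_mem_degreeLT (by omega)
    have hFA := (hF.mono (by omega : 1 + 2 * i + 2 ≤ _)).advDiff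
    have hcF := cellCont_op (𝓜 := 𝓜) (k := k) (lam := lam) (θ := θ) i F M (hF.mono (by omega))
    have hcFA := cellCont_op (𝓜 := 𝓜) (k := k) (lam := lam) (θ := θ) i (advDiff F) _
      (hFA.mono (by omega))
    have h1 : ∫ x in 𝓜.left j..𝓜.right j, (𝓜.op k lam θ (i + 1) F).1 j x * x ^ m = 0 := by
      have h2 := IsRadau.integral_mul_eq hcF.2.cellPrim
        (𝓜.radau_spec k hθ hcF.2.cellPrim 0) j hX
      simp only [eval_pow, eval_X] at h2
      have h3 := orthogonal_cellPrim (hcF.2 j) (n := k - i)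
        (fun m hm => (ih F M (hF.mono (by omega)) m (by omega) j).2) (m := m) (by omega)
      exact h2.trans h3
    refine ⟨h1, ?_⟩
    have hc := (𝓜.cellCont_toBroken (𝓜.stepU k θ (𝓜.op k lam θ i F).2)).add hcFA.1.cellPrim
    have h2 := IsRadau.integral_mul_eq hc (𝓜.radau_spec k (one_sub_ne_half hθ) hc
      (𝓜.avg lam (𝓜.toBroken (𝓜.stepU k θ (𝓜.op k lam θ i F).2)))) j hX
    simp only [eval_pow, eval_X] at h2
    have h3 := orthogonal_cellPrim (hcFA.1 j) (n := k - i)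
        (fun m hm => (ih (advDiff F) _ hFA m (by omega) j).1) (m := m) (by omega)
    refine h2.trans ?_
    simp only [Pi.add_apply, add_mul]
    rw [intervalIntegral.integral_add, h3, add_zero]
    · exact h1
    · exact (by fun_prop : Continuous fun x => (𝓜.stepU k θ (𝓜.op k lam θ i F).2 j).eval x
        * x ^ m).intervalIntegrable _ _
    · exact (hcFA.1.cellPrim.intervalIntegrable j).mul_continuousOn (by fun_prop)

/-- Node conditions of the corrections. -/
theorem op_nodes (hθ : θ ≠ 1 / 2) (i : ℕ) (F : ℕ → ℝ → ℝ) (M : ℝ) (hF : IsJet (1 + 2 * i) F M)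
    (j : Fin 𝓜.N) : 𝓜.avg θ (𝓜.op k lam θ i F).1 j = 0 ∧
      𝓜.avg (1 - θ) (𝓜.op k lam θ i F).2 j = 𝓜.avg lam (𝓜.op k lam θ i F).1 j := by
  cases i with
  | zero =>
    have h1 := (𝓜.radau_spec k hθ (hF.cellCont (i := 0) (by omega))
      (𝓜.avg θ (𝓜.restrict (F 0)))).2.2 j
    have h2 := (𝓜.radau_spec k (one_sub_ne_half hθ) (hF.cellCont (i := 1) (by omega))
      (fun j => 𝓜.avg (1 - θ) (𝓜.restrict (F 1)) j
        + (lam - θ) * 𝓜.jump (𝓜.op k lam θ 0 F).1 j)).2.2 j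
    have e1 : 𝓜.avg θ (𝓜.op k lam θ 0 F).1 j = 0 := by
      simp only [op, proj]
      rw [avg_sub, h1, sub_self]
    refine ⟨e1, ?_⟩
    have e2 : 𝓜.avg (1 - θ) (𝓜.op k lam θ 0 F).2 j
        = -((lam - θ) * 𝓜.jump (𝓜.op k lam θ 0 F).1 j) := by
      change 𝓜.avg (1 - θ) (𝓜.restrict (F 1) - 𝓜.toBroken (𝓜.radau k (1 - θ) (𝓜.restrict (F 1))
        fun j => 𝓜.avg (1 - θ) (𝓜.restrict (F 1)) j
        + (lam - θ) * 𝓜.jump (𝓜.op k lam θ 0 F).1 j)) j = _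
      rw [avg_sub, h2]
      ring
    rw [e2]
    simp only [avg, jump] at e1 ⊢
    -- Uses v^{(λ)} = v^{(θ)} - (λ - θ)[v] for v = w_{u,0}, whose θ-average is zero. This is the
    -- purpose of the jump term in the modified projection.
    linear_combination -e1
  | succ i =>
    have hFA := (hF.mono (by omega : 1 + 2 * i + 2 ≤ _)).advDiff
    have hcF := cellCont_op (𝓜 := 𝓜) (k := k) (lam := lam) (θ := θ) i F M (hF.mono (by omega))
    have hcFA := cellCont_op (𝓜 := 𝓜) (k := k) (lam := lam) (θ := θ) i (advDiff F) _
      (hFA.mono (by omega))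
    have hc := (𝓜.cellCont_toBroken (𝓜.stepU k θ (𝓜.op k lam θ i F).2)).add hcFA.1.cellPrim
    exact ⟨(𝓜.radau_spec k hθ hcF.2.cellPrim 0).2.2 j,
      (𝓜.radau_spec k (one_sub_ne_half hθ) hc _).2.2 j⟩

/-- Mean zero makes the cell primitive vanish at the right end as well, so the integrations by parts
below have no boundary term. -/
theorem op_integral_eq_zero (hθ : θ ≠ 1 / 2) {i : ℕ} (hi : i < k) {F : ℕ → ℝ → ℝ} {M : ℝ}
    (hF : IsJet (1 + 2 * i) F M) (j : Fin 𝓜.N) :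
      ∫ x in 𝓜.left j..𝓜.right j, (𝓜.op k lam θ i F).1 j x = 0 ∧
      ∫ x in 𝓜.left j..𝓜.right j, (𝓜.op k lam θ i F).2 j x = 0 := by
  have h := op_orthogonal (𝓜 := 𝓜) (k := k) (lam := lam) hθ i F M hF 0 (by omega) j
  simpa using h

/-- The relation between `w_{u,i+1}` and `w_{q,i}`, tested with derivatives. -/
theorem op_succ_fst (hθ : θ ≠ 1 / 2) {i : ℕ} (hi : i < k) {F : ℕ → ℝ → ℝ} {M : ℝ}
    (hF : IsJet (1 + 2 * i) F M) (j : Fin 𝓜.N) {v : ℝ[X]} (hv : v ∈ degreeLT ℝ (k + 1)) :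
      ∫ x in 𝓜.left j..𝓜.right j, (𝓜.op k lam θ (i + 1) F).1 j x * (derivative v).eval x
        = -∫ x in 𝓜.left j..𝓜.right j, (𝓜.op k lam θ i F).2 j x * v.eval x := by
  have hcF := cellCont_op (𝓜 := 𝓜) (k := k) (lam := lam) (θ := θ) i F M (hF.mono (by omega))
  have h1 := IsRadau.integral_mul_eq hcF.2.cellPrim
    (𝓜.radau_spec k hθ hcF.2.cellPrim 0) j (derivative_mem_degreeLT hv)
  have h2 := integral_cellPrim_mul (hcF.2 j) v
  rw [(op_integral_eq_zero hθ hi hF j).2, zero_mul, zero_sub] at h2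
  exact h1.trans h2

/-- The relation between `w_{u,i+1}`, `w_{q,i+1}` and `∂_t w_{u,i}`, tested with derivatives. -/
theorem op_succ_sub (hθ : θ ≠ 1 / 2) {i : ℕ} (hi : i < k) {F : ℕ → ℝ → ℝ} {M : ℝ}
    (hF : IsJet (1 + 2 * (i + 1)) F M) (j : Fin 𝓜.N) {v : ℝ[X]} (hv : v ∈ degreeLT ℝ (k + 1)) :
      ∫ x in 𝓜.left j..𝓜.right j, ((𝓜.op k lam θ (i + 1) F).1 j x
          - (𝓜.op k lam θ (i + 1) F).2 j x) * (derivative v).eval x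
        = ∫ x in 𝓜.left j..𝓜.right j, (𝓜.op k lam θ i (advDiff F)).1 j x * v.eval x := by
  have hFA := (hF.mono (by omega : 1 + 2 * i + 2 ≤ _)).advDiff
  have hcFA := cellCont_op (𝓜 := 𝓜) (k := k) (lam := lam) (θ := θ) i (advDiff F) _
      (hFA.mono (by omega))
  have hc := (𝓜.cellCont_toBroken (𝓜.stepU k θ (𝓜.op k lam θ i F).2)).add hcFA.1.cellPrim
  have h1 := IsRadau.integral_mul_eq hc (𝓜.radau_spec k (one_sub_ne_half hθ) hc
    (𝓜.avg lam (𝓜.toBroken (𝓜.stepU k θ (𝓜.op k lam θ i F).2)))) j (derivative_mem_degreeLT hv)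
  have h2 := integral_cellPrim_mul (hcFA.1 j) v
  rw [(op_integral_eq_zero hθ hi hFA j).1, zero_mul, zero_sub] at h2
  have i1 : IntervalIntegrable (fun x => 𝓜.toBroken (𝓜.stepU k θ (𝓜.op k lam θ i F).2) j x
      * (derivative v).eval x) volume (𝓜.left j) (𝓜.right j) :=
    ((𝓜.cellCont_toBroken _).intervalIntegrable j).mul_continuousOn (by fun_prop)
  have i2 : IntervalIntegrable (fun x => 𝓜.cellPrim (𝓜.op k lam θ i (advDiff F)).1 j x
      * (derivative v).eval x) volume (𝓜.left j) (𝓜.right j) :=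
    (hcFA.1.cellPrim.intervalIntegrable j).mul_continuousOn (by fun_prop)
  simp only [Pi.add_apply, add_mul] at h1
  rw [intervalIntegral.integral_add i1 i2, h2] at h1
  simp only [sub_mul]
  have i3 : IntervalIntegrable (fun x => (𝓜.op k lam θ (i + 1) F).2 j x
      * (derivative v).eval x) volume (𝓜.left j) (𝓜.right j) :=
    ((𝓜.cellCont_toBroken _).intervalIntegrable j).mul_continuousOn (by fun_prop)
  have i4 : IntervalIntegrable (fun x => (𝓜.op k lam θ (i + 1) F).1 j x
      * (derivative v).eval x) volume (𝓜.left j) (𝓜.right j) := i1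
  rw [intervalIntegral.integral_sub i4 i3]
  have h3 : ∫ x in 𝓜.left j..𝓜.right j, (𝓜.op k lam θ (i + 1) F).2 j x * (derivative v).eval x
    = (∫ x in 𝓜.left j..𝓜.right j, (𝓜.op k lam θ (i + 1) F).1 j x * (derivative v).eval x)
      + -∫ x in 𝓜.left j..𝓜.right j, (𝓜.op k lam θ i (advDiff F)).1 j x * v.eval x := h1
  rw [h3]
  ring

theorem op_zero_sub (hθ : θ ≠ 1 / 2) {F : ℕ → ℝ → ℝ} {M : ℝ}
    (hF : IsJet 1 F M) (j : Fin 𝓜.N) {v : ℝ[X]} (hv : v ∈ degreeLT ℝ (k + 1)) :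
      (∫ x in 𝓜.left j..𝓜.right j, (𝓜.op k lam θ 0 F).1 j x * (derivative v).eval x = 0) ∧
      ∫ x in 𝓜.left j..𝓜.right j, (𝓜.op k lam θ 0 F).2 j x * (derivative v).eval x = 0 := by
  have hc := cellCont_op (𝓜 := 𝓜) (k := k) (lam := lam) (θ := θ) 0 F M hF
  have h := fun m (hm : m < k) => op_orthogonal (𝓜 := 𝓜) (k := k) (lam := lam) hθ 0 F M hF m hm j
  exact ⟨integral_mul_eq_zero_of_monomials (hc.1.intervalIntegrable j) (fun m hm => (h m hm).1)
      (derivative_mem_degreeLT hv),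
    integral_mul_eq_zero_of_monomials (hc.2.intervalIntegrable j) (fun m hm => (h m hm).2)
      (derivative_mem_degreeLT hv)⟩

/-! ### Dependence on time -/

variable {T B : ℝ} {D : ℝ → ℕ → ℝ → ℝ}

theorem op_sub_eq (hθ : θ ≠ 1 / 2) {i : ℕ} {F G : ℕ → ℝ → ℝ} {M M' : ℝ}
    (hF : IsJet (1 + 2 * i) F M) (hG : IsJet (1 + 2 * i) G M') (j : Fin 𝓜.N) {x : ℝ}
    (hx : x ∈ 𝓜.cell j) :
    (𝓜.op k lam θ i F).1 j x - (𝓜.op k lam θ i G).1 j x = (𝓜.op k lam θ i (F - G)).1 j x ∧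
    (𝓜.op k lam θ i F).2 j x - (𝓜.op k lam θ i G).2 j x = (𝓜.op k lam θ i (F - G)).2 j x := by
  have h := op_add_smul (𝓜 := 𝓜) (k := k) (lam := lam) hθ i F G M M' (-1) hF hG j
  have e : F + (-1 : ℝ) • G = F - G := by rw [neg_one_smul, sub_eq_add_neg]
  rw [e] at h
  rw [h.1 hx, h.2 hx]
  simp only [Pi.add_apply, Pi.smul_apply, smul_eq_mul]
  constructor <;> ring

/-- By linearity the remainder is the operator applied to the remainder of the jets. These are
available up to order 2k, and k + 1 + i ≤ 2k holds exactly for i < k. -/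
theorem op_uniform_deriv (hθ : θ ≠ 1 / 2) {i : ℕ} (hi : i < k)
    (hD : IsJetSolution (2 * k) T B D) : ∀ ε > 0, ∃ δ > 0, ∀ s ∈ Icc 0 T, ∀ t ∈ Icc 0 T,
      |s - t| < δ → ∀ j, ∀ x ∈ 𝓜.cell j,
        |(𝓜.op k lam θ i (D s)).1 j x - (𝓜.op k lam θ i (D t)).1 j x
          - (s - t) * (𝓜.op k lam θ i (advDiff (D t))).1 j x| ≤ ε * |s - t| := by
  obtain ⟨C, hC0, hC⟩ := exists_op_bound k lam hθ i
  intro ε hε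
  have hh := 𝓜.maxSize_pos
  obtain ⟨δ, hδ, hδ'⟩ := hD.jet_deriv (ε / (C * 𝓜.maxSize ^ (k + 1 + i))) (by positivity)
  refine ⟨δ, hδ, fun s hs t ht hst j x hx => ?_⟩
  have hj := hδ' s hs t ht hst
  have h1 := (hC 𝓜 _ _).1 (hj.mono (by omega)) j x hx
  have hjs := (hD.jet s hs).mono (by omega : 1 + 2 * i ≤ _)
  have hjt := (hD.jet t ht).mono (by omega : 1 + 2 * i ≤ _)
  have hA := (hD.jet t ht).advDiff.mono (by omega : 1 + 2 * i ≤ _)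
  have h2 := (op_add_smul (𝓜 := 𝓜) (k := k) (lam := lam) hθ i (D s - D t) (advDiff (D t)) _ _
    (-(s - t)) (hjs.sub hjt) hA j).1 hx
  have e : D s - D t + (-(s - t)) • advDiff (D t) = D s - D t - (s - t) • advDiff (D t) := by
    rw [neg_smul, sub_eq_add_neg (D s - D t)]
  rw [e] at h2
  rw [h2] at h1
  simp only [Pi.add_apply, Pi.smul_apply, smul_eq_mul] at h1
  rw [← (op_sub_eq (𝓜 := 𝓜) (k := k) (lam := lam) hθ hjs hjt j hx).1] at h1
  convert h1 using 1
  · congr 1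
    ring
  · field_simp

theorem op_hasDerivWithinAt (hθ : θ ≠ 1 / 2) {i : ℕ} (hi : i < k)
    (hD : IsJetSolution (2 * k) T B D) {t : ℝ} (ht : t ∈ Icc 0 T) {j : Fin 𝓜.N} {x : ℝ}
    (hx : x ∈ 𝓜.cell j) :
    HasDerivWithinAt (fun s => (𝓜.op k lam θ i (D s)).1 j x)
      ((𝓜.op k lam θ i (advDiff (D t))).1 j x) (Icc 0 T) t := by
  rw [hasDerivWithinAt_iff_isLittleO, Asymptotics.isLittleO_iff]
  intro ε hε
  obtain ⟨δ, hδ, hδ'⟩ := op_uniform_deriv (𝓜 := 𝓜) (k := k) (lam := lam) hθ hi hD ε hε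
  filter_upwards [self_mem_nhdsWithin, mem_nhdsWithin_of_mem_nhds (Metric.ball_mem_nhds t hδ)]
    with s hs hst
  exact hδ' s hs t ht hst j x hx

theorem op_uniform_continuous (hθ : θ ≠ 1 / 2) {i : ℕ} (hi : i ≤ k)
    (hD : IsJetSolution (2 * k) T B D) : ∀ ε > 0, ∃ δ > 0, ∀ s ∈ Icc 0 T, ∀ t ∈ Icc 0 T,
      |s - t| < δ → ∀ j, ∀ x ∈ 𝓜.cell j,
        |(𝓜.op k lam θ i (D s)).1 j x - (𝓜.op k lam θ i (D t)).1 j x| ≤ ε ∧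
        |(𝓜.op k lam θ i (D s)).2 j x - (𝓜.op k lam θ i (D t)).2 j x| ≤ ε := by
  obtain ⟨C, hC0, hC⟩ := exists_op_bound k lam hθ i
  intro ε hε
  have hh := 𝓜.maxSize_pos
  obtain ⟨δ, hδ, hδ'⟩ := hD.jet_continuous (ε / (C * 𝓜.maxSize ^ (k + 1 + i))) (by positivity)
  refine ⟨δ, hδ, fun s hs t ht hst j x hx => ?_⟩
  have hj := hδ' s hs t ht hst
  have h1 := (hC 𝓜 _ _).1 (hj.mono (by omega)) j x hx
  have h1' := (hC 𝓜 _ _).2 (hj.mono (by omega)) j x hx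
  have h2 := op_sub_eq (𝓜 := 𝓜) (k := k) (lam := lam) hθ
    ((hD.jet s hs).mono (by omega : 1 + 2 * i ≤ _)) ((hD.jet t ht).mono (by omega)) j hx
  rw [← h2.1, mul_div_cancel₀ _ (by positivity)] at h1
  rw [← h2.2, mul_div_cancel₀ _ (by positivity)] at h1'
  exact ⟨h1, h1'⟩

/-- Bounds for the last corrections, uniform in time. -/
theorem exists_last_bound (k : ℕ) (lam : ℝ) (hθ : θ ≠ 1 / 2) : ∃ C : ℝ, 0 < C ∧
    ∀ (𝓜 : Mesh) (T B : ℝ) (D : ℝ → ℕ → ℝ → ℝ), IsJetSolution (2 * k) T B D →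
      (∀ t ∈ Icc 0 T, ∀ j, ∀ x ∈ 𝓜.cell j,
        |(𝓜.op k lam θ k (D t)).2 j x| ≤ C * 𝓜.maxSize ^ (2 * k + 1) * B) ∧
      ∀ s ∈ Icc 0 T, ∀ t ∈ Icc 0 T, ∀ j, ∀ x ∈ 𝓜.cell j,
        |(𝓜.op k lam θ k (D s)).1 j x - (𝓜.op k lam θ k (D t)).1 j x|
          ≤ C * 𝓜.maxSize ^ (2 * k + 1) * B * |s - t| := by
  obtain ⟨C, hC0, hC⟩ := exists_op_bound k lam hθ k
  refine ⟨2 * C, by positivity, fun 𝓜 T B D hD => ⟨fun t ht j x hx => ?_,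
    fun s hs t ht j x hx => ?_⟩⟩
  · have hB := (hD.jet t ht).nonneg
    have hh := 𝓜.maxSize_pos
    have := (hC 𝓜 _ _).2 ((hD.jet t ht).mono (by omega)) j x hx
    rw [(by ring : k + 1 + k = 2 * k + 1)] at this
    refine this.trans ?_
    gcongr
    linarith
  -- For i = k the operator needs order 2k + 1, precisely the order at which the jets are still
  -- Lipschitz in time.
  · have := (hC 𝓜 _ _).1 ((hD.jet_lipschitz hs ht).mono (by omega)) j x hx
    rw [(by ring : k + 1 + k = 2 * k + 1)] at this
    rw [(op_sub_eq (𝓜 := 𝓜) (k := k) (lam := lam) hθ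
      ((hD.jet s hs).mono (by omega)) ((hD.jet t ht).mono (by omega)) j hx).1]
    refine this.trans (le_of_eq ?_)
    ring

/-- The correction functions are given by the correction operators. -/
theorem corr_eqOn (hθ : θ ≠ 1 / 2) {u : ℝ → ℝ → ℝ} (hD : IsJetSolution (2 * k) T B D)
    (hT : 0 < T) (h0 : ∀ t ∈ Icc 0 T, D t 0 = u t)
    (h1 : ∀ t ∈ Icc 0 T, EqOn (auxVar u t) (D t 1) (Icc 0 (2 * π))) (i : ℕ) (hi : i ≤ k) :
    ∀ t ∈ Icc 0 T, ∀ j,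
      EqOn ((𝓜.corr k lam θ T u i).1 t j) ((𝓜.op k lam θ i (D t)).1 j) (𝓜.cell j) ∧
      EqOn ((𝓜.corr k lam θ T u i).2 t j) ((𝓜.op k lam θ i (D t)).2 j) (𝓜.cell j) := by
  induction i with
  | zero =>
    intro t ht j
    have e1 : (𝓜.corr k lam θ T u 0).1 t = (𝓜.op k lam θ 0 (D t)).1 := by
      simp only [corr, op, h0 t ht]
    have hq : ∀ j, EqOn (𝓜.restrict (auxVar u t) j) (𝓜.restrict (D t 1) j) (𝓜.cell j) :=
      fun j x hx => h1 t ht (𝓜.cell_subset j hx)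
    have e2 : 𝓜.projStar k lam θ (𝓜.restrict (u t)) (𝓜.restrict (auxVar u t))
        = 𝓜.projStar k lam θ (𝓜.restrict (D t 0)) (𝓜.restrict (D t 1)) := by
      rw [projStar, projStar, 𝓜.radau_congr hq]
      rw [h0 t ht]
      funext j
      rw [𝓜.avg_congr hq]
    refine ⟨fun x _ => by rw [e1], fun x hx => ?_⟩
    simp only [corr, op, e2, Pi.sub_apply, hq j hx]
  | succ i ih =>
    intro t ht j
    have ih := ih (by omega)
    have e1 : ∀ t ∈ Icc 0 T, 𝓜.stepU k θ ((𝓜.corr k lam θ T u i).2 t)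
        = 𝓜.stepU k θ (𝓜.op k lam θ i (D t)).2 := fun t ht =>
      𝓜.radau_congr (cellPrim_congr fun j => (ih t ht j).2) rfl
    -- Only w_{u,i} with i < k is differentiated in the recursion up to index k, so the time
    -- derivative exists whenever it is used.
    have hd : ∀ j, EqOn (𝓜.timeDeriv T (𝓜.corr k lam θ T u i).1 t j)
        ((𝓜.op k lam θ i (advDiff (D t))).1 j) (𝓜.cell j) := by
      intro j x hx
      have := (op_hasDerivWithinAt (𝓜 := 𝓜) (k := k) (lam := lam) hθ (by omega) hD ht hx
        (i := i)).congr (fun s hs => (ih s hs j).1 hx) ((ih t ht j).1 hx)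
      exact this.derivWithin (uniqueDiffOn_Icc hT t ht)
    have e2 : 𝓜.stepQ k lam θ (𝓜.toBroken (𝓜.stepU k θ ((𝓜.corr k lam θ T u i).2 t)))
          (𝓜.timeDeriv T (𝓜.corr k lam θ T u i).1 t)
        = 𝓜.stepQ k lam θ (𝓜.toBroken (𝓜.stepU k θ (𝓜.op k lam θ i (D t)).2))
          (𝓜.op k lam θ i (advDiff (D t))).1 := by
      rw [e1 t ht]
      refine 𝓜.radau_congr (fun j x hx => ?_) rfl
      simp only [Pi.add_apply, cellPrim_congr hd j hx]
    constructor
    · intro x _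
      change 𝓜.toBroken (𝓜.stepU k θ ((𝓜.corr k lam θ T u i).2 t)) j x = _
      rw [e1 t ht]
      rfl
    · intro x _
      change 𝓜.toBroken (𝓜.stepQ k lam θ (𝓜.toBroken (𝓜.stepU k θ ((𝓜.corr k lam θ T u i).2 t)))
          (𝓜.timeDeriv T (𝓜.corr k lam θ T u i).1 t)) j x = _
      rw [e2]
      rfl

end OperatorProperties

end Mesh

namespace Mesh

/-! ## Error equations -/

section ErrorEquations

variable {𝓜 : Mesh} {k : ℕ} {lam θ : ℝ}

/-- The pairing `∫_{I_j} f p` of a function and a polynomial. -/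
def cellInt (𝓜 : Mesh) (j : Fin 𝓜.N) (f : ℝ → ℝ) (p : ℝ[X]) : ℝ :=
  ∫ x in 𝓜.left j..𝓜.right j, f x * p.eval x

theorem cellInt_congr {j : Fin 𝓜.N} {f g : ℝ → ℝ} (h : EqOn f g (𝓜.cell j)) (p : ℝ[X]) :
    𝓜.cellInt j f p = 𝓜.cellInt j g p :=
  cell_integral_congr fun x hx => by simp only [h hx]

theorem intervalIntegrable_mul_eval {j : Fin 𝓜.N} {f : ℝ → ℝ} (hf : ContinuousOn f (𝓜.cell j))
    (p : ℝ[X]) : IntervalIntegrable (fun x => f x * p.eval x) volume (𝓜.left j) (𝓜.right j) :=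
  ContinuousOn.intervalIntegrable_of_Icc (𝓜.left_le_right j)
    (hf.mul p.continuous.continuousOn)

theorem cellInt_sub {j : Fin 𝓜.N} {f g : ℝ → ℝ} (hf : ContinuousOn f (𝓜.cell j))
    (hg : ContinuousOn g (𝓜.cell j)) (p : ℝ[X]) :
    𝓜.cellInt j (fun x => f x - g x) p = 𝓜.cellInt j f p - 𝓜.cellInt j g p := by
  simp only [cellInt, sub_mul]
  exact intervalIntegral.integral_sub (intervalIntegrable_mul_eval hf p)
    (intervalIntegrable_mul_eval hg p)

theorem cellInt_sum {ι : Type*} {s : Finset ι} {j : Fin 𝓜.N} {f : ι → ℝ → ℝ}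
    (hf : ∀ i ∈ s, ContinuousOn (f i) (𝓜.cell j)) (p : ℝ[X]) :
    𝓜.cellInt j (fun x => ∑ i ∈ s, f i x) p = ∑ i ∈ s, 𝓜.cellInt j (f i) p := by
  simp only [cellInt, Finset.sum_mul]
  exact intervalIntegral.integral_finsetSum fun i hi => intervalIntegrable_mul_eval (hf i hi) p

/-- The sum `∑_{i ≤ k} w_{u,i}`. -/
def etaU (𝓜 : Mesh) (k : ℕ) (lam θ : ℝ) (F : ℕ → ℝ → ℝ) : 𝓜.Broken :=
  fun j x => ∑ i ∈ Finset.range (k + 1), (𝓜.op k lam θ i F).1 j x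

/-- The sum `∑_{i ≤ k} w_{q,i}`. -/
def etaQ (𝓜 : Mesh) (k : ℕ) (lam θ : ℝ) (F : ℕ → ℝ → ℝ) : 𝓜.Broken :=
  fun j x => ∑ i ∈ Finset.range (k + 1), (𝓜.op k lam θ i F).2 j x

theorem cellCont_etaU {F : ℕ → ℝ → ℝ} {M : ℝ} (hF : IsJet 1 F M) :
    𝓜.CellCont (𝓜.etaU k lam θ F) := fun j =>
  continuousOn_finsetSum _ fun i _ => (cellCont_op i F M hF).1 j

theorem cellCont_etaQ {F : ℕ → ℝ → ℝ} {M : ℝ} (hF : IsJet 1 F M) :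
    𝓜.CellCont (𝓜.etaQ k lam θ F) := fun j =>
  continuousOn_finsetSum _ fun i _ => (cellCont_op i F M hF).2 j

theorem avg_etaU (hθ : θ ≠ 1 / 2) {F : ℕ → ℝ → ℝ} {M : ℝ} (hF : IsJet (1 + 2 * k) F M)
    (j : Fin 𝓜.N) : 𝓜.avg θ (𝓜.etaU k lam θ F) j = 0 := by
  have e : 𝓜.etaU k lam θ F = ∑ i ∈ Finset.range (k + 1), (𝓜.op k lam θ i F).1 := by
    funext j x
    simp [etaU]
  rw [e, avg_sum]
  refine Finset.sum_eq_zero fun i hi => (op_nodes hθ i F M (hF.mono ?_) j).1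
  have := Finset.mem_range.1 hi
  omega

theorem avg_etaQ (hθ : θ ≠ 1 / 2) {F : ℕ → ℝ → ℝ} {M : ℝ} (hF : IsJet (1 + 2 * k) F M)
    (j : Fin 𝓜.N) : 𝓜.avg (1 - θ) (𝓜.etaQ k lam θ F) j = 𝓜.avg lam (𝓜.etaU k lam θ F) j := by
  have e : 𝓜.etaU k lam θ F = ∑ i ∈ Finset.range (k + 1), (𝓜.op k lam θ i F).1 := by
    funext j x
    simp [etaU]
  have e' : 𝓜.etaQ k lam θ F = ∑ i ∈ Finset.range (k + 1), (𝓜.op k lam θ i F).2 := by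
    funext j x
    simp [etaQ]
  rw [e, e', avg_sum, avg_sum]
  refine Finset.sum_congr rfl fun i hi => (op_nodes hθ i F M (hF.mono ?_) j).2
  have := Finset.mem_range.1 hi
  omega

/-- The terms with i = 0 vanish by orthogonality. The others add up to all of ∂_t η_u except ∂_t
w_{u,k}. -/
theorem cellInt_etaU_sub_etaQ (hθ : θ ≠ 1 / 2) {F : ℕ → ℝ → ℝ} {M : ℝ}
    (hF : IsJet (1 + 2 * k) F M) (j : Fin 𝓜.N) {v : ℝ[X]} (hv : v ∈ degreeLT ℝ (k + 1)) :
    𝓜.cellInt j (𝓜.etaU k lam θ F j) (derivative v)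
      - 𝓜.cellInt j (𝓜.etaQ k lam θ F j) (derivative v)
      = ∑ i ∈ Finset.range k, 𝓜.cellInt j ((𝓜.op k lam θ i (advDiff F)).1 j) v := by
  have hc := fun i => cellCont_op (𝓜 := 𝓜) (k := k) (lam := lam) (θ := θ) i F M
    (hF.mono (by omega))
  have e1 : 𝓜.cellInt j (𝓜.etaU k lam θ F j) (derivative v)
      = ∑ i ∈ Finset.range (k + 1), 𝓜.cellInt j ((𝓜.op k lam θ i F).1 j) (derivative v) :=
    cellInt_sum (fun i _ => (hc i).1 j) _
  have e2 : 𝓜.cellInt j (𝓜.etaQ k lam θ F j) (derivative v)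
      = ∑ i ∈ Finset.range (k + 1), 𝓜.cellInt j ((𝓜.op k lam θ i F).2 j) (derivative v) :=
    cellInt_sum (fun i _ => (hc i).2 j) _
  rw [e1, e2, Finset.sum_range_succ', Finset.sum_range_succ']
  have h0 := op_zero_sub (𝓜 := 𝓜) (lam := lam) hθ (hF.mono (by omega : 1 ≤ _)) j hv
  rw [show 𝓜.cellInt j ((𝓜.op k lam θ 0 F).1 j) (derivative v) = 0 from h0.1,
    show 𝓜.cellInt j ((𝓜.op k lam θ 0 F).2 j) (derivative v) = 0 from h0.2, add_zero, add_zero,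
    ← Finset.sum_sub_distrib]
  refine Finset.sum_congr rfl fun i hi => ?_
  have hi := Finset.mem_range.1 hi
  rw [← cellInt_sub ((hc (i + 1)).1 j) ((hc (i + 1)).2 j)]
  exact op_succ_sub hθ hi (hF.mono (by omega)) j hv

/-- Each (w_{u,i+1}, v_x) cancels (w_{q,i}, v), so the telescoping sum leaves its last term alone.
-/
theorem cellInt_etaQ_add_etaU (hθ : θ ≠ 1 / 2) {F : ℕ → ℝ → ℝ} {M : ℝ}
    (hF : IsJet (1 + 2 * k) F M) (j : Fin 𝓜.N) {v : ℝ[X]} (hv : v ∈ degreeLT ℝ (k + 1)) :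
    𝓜.cellInt j (𝓜.etaQ k lam θ F j) v + 𝓜.cellInt j (𝓜.etaU k lam θ F j) (derivative v)
      = 𝓜.cellInt j ((𝓜.op k lam θ k F).2 j) v := by
  have hc := fun i => cellCont_op (𝓜 := 𝓜) (k := k) (lam := lam) (θ := θ) i F M
    (hF.mono (by omega))
  have e1 : 𝓜.cellInt j (𝓜.etaU k lam θ F j) (derivative v)
      = ∑ i ∈ Finset.range (k + 1), 𝓜.cellInt j ((𝓜.op k lam θ i F).1 j) (derivative v) :=
    cellInt_sum (fun i _ => (hc i).1 j) _
  have e2 : 𝓜.cellInt j (𝓜.etaQ k lam θ F j) v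
      = ∑ i ∈ Finset.range (k + 1), 𝓜.cellInt j ((𝓜.op k lam θ i F).2 j) v :=
    cellInt_sum (fun i _ => (hc i).2 j) _
  rw [e1, e2, Finset.sum_range_succ, Finset.sum_range_succ']
  have h0 := op_zero_sub (𝓜 := 𝓜) (lam := lam) hθ (hF.mono (by omega : 1 ≤ _)) j hv
  rw [show 𝓜.cellInt j ((𝓜.op k lam θ 0 F).1 j) (derivative v) = 0 from h0.1, add_zero]
  have h1 : ∀ i ∈ Finset.range k, 𝓜.cellInt j ((𝓜.op k lam θ (i + 1) F).1 j) (derivative v)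
      = -𝓜.cellInt j ((𝓜.op k lam θ i F).2 j) v := fun i hi => by
    have hi := Finset.mem_range.1 hi
    exact op_succ_fst hθ hi (hF.mono (by omega)) j hv
  rw [Finset.sum_congr rfl h1, Finset.sum_neg_distrib]
  ring

/-- Integration by parts on a cell. -/
theorem cellInt_deriv {j : Fin 𝓜.N} {f f' : ℝ → ℝ}
    (hf : ∀ x ∈ 𝓜.cell j, HasDerivWithinAt f (f' x) (𝓜.cell j) x)
    (hf' : ContinuousOn f' (𝓜.cell j)) (v : ℝ[X]) :
    𝓜.cellInt j f' v + 𝓜.cellInt j f (derivative v)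
      = f (𝓜.right j) * v.eval (𝓜.right j) - f (𝓜.left j) * v.eval (𝓜.left j) := by
  have hu : uIcc (𝓜.left j) (𝓜.right j) = 𝓜.cell j := uIcc_of_le (𝓜.left_le_right j)
  have := intervalIntegral.integral_mul_deriv_eq_deriv_mul_of_hasDerivWithinAt
    (a := 𝓜.left j) (b := 𝓜.right j) (u := f) (u' := f') (v := fun x => v.eval x)
    (v' := fun x => (derivative v).eval x) (by rwa [hu])
    (fun x _ => (v.hasDerivAt x).hasDerivWithinAt)
    (ContinuousOn.intervalIntegrable_of_Icc (𝓜.left_le_right j) hf')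
    (intervalIntegrable_eval _ _ _)
  simp only [cellInt]
  rw [this]
  ring

/-- The polynomial part `P_θ u - ∑ w_{u,i} - u_h` of the error of `u_h`. -/
def errU (𝓜 : Mesh) (k : ℕ) (lam θ : ℝ) (F : ℕ → ℝ → ℝ) (p : 𝓜.PiecePoly) : 𝓜.PiecePoly :=
  fun j => 𝓜.radau k θ (𝓜.restrict (F 0)) (𝓜.avg θ (𝓜.restrict (F 0))) j
    - ∑ i ∈ Finset.range k, 𝓜.stepU k θ (𝓜.op k lam θ i F).2 j - p j

/-- The polynomial part `P^*_{1-θ} q - ∑ w_{q,i} - q_h` of the error of `q_h`. -/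
def errQ (𝓜 : Mesh) (k : ℕ) (lam θ : ℝ) (F : ℕ → ℝ → ℝ) (p : 𝓜.PiecePoly) : 𝓜.PiecePoly :=
  fun j => 𝓜.radau k (1 - θ) (𝓜.restrict (F 1)) (fun j => 𝓜.avg (1 - θ) (𝓜.restrict (F 1)) j
        + (lam - θ) * 𝓜.jump (𝓜.restrict (F 0) - 𝓜.proj k θ (𝓜.restrict (F 0))) j) j
    - ∑ i ∈ Finset.range k, 𝓜.stepQ k lam θ (𝓜.toBroken (𝓜.stepU k θ (𝓜.op k lam θ i F).2))
        (𝓜.op k lam θ i (advDiff F)).1 j - p j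

theorem eval_errU (F : ℕ → ℝ → ℝ) (p : 𝓜.PiecePoly) (j : Fin 𝓜.N) (x : ℝ) :
    (𝓜.errU k lam θ F p j).eval x = F 0 x - 𝓜.etaU k lam θ F j x - (p j).eval x := by
  rw [etaU, Finset.sum_range_succ']
  simp only [errU, op, eval_sub, eval_finsetSum, Pi.sub_apply, restrict, toBroken, proj]
  ring

theorem eval_errQ (F : ℕ → ℝ → ℝ) (p : 𝓜.PiecePoly) (j : Fin 𝓜.N) (x : ℝ) :
    (𝓜.errQ k lam θ F p j).eval x = F 1 x - 𝓜.etaQ k lam θ F j x - (p j).eval x := by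
  rw [etaQ, Finset.sum_range_succ']
  simp only [errQ, op, eval_sub, eval_finsetSum, Pi.sub_apply, restrict, toBroken, projStar, proj]
  ring

theorem errU_mem (hθ : θ ≠ 1 / 2) {F : ℕ → ℝ → ℝ} {M : ℝ} (hF : IsJet 1 F M)
    {p : 𝓜.PiecePoly} (hp : 𝓜.InSpace k p) : 𝓜.InSpace k (𝓜.errU k lam θ F p) := fun j =>
  Submodule.sub_mem _ (Submodule.sub_mem _
    ((𝓜.radau_spec k hθ (hF.cellCont (by omega)) _).1 j)
    (Submodule.sum_mem _ fun i _ => (𝓜.radau_spec k hθ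
      (cellCont_op (k := k) (lam := lam) (θ := θ) i F M hF).2.cellPrim _).1 j)) (hp j)

theorem errQ_mem (hθ : θ ≠ 1 / 2) {F : ℕ → ℝ → ℝ} {M : ℝ} (hF : IsJet 3 F M)
    {p : 𝓜.PiecePoly} (hp : 𝓜.InSpace k p) : 𝓜.InSpace k (𝓜.errQ k lam θ F p) := fun j =>
  Submodule.sub_mem _ (Submodule.sub_mem _
    ((𝓜.radau_spec k (one_sub_ne_half hθ) (hF.cellCont (by omega)) _).1 j)
    (Submodule.sum_mem _ fun i _ => (𝓜.radau_spec k (one_sub_ne_half hθ)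
      ((𝓜.cellCont_toBroken _).add (cellCont_op (k := k) (lam := lam) (θ := θ) i _ _
        (hF.mono (by omega : 1 + 2 ≤ 3)).advDiff).1.cellPrim) _).1 j)) (hp j)

theorem avg_errU (F : ℕ → ℝ → ℝ) (p : 𝓜.PiecePoly) (α : ℝ) (j : Fin 𝓜.N) :
    𝓜.avg α (𝓜.toBroken (𝓜.errU k lam θ F p)) j = 𝓜.avg α (𝓜.restrict (F 0)) j
      - 𝓜.avg α (𝓜.etaU k lam θ F) j - 𝓜.avg α (𝓜.toBroken p) j := by
  rw [← avg_sub, ← avg_sub]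
  congr 1
  funext j x
  exact eval_errU F p j x

theorem avg_errQ (F : ℕ → ℝ → ℝ) (p : 𝓜.PiecePoly) (α : ℝ) (j : Fin 𝓜.N) :
    𝓜.avg α (𝓜.toBroken (𝓜.errQ k lam θ F p)) j = 𝓜.avg α (𝓜.restrict (F 1)) j
      - 𝓜.avg α (𝓜.etaQ k lam θ F) j - 𝓜.avg α (𝓜.toBroken p) j := by
  rw [← avg_sub, ← avg_sub]
  congr 1
  funext j x
  exact eval_errQ F p j x

theorem cellInt_errU {F : ℕ → ℝ → ℝ} {M : ℝ} (hF : IsJet 1 F M) (p : 𝓜.PiecePoly)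
    (j : Fin 𝓜.N) (v : ℝ[X]) : 𝓜.cellInt j (fun x => (𝓜.errU k lam θ F p j).eval x) v
      = 𝓜.cellInt j (F 0) v - 𝓜.cellInt j (𝓜.etaU k lam θ F j) v
        - 𝓜.cellInt j (fun x => (p j).eval x) v := by
  have h0 : ContinuousOn (F 0) (𝓜.cell j) := hF.cellCont (by omega) j
  have h1 := cellCont_etaU (k := k) (lam := lam) (θ := θ) hF j
  rw [← cellInt_sub h0 h1, ← cellInt_sub (h0.fun_sub h1) (p j).continuous.continuousOn]
  exact cellInt_congr (fun x _ => eval_errU F p j x) v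

theorem cellInt_errQ {F : ℕ → ℝ → ℝ} {M : ℝ} (hF : IsJet 1 F M) (p : 𝓜.PiecePoly)
    (j : Fin 𝓜.N) (v : ℝ[X]) : 𝓜.cellInt j (fun x => (𝓜.errQ k lam θ F p j).eval x) v
      = 𝓜.cellInt j (F 1) v - 𝓜.cellInt j (𝓜.etaQ k lam θ F j) v
        - 𝓜.cellInt j (fun x => (p j).eval x) v := by
  have h0 : ContinuousOn (F 1) (𝓜.cell j) := hF.cellCont (by omega) j
  have h1 := cellCont_etaQ (k := k) (lam := lam) (θ := θ) hF j
  rw [← cellInt_sub h0 h1, ← cellInt_sub (h0.fun_sub h1) (p j).continuous.continuousOn]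
  exact cellInt_congr (fun x _ => eval_errQ F p j x) v

theorem eval_left_eq {f : ℝ → ℝ} (hf : f 0 = f (2 * π)) (α : ℝ) (j : Fin 𝓜.N) :
    f (𝓜.left j) = 𝓜.avg α (𝓜.restrict f) (𝓜.prev j) := by
  rw [𝓜.avg_restrict hf, ← 𝓜.eval_left_next hf, 𝓜.next_prev]

/-- The error equation of the second equation of the scheme. -/
theorem error_equation_q (hθ : θ ≠ 1 / 2) {F : ℕ → ℝ → ℝ} {M : ℝ} (hF : IsJet (1 + 2 * k) F M)
    (hper : F 0 0 = F 0 (2 * π)) {p q : 𝓜.PiecePoly}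
    {j : Fin 𝓜.N} {v : ℝ[X]} (hv : v ∈ degreeLT ℝ (k + 1))
    (h : 𝓜.cellInt j (fun x => (q j).eval x) v + 𝓜.cellInt j (fun x => (p j).eval x) (derivative v)
      - 𝓜.avg θ (𝓜.toBroken p) j * v.eval (𝓜.right j)
      + 𝓜.avg θ (𝓜.toBroken p) (𝓜.prev j) * v.eval (𝓜.left j) = 0) :
    𝓜.cellInt j (fun x => (𝓜.errQ k lam θ F q j).eval x) v
      + 𝓜.cellInt j (fun x => (𝓜.errU k lam θ F p j).eval x) (derivative v)
      - 𝓜.avg θ (𝓜.toBroken (𝓜.errU k lam θ F p)) j * v.eval (𝓜.right j)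
      + 𝓜.avg θ (𝓜.toBroken (𝓜.errU k lam θ F p)) (𝓜.prev j) * v.eval (𝓜.left j)
      = -𝓜.cellInt j ((𝓜.op k lam θ k F).2 j) v := by
  have hF1 := hF.mono (by omega : 1 ≤ _)
  rw [cellInt_errQ hF1, cellInt_errU hF1, avg_errU, avg_errU, avg_etaU hθ hF, avg_etaU hθ hF,
    ← cellInt_etaQ_add_etaU hθ hF j hv, ← eval_left_eq hper, avg_restrict _ hper]
  have h2 := cellInt_deriv (j := j) (fun x hx => (hF1.deriv 0 (by omega) x
    (𝓜.cell_subset j hx)).mono (𝓜.cell_subset j)) (hF1.cellCont (𝓜 := 𝓜) le_rfl j) v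
  linear_combination h2 - h

/-- The error equation of the first equation of the scheme. -/
theorem error_equation_u (hθ : θ ≠ 1 / 2) {F : ℕ → ℝ → ℝ} {M : ℝ} (hF : IsJet (2 + 2 * k) F M)
    (hper0 : F 0 0 = F 0 (2 * π)) (hper1 : F 1 0 = F 1 (2 * π)) {p q : 𝓜.PiecePoly} {d : ℝ → ℝ}
    {j : Fin 𝓜.N} (hd : ContinuousOn d (𝓜.cell j)) {v : ℝ[X]} (hv : v ∈ degreeLT ℝ (k + 1))
    (h : 𝓜.cellInt j d v
      - (𝓜.cellInt j (fun x => (p j).eval x) (derivative v)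
        - 𝓜.cellInt j (fun x => (q j).eval x) (derivative v))
      + (𝓜.avg lam (𝓜.toBroken p) j - 𝓜.avg (1 - θ) (𝓜.toBroken q) j) * v.eval (𝓜.right j)
      - (𝓜.avg lam (𝓜.toBroken p) (𝓜.prev j) - 𝓜.avg (1 - θ) (𝓜.toBroken q) (𝓜.prev j))
        * v.eval (𝓜.left j) = 0) :
    𝓜.cellInt j (fun x => advDiff F 0 x
        - ∑ i ∈ Finset.range k, (𝓜.op k lam θ i (advDiff F)).1 j x - d x) v
      - (𝓜.cellInt j (fun x => (𝓜.errU k lam θ F p j).eval x) (derivative v)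
        - 𝓜.cellInt j (fun x => (𝓜.errQ k lam θ F q j).eval x) (derivative v))
      + (𝓜.avg lam (𝓜.toBroken (𝓜.errU k lam θ F p)) j
          - 𝓜.avg (1 - θ) (𝓜.toBroken (𝓜.errQ k lam θ F q)) j) * v.eval (𝓜.right j)
      - (𝓜.avg lam (𝓜.toBroken (𝓜.errU k lam θ F p)) (𝓜.prev j)
          - 𝓜.avg (1 - θ) (𝓜.toBroken (𝓜.errQ k lam θ F q)) (𝓜.prev j))
        * v.eval (𝓜.left j) = 0 := by
  have hF2 := hF.mono (by omega : 2 ≤ _)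
  have hF1 := hF.mono (by omega : 1 ≤ _)
  have hFk := hF.mono (by omega : 1 + 2 * k ≤ _)
  have hFA : ∀ i ∈ Finset.range k, ContinuousOn ((𝓜.op k lam θ i (advDiff F)).1 j) (𝓜.cell j) := by
    intro i hi
    have := Finset.mem_range.1 hi
    exact (cellCont_op i _ _ (hF.mono (by omega : 1 + 2 ≤ _)).advDiff).1 j
  have hsum : ContinuousOn (fun x => ∑ i ∈ Finset.range k, (𝓜.op k lam θ i (advDiff F)).1 j x)
      (𝓜.cell j) := continuousOn_finsetSum _ hFA
  have c0 : ContinuousOn (F 0) (𝓜.cell j) := hF2.cellCont (by omega) j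
  have c1 : ContinuousOn (F 1) (𝓜.cell j) := hF2.cellCont (by omega) j
  have c2 : ContinuousOn (F 2) (𝓜.cell j) := hF2.cellCont (by omega) j
  have cA : ContinuousOn (advDiff F 0) (𝓜.cell j) := c2.sub c1
  rw [cellInt_sub (cA.fun_sub hsum) hd, cellInt_sub cA hsum, cellInt_sum hFA,
    ← cellInt_etaU_sub_etaQ hθ hFk j hv, cellInt_errQ hF1, cellInt_errU hF1, avg_errU, avg_errU,
    avg_errQ, avg_errQ, avg_etaQ hθ hFk, avg_etaQ hθ hFk, ← eval_left_eq hper0,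
    avg_restrict _ hper0, ← eval_left_eq hper1, avg_restrict _ hper1,
    show 𝓜.cellInt j (advDiff F 0) v = 𝓜.cellInt j (F 2) v - 𝓜.cellInt j (F 1) v from
      cellInt_sub c2 c1 v]
  have h2 := cellInt_deriv (j := j) (fun x hx => (hF2.deriv 0 (by omega) x
    (𝓜.cell_subset j hx)).mono (𝓜.cell_subset j)) c1 v
  have h3 := cellInt_deriv (j := j) (fun x hx => (hF2.deriv 1 (by omega) x
    (𝓜.cell_subset j hx)).mono (𝓜.cell_subset j)) c2 v
  simp only [zero_add, Nat.reduceAdd] at h2 h3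
  linear_combination h3 - h2 - h

/-! ## The energy inequality -/

/-- The integral of a piecewise function. -/
def total (𝓜 : Mesh) (f : 𝓜.Broken) : ℝ := ∑ j, ∫ x in 𝓜.left j..𝓜.right j, f j x

/-- With v = p and ψ = q all interior terms are total derivatives. At a node the products of p and q
cancel because the weights θ and 1 - θ are complementary, and the quadratic terms in p combine to
-(λ - 1/2)[p]². -/
theorem energy_inequality (hlam : 1 / 2 ≤ lam) {p q : 𝓜.PiecePoly} {ρ W : 𝓜.Broken}
    (hp : 𝓜.InSpace k p) (hq : 𝓜.InSpace k q)
    (hu : ∀ j, ∀ v ∈ degreeLT ℝ (k + 1), 𝓜.cellInt j (ρ j) v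
      - (𝓜.cellInt j (fun x => (p j).eval x) (derivative v)
        - 𝓜.cellInt j (fun x => (q j).eval x) (derivative v))
      + (𝓜.avg lam (𝓜.toBroken p) j - 𝓜.avg (1 - θ) (𝓜.toBroken q) j) * v.eval (𝓜.right j)
      - (𝓜.avg lam (𝓜.toBroken p) (𝓜.prev j) - 𝓜.avg (1 - θ) (𝓜.toBroken q) (𝓜.prev j))
        * v.eval (𝓜.left j) = 0)
    (hq' : ∀ j, ∀ v ∈ degreeLT ℝ (k + 1), 𝓜.cellInt j (fun x => (q j).eval x) v
      + 𝓜.cellInt j (fun x => (p j).eval x) (derivative v)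
      - 𝓜.avg θ (𝓜.toBroken p) j * v.eval (𝓜.right j)
      + 𝓜.avg θ (𝓜.toBroken p) (𝓜.prev j) * v.eval (𝓜.left j) = -𝓜.cellInt j (W j) v) :
    ∑ j, 𝓜.cellInt j (ρ j) (p j) + ∑ j, 𝓜.cellInt j (fun x => (q j).eval x) (q j)
      ≤ -∑ j, 𝓜.cellInt j (W j) (q j) := by
  have hpp : ∀ j, 2 * 𝓜.cellInt j (fun x => (p j).eval x) (derivative (p j))
      = (p j).eval (𝓜.right j) ^ 2 - (p j).eval (𝓜.left j) ^ 2 := by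
    intro j
    have h := cellInt_deriv (j := j) (f := fun x => (p j).eval x)
      (f' := fun x => (derivative (p j)).eval x)
      (fun x _ => ((p j).hasDerivAt x).hasDerivWithinAt)
      (derivative (p j)).continuous.continuousOn (p j)
    have e : 𝓜.cellInt j (fun x => (derivative (p j)).eval x) (p j)
        = 𝓜.cellInt j (fun x => (p j).eval x) (derivative (p j)) := by
      simp only [cellInt, mul_comm]
    rw [e] at h
    linear_combination h
  have hpq : ∀ j, 𝓜.cellInt j (fun x => (q j).eval x) (derivative (p j))
      + 𝓜.cellInt j (fun x => (p j).eval x) (derivative (q j))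
      = (p j).eval (𝓜.right j) * (q j).eval (𝓜.right j)
        - (p j).eval (𝓜.left j) * (q j).eval (𝓜.left j) := by
    intro j
    have h := cellInt_deriv (j := j) (f := fun x => (p j).eval x)
      (f' := fun x => (derivative (p j)).eval x)
      (fun x _ => ((p j).hasDerivAt x).hasDerivWithinAt)
      (derivative (p j)).continuous.continuousOn (q j)
    have e : 𝓜.cellInt j (fun x => (derivative (p j)).eval x) (q j)
        = 𝓜.cellInt j (fun x => (q j).eval x) (derivative (p j)) := by
      simp only [cellInt, mul_comm]
    rw [e] at h
    exact h
  set Φ : Fin 𝓜.N → ℝ := fun j => 𝓜.avg lam (𝓜.toBroken p) j - 𝓜.avg (1 - θ) (𝓜.toBroken q) j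
    with hΦ
  set Γ : Fin 𝓜.N → ℝ := fun j => 𝓜.avg θ (𝓜.toBroken p) j with hΓ
  have hcell : ∀ j, 𝓜.cellInt j (ρ j) (p j) + 𝓜.cellInt j (fun x => (q j).eval x) (q j)
      + 𝓜.cellInt j (W j) (q j)
      = ((p j).eval (𝓜.right j) ^ 2 / 2 - (p j).eval (𝓜.right j) * (q j).eval (𝓜.right j)
          - Φ j * (p j).eval (𝓜.right j) + Γ j * (q j).eval (𝓜.right j))
        - ((p j).eval (𝓜.left j) ^ 2 / 2 - (p j).eval (𝓜.left j) * (q j).eval (𝓜.left j)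
          - Φ (𝓜.prev j) * (p j).eval (𝓜.left j) + Γ (𝓜.prev j) * (q j).eval (𝓜.left j)) := by
    intro j
    have h1 := hu j (p j) (hp j)
    have h2 := hq' j (q j) (hq j)
    simp only [hΦ, hΓ]
    linear_combination h1 + h2 + hpp j / 2 - hpq j
  have hsum := Finset.sum_congr (rfl : (Finset.univ : Finset (Fin 𝓜.N)) = Finset.univ)
    fun j _ => hcell j
  -- The left-end terms are shifted cyclically by one cell, so that both traces at a node stand in
  -- the same summand.
  rw [Finset.sum_add_distrib, Finset.sum_add_distrib, Finset.sum_sub_distrib,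
    ← 𝓜.sum_next (fun j => (p j).eval (𝓜.left j) ^ 2 / 2
      - (p j).eval (𝓜.left j) * (q j).eval (𝓜.left j)
      - Φ (𝓜.prev j) * (p j).eval (𝓜.left j) + Γ (𝓜.prev j) * (q j).eval (𝓜.left j)),
    ← Finset.sum_sub_distrib] at hsum
  have hneg : ∑ j, (((p j).eval (𝓜.right j) ^ 2 / 2 - (p j).eval (𝓜.right j)
          * (q j).eval (𝓜.right j)
          - Φ j * (p j).eval (𝓜.right j) + Γ j * (q j).eval (𝓜.right j))
        - ((p (𝓜.next j)).eval (𝓜.left (𝓜.next j)) ^ 2 / 2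
          - (p (𝓜.next j)).eval (𝓜.left (𝓜.next j)) * (q (𝓜.next j)).eval (𝓜.left (𝓜.next j))
          - Φ (𝓜.prev (𝓜.next j)) * (p (𝓜.next j)).eval (𝓜.left (𝓜.next j))
          + Γ (𝓜.prev (𝓜.next j)) * (q (𝓜.next j)).eval (𝓜.left (𝓜.next j)))) ≤ 0 := by
    refine Finset.sum_nonpos fun j _ => ?_
    rw [𝓜.prev_next]
    simp only [hΦ, hΓ, avg, toBroken]
    set a := (p j).eval (𝓜.right j)
    set b := (p (𝓜.next j)).eval (𝓜.left (𝓜.next j))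
    set c := (q j).eval (𝓜.right j)
    set d := (q (𝓜.next j)).eval (𝓜.left (𝓜.next j))
    have : 0 ≤ (lam - 1 / 2) * (a - b) ^ 2 :=
      mul_nonneg (by linarith) (sq_nonneg _)
    nlinarith
  linarith

end ErrorEquations

end Mesh

namespace Mesh

/-! ## Evolution of the energy -/

section Energy

variable {𝓜 : Mesh}

theorem total_mono {f g : 𝓜.Broken} (hf : 𝓜.CellCont f) (hg : 𝓜.CellCont g)
    (h : ∀ j, ∀ x ∈ 𝓜.cell j, f j x ≤ g j x) : 𝓜.total f ≤ 𝓜.total g :=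
  Finset.sum_le_sum fun j _ => intervalIntegral.integral_mono_on (𝓜.left_le_right j)
    (hf.intervalIntegrable j) (hg.intervalIntegrable j) (h j)

theorem total_nonneg {f : 𝓜.Broken} (h : ∀ j, ∀ x ∈ 𝓜.cell j, 0 ≤ f j x) : 0 ≤ 𝓜.total f :=
  Finset.sum_nonneg fun j _ => intervalIntegral.integral_nonneg (𝓜.left_le_right j) (h j)

theorem total_const (c : ℝ) : 𝓜.total (fun _ _ => c) = 2 * π * c := by
  simp only [total, intervalIntegral.integral_const, smul_eq_mul]
  rw [← Finset.sum_mul]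
  congr 1
  exact 𝓜.sum_size

theorem total_add {f g : 𝓜.Broken} (hf : 𝓜.CellCont f) (hg : 𝓜.CellCont g) :
    𝓜.total (fun j x => f j x + g j x) = 𝓜.total f + 𝓜.total g := by
  simp only [total]
  rw [← Finset.sum_add_distrib]
  exact Finset.sum_congr rfl fun j _ =>
    intervalIntegral.integral_add (hf.intervalIntegrable j) (hg.intervalIntegrable j)

theorem total_const_mul (c : ℝ) (f : 𝓜.Broken) :
    𝓜.total (fun j x => c * f j x) = c * 𝓜.total f := by
  simp only [total, intervalIntegral.integral_const_mul, Finset.mul_sum]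

theorem total_sub {f g : 𝓜.Broken} (hf : 𝓜.CellCont f) (hg : 𝓜.CellCont g) :
    𝓜.total (fun j x => f j x - g j x) = 𝓜.total f - 𝓜.total g := by
  simp only [total]
  rw [← Finset.sum_sub_distrib]
  exact Finset.sum_congr rfl fun j _ =>
    intervalIntegral.integral_sub (hf.intervalIntegrable j) (hg.intervalIntegrable j)

theorem abs_total_le {f g : 𝓜.Broken} (hf : 𝓜.CellCont f) (hg : 𝓜.CellCont g)
    (h : ∀ j, ∀ x ∈ 𝓜.cell j, |f j x| ≤ g j x) : |𝓜.total f| ≤ 𝓜.total g := by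
  rw [abs_le]
  constructor
  · have h1 := total_mono (𝓜 := 𝓜) (f := fun j x => -1 * g j x)
      (fun j => continuousOn_const.mul (hg j)) hf
      fun j x hx => by linarith [neg_abs_le (f j x), h j x hx]
    rw [total_const_mul] at h1
    linarith
  · exact total_mono hf hg fun j x hx => (le_abs_self _).trans (h j x hx)

theorem CellCont.exists_bound {f : 𝓜.Broken} (hf : 𝓜.CellCont f) :
    ∃ K, 0 ≤ K ∧ ∀ j, ∀ x ∈ 𝓜.cell j, |f j x| ≤ K := by
  have h := fun j => (isCompact_Icc (a := 𝓜.left j) (b := 𝓜.right j)).exists_bound_of_continuousOn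
    (hf j)
  choose C hC using h
  refine ⟨∑ j, |C j|, Finset.sum_nonneg fun j _ => abs_nonneg _, fun j x hx => ?_⟩
  exact ((hC j x hx).trans (le_abs_self _)).trans
    (Finset.single_le_sum (f := fun j => |C j|) (fun i _ => abs_nonneg _) (Finset.mem_univ j))

/-- An energy estimate for `ξ`, where only `ξ + w` is differentiable in time, with derivative `ρ`,
and `w` is Lipschitz continuous in time. -/
theorem energy_estimate {T L : ℝ} (hL : 0 < L) {ξ w ρ : ℝ → 𝓜.Broken} {Q : ℝ → ℝ}
    (hξ : ∀ t ∈ Icc 0 T, 𝓜.CellCont (ξ t)) (hρ : ∀ t ∈ Icc 0 T, 𝓜.CellCont (ρ t))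
    (hd : ∀ t ∈ Icc 0 T, ∀ ε > 0, ∃ δ > 0, ∀ s ∈ Icc 0 T, |s - t| < δ → ∀ j, ∀ x ∈ 𝓜.cell j,
      |ξ s j x + w s j x - (ξ t j x + w t j x) - (s - t) * ρ t j x| ≤ ε * |s - t|)
    (hw : ∀ s ∈ Icc 0 T, ∀ t ∈ Icc 0 T, ∀ j, ∀ x ∈ 𝓜.cell j,
      |w s j x - w t j x| ≤ L * |s - t|)
    (hQ : Continuous Q) (hQ0 : ∀ t, 0 ≤ Q t)
    (hE : ∀ t ∈ Icc 0 T, 2 * 𝓜.total (fun j x => ρ t j x * ξ t j x) + Q t ≤ 2 * π * L ^ 2)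
    (h0 : 𝓜.total (fun j x => ξ 0 j x ^ 2) = 0) :
    ∀ t ∈ Icc 0 T, 𝓜.total (fun j x => ξ t j x ^ 2) + ∫ τ in (0 : ℝ)..t, Q τ
      ≤ 16 * L ^ 2 * (1 + t) ^ 2 := by
  set E : ℝ → ℝ := fun t => 𝓜.total (fun j x => ξ t j x ^ 2) with hEdef
  have cξ2 : ∀ t ∈ Icc 0 T, 𝓜.CellCont fun j x => ξ t j x ^ 2 := fun t ht j => (hξ t ht j).pow 2
  have cabs : ∀ t ∈ Icc 0 T, 𝓜.CellCont fun j x => |ξ t j x| := fun t ht j => (hξ t ht j).abs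
  have cρξ : ∀ t ∈ Icc 0 T, 𝓜.CellCont fun j x => ρ t j x * ξ t j x :=
    fun t ht j => (hρ t ht j).mul (hξ t ht j)
  set X : ℝ → ℝ := fun t => 𝓜.total (fun j x => |ξ t j x|) with hX
  have hX0 : ∀ t, 0 ≤ X t := fun t => total_nonneg fun j x _ => abs_nonneg _
  -- With d = ξ(s) - ξ(t), the increment of ξ² is 2ξ(t)d + d². Here d differs from (s - t)ρ by at
  -- most (ε + L)|s - t|, where ε comes from the differentiability of ξ + w and L from the Lipschitz
  -- constant of w.
  have key : ∀ t ∈ Icc 0 T, ∀ ε > 0, ∃ K, ∃ δ > 0, ∀ s ∈ Icc 0 T, |s - t| < δ →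
      |E s - E t - 2 * (s - t) * 𝓜.total (fun j x => ρ t j x * ξ t j x)|
        ≤ |s - t| * (2 * (ε + L) * X t + |s - t| * (2 * π * K ^ 2)) := by
    intro t ht ε hε
    obtain ⟨K, hK0, hK⟩ := (hρ t ht).exists_bound
    obtain ⟨δ, hδ, hδ'⟩ := hd t ht ε hε
    refine ⟨K + (ε + L), δ, hδ, fun s hs hst => ?_⟩
    have e : E s - E t - 2 * (s - t) * 𝓜.total (fun j x => ρ t j x * ξ t j x)
        = 𝓜.total fun j x => ξ s j x ^ 2 - ξ t j x ^ 2 - 2 * (s - t) * (ρ t j x * ξ t j x) := by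
      rw [total_sub (f := fun j x => ξ s j x ^ 2 - ξ t j x ^ 2)
        (g := fun j x => 2 * (s - t) * (ρ t j x * ξ t j x))
        (fun j => (cξ2 s hs j).sub (cξ2 t ht j)) (fun j => continuousOn_const.mul (cρξ t ht j)),
        total_sub (cξ2 s hs) (cξ2 t ht), total_const_mul]
    have e2 : |s - t| * (2 * (ε + L) * X t + |s - t| * (2 * π * (K + (ε + L)) ^ 2))
        = 𝓜.total fun j x => 2 * (ε + L) * |s - t| * |ξ t j x|
          + (|s - t| * (K + (ε + L))) ^ 2 := by
      rw [total_add (f := fun j x => 2 * (ε + L) * |s - t| * |ξ t j x|)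
        (fun j => continuousOn_const.mul (cabs t ht j)) (fun j => continuousOn_const),
        total_const_mul, total_const]
      ring
    rw [e, e2]
    refine abs_total_le (fun j => ((cξ2 s hs j).sub (cξ2 t ht j)).sub
      (continuousOn_const.mul (cρξ t ht j)))
      (fun j => (continuousOn_const.mul (cabs t ht j)).add continuousOn_const) fun j x hx => ?_
    have h1 := hδ' s hs hst j x hx
    have h2 := hw s hs t ht j x hx
    have h3 := hK j x hx
    set d := ξ s j x - ξ t j x with hdd
    have h4 : |d - (s - t) * ρ t j x| ≤ (ε + L) * |s - t| := by
      have e3 : d - (s - t) * ρ t j x = ξ s j x + w s j x - (ξ t j x + w t j x)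
          - (s - t) * ρ t j x - (w s j x - w t j x) := by
        rw [hdd]
        ring
      rw [e3]
      refine (abs_sub _ _).trans ?_
      linarith
    have h5 : |d| ≤ |s - t| * (K + (ε + L)) := by
      have e4 : d = (d - (s - t) * ρ t j x) + (s - t) * ρ t j x := by ring
      rw [e4]
      refine (abs_add_le _ _).trans ?_
      rw [abs_mul]
      nlinarith [abs_nonneg (s - t)]
    have e5 : ξ s j x ^ 2 - ξ t j x ^ 2 - 2 * (s - t) * (ρ t j x * ξ t j x)
        = 2 * ξ t j x * (d - (s - t) * ρ t j x) + d ^ 2 := by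
      rw [hdd]
      ring
    rw [e5]
    refine (abs_add_le _ _).trans (add_le_add ?_ ?_)
    · rw [abs_mul, abs_mul, abs_two]
      nlinarith [abs_nonneg (ξ t j x), mul_le_mul_of_nonneg_left h4 (abs_nonneg (ξ t j x))]
    · rw [abs_of_nonneg (sq_nonneg d), ← sq_abs d]
      exact pow_le_pow_left₀ (abs_nonneg d) h5 2
  have hEc : ContinuousOn E (Icc 0 T) := by
    intro t ht
    obtain ⟨K, δ, hδ, hK⟩ := key t ht 1 one_pos
    set R := 𝓜.total (fun j x => ρ t j x * ξ t j x) with hR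
    have h1 : Filter.Tendsto (fun s => |s - t| * (2 * (1 + L) * X t + |s - t| * (2 * π * K ^ 2))
        + 2 * |s - t| * |R|) (nhdsWithin t (Icc 0 T)) (nhds 0) := by
      have : Continuous fun s => |s - t| * (2 * (1 + L) * X t + |s - t| * (2 * π * K ^ 2))
          + 2 * |s - t| * |R| := by fun_prop
      have h2 := this.tendsto t
      simp only [sub_self, abs_zero, zero_mul, mul_zero, add_zero] at h2
      exact h2.mono_left nhdsWithin_le_nhds
    rw [ContinuousWithinAt, tendsto_iff_dist_tendsto_zero]
    refine squeeze_zero' (Filter.Eventually.of_forall fun s => dist_nonneg) ?_ h1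
    filter_upwards [self_mem_nhdsWithin, mem_nhdsWithin_of_mem_nhds (Metric.ball_mem_nhds t hδ)]
      with s hs hst
    have h3 := hK s hs hst
    rw [Real.dist_eq]
    have e : E s - E t = (E s - E t - 2 * (s - t) * R) + 2 * (s - t) * R := by ring
    rw [e]
    refine (abs_add_le _ _).trans (add_le_add h3 (le_of_eq ?_))
    rw [abs_mul, abs_mul, abs_two]
  have hG : ∀ t, HasDerivAt (fun t => ∫ τ in (0 : ℝ)..t, Q τ) (Q t) t := fun t =>
    (hQ.integral_hasStrictDerivAt 0 t).hasDerivAt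
  -- E need not be differentiable, so its right difference quotients are compared with the barrier
  -- 16L²(1+t)². At a contact point E/(1+t) ≤ 16L²(1+t), and the strict inequality needed reduces to
  -- 4π < 16.
  refine image_le_of_liminf_slope_right_lt_deriv_boundary'
    (f := fun t => E t + ∫ τ in (0 : ℝ)..t, Q τ)
    (f' := fun t => 2 * π * L ^ 2 + 2 * π * L ^ 2 * (1 + t) + E t / (1 + t))
    (B := fun t => 16 * L ^ 2 * (1 + t) ^ 2) (B' := fun t => 32 * L ^ 2 * (1 + t))
    (hEc.add fun t _ => (hG t).continuousAt.continuousWithinAt) ?_ ?_ (by fun_prop) ?_ ?_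
  · intro t ht r hr
    have ht' : t ∈ Icc 0 T := ⟨ht.1, ht.2.le⟩
    have ht1 : 0 < 1 + t := by linarith [ht.1]
    set R := 𝓜.total (fun j x => ρ t j x * ξ t j x) with hR
    -- Young's inequality with the time dependent weight 1 + t; a fixed weight would give
    -- exponential instead of linear growth of the error.
    have hLX : 2 * L * X t ≤ 2 * π * L ^ 2 * (1 + t) + E t / (1 + t) := by
      have h1 : 2 * L * X t = 𝓜.total fun j x => 2 * L * |ξ t j x| := by rw [total_const_mul]
      have h2 : 2 * π * L ^ 2 * (1 + t) + E t / (1 + t)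
          = 𝓜.total fun j x => L ^ 2 * (1 + t) + (1 + t)⁻¹ * ξ t j x ^ 2 := by
        rw [total_add (f := fun _ _ => L ^ 2 * (1 + t))
          (g := fun j x => (1 + t)⁻¹ * ξ t j x ^ 2) (fun j => continuousOn_const)
          (fun j => continuousOn_const.mul (cξ2 t ht' j)), total_const, total_const_mul]
        ring
      rw [h1, h2]
      refine total_mono (fun j => continuousOn_const.mul (cabs t ht' j))
        (fun j => continuousOn_const.add (continuousOn_const.mul (cξ2 t ht' j))) fun j x _ => ?_
      rw [← sq_abs (ξ t j x), ← sub_nonneg]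
      have : L ^ 2 * (1 + t) + (1 + t)⁻¹ * |ξ t j x| ^ 2 - 2 * L * |ξ t j x|
          = (1 + t)⁻¹ * (L * (1 + t) - |ξ t j x|) ^ 2 := by
        field_simp
        ring
      rw [this]
      positivity
    have hgap : 0 < r - (2 * R + Q t + 2 * L * X t) := by
      have := hE t ht'
      linarith
    set gap := r - (2 * R + Q t + 2 * L * X t) with hgd
    set ε := gap / (8 * (X t + 1)) with hε
    have hXt := hX0 t
    have hε0 : 0 < ε := by positivity
    have hεX : 2 * ε * X t ≤ gap / 4 := by
      have : ε * (8 * (X t + 1)) = gap := by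
        rw [hε]
        field_simp
      nlinarith
    obtain ⟨K, δ, hδ, hK⟩ := key t ht' ε hε0
    have hslope : ∀ᶠ z in nhdsWithin t (Ioi t),
        slope (fun t => ∫ τ in (0 : ℝ)..t, Q τ) t z < Q t + gap / 4 := by
      have h1 := (hasDerivAt_iff_tendsto_slope.1 (hG t)).mono_left
        (nhdsWithin_mono t fun z (hz : t < z) => (ne_of_gt hz : z ∈ ({t}ᶜ : Set ℝ)))
      exact h1.eventually_lt_const (by linarith)
    have hη : ∀ᶠ z in nhdsWithin t (Ioi t), (z - t) * (2 * π * K ^ 2) < gap / 4 := by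
      have : Continuous fun z => (z - t) * (2 * π * K ^ 2) := by fun_prop
      have h1 := (this.tendsto t).mono_left (nhdsWithin_le_nhds (s := Ioi t))
      simp only [sub_self, zero_mul] at h1
      exact h1.eventually_lt_const (by linarith)
    refine Filter.Eventually.frequently ?_
    filter_upwards [hslope, hη, self_mem_nhdsWithin, Ioo_mem_nhdsGT ht.2,
      mem_nhdsWithin_of_mem_nhds (Metric.ball_mem_nhds t hδ)] with z hz1 hz2 hz3 hz4 hz5
    have hzt : 0 < z - t := sub_pos.2 hz3
    have h1 := hK z ⟨ht.1.trans hz4.1.le, hz4.2.le⟩ hz5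
    rw [abs_of_pos hzt] at h1
    have h2 := (abs_le.1 h1).2
    have h3 : (E z - E t) / (z - t) ≤ 2 * R + 2 * (ε + L) * X t + (z - t) * (2 * π * K ^ 2) := by
      rw [div_le_iff₀ hzt]
      linarith
    have h4 : slope (fun t => E t + ∫ τ in (0 : ℝ)..t, Q τ) t z
        = (E z - E t) / (z - t) + slope (fun t => ∫ τ in (0 : ℝ)..t, Q τ) t z := by
      simp only [slope_def_field]
      ring
    rw [h4]
    linarith
  · have h1 : E 0 = 0 := h0
    simp only [h1, intervalIntegral.integral_same, add_zero]
    positivity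
  · intro t _
    have h1 : HasDerivAt (fun t : ℝ => 16 * L ^ 2 * (1 + t) ^ 2) (32 * L ^ 2 * (1 + t)) t := by
      have := (((hasDerivAt_id t).const_add 1).fun_pow 2).const_mul (16 * L ^ 2)
      refine this.congr_deriv ?_
      simp
      ring
    exact h1.hasDerivWithinAt
  · intro t ht hEt
    have ht1 : 0 < 1 + t := by linarith [ht.1]
    have h1 : 0 ≤ ∫ τ in (0 : ℝ)..t, Q τ :=
      intervalIntegral.integral_nonneg ht.1 fun τ _ => hQ0 τ
    have h2 : E t / (1 + t) ≤ 16 * L ^ 2 * (1 + t) := by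
      rw [div_le_iff₀ ht1]
      have h3 : E t + ∫ τ in (0 : ℝ)..t, Q τ = 16 * L ^ 2 * (1 + t) ^ 2 := hEt
      linarith
    have h4 : 0 < L ^ 2 := by positivity
    have h5 : L ^ 2 * 1 ≤ L ^ 2 * (1 + t) := mul_le_mul_of_nonneg_left (by linarith [ht.1]) h4.le
    have h6 : L ^ 2 * (1 + t) * (4 * π) < L ^ 2 * (1 + t) * 16 :=
      mul_lt_mul_of_pos_left (by linarith [Real.pi_lt_d2]) (by positivity)
    have h7 : π * (L ^ 2 * 1) ≤ π * (L ^ 2 * (1 + t)) := mul_le_mul_of_nonneg_left h5 Real.pi_pos.le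
    linarith

end Energy

end Mesh

/-! ## Dependence of the discrete solution on time -/

theorem eventually_nhdsWithin_iff_exists_delta {s : Set ℝ} {t : ℝ} {P : ℝ → Prop} :
    (∀ᶠ r in nhdsWithin t s, P r) ↔ ∃ δ > 0, ∀ r ∈ s, |r - t| < δ → P r := by
  rw [Filter.Eventually, Metric.mem_nhdsWithin_iff]
  constructor
  · rintro ⟨δ, hδ, h⟩
    exact ⟨δ, hδ, fun r hr hrt => h ⟨hrt, hr⟩⟩
  · rintro ⟨δ, hδ, h⟩
    exact ⟨δ, hδ, fun r hr => h r hr.2 hr.1⟩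

theorem continuousOn_of_uniform {f : ℝ → ℝ} {S : Set ℝ}
    (h : ∀ ε > 0, ∃ δ > 0, ∀ s ∈ S, ∀ t ∈ S, |s - t| < δ → |f s - f t| ≤ ε) :
    ContinuousOn f S := by
  intro t ht
  rw [ContinuousWithinAt, Metric.tendsto_nhds]
  intro ε hε
  obtain ⟨δ, hδ, h'⟩ := h (ε / 2) (by positivity)
  exact eventually_nhdsWithin_iff_exists_delta.2
    ⟨δ, hδ, fun s hs hst => (h' s hs t ht hst).trans_lt (by linarith)⟩

/-- Interpolation at fixed nodes writes the integral as a fixed linear combination of finitely many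
values. -/
theorem continuousOn_integral_mul {n : ℕ} {p : ℝ → ℝ[X]} {S : Set ℝ} {l r : ℝ} (hlr : l < r)
    (hp : ∀ t ∈ S, p t ∈ degreeLT ℝ n)
    (hc : ∀ x ∈ Icc l r, ContinuousOn (fun t => (p t).eval x) S) (v : ℝ[X]) :
    ContinuousOn (fun t => ∫ x in l..r, (p t).eval x * v.eval x) S := by
  obtain ⟨x, b, hx, -, h⟩ := exists_interpolation n hlr
  have : ∀ t ∈ S, ∫ y in l..r, (p t).eval y * v.eval y
      = ∑ i, (p t).eval (x i) * ∫ y in l..r, (b i).eval y * v.eval y := by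
    intro t ht
    have e : ∀ y, (p t).eval y * v.eval y
        = ∑ i, (p t).eval (x i) * ((b i).eval y * v.eval y) := by
      intro y
      rw [h _ (hp t ht) y, Finset.sum_mul]
      exact Finset.sum_congr rfl fun i _ => mul_assoc _ _ _
    simp only [e]
    rw [intervalIntegral.integral_finsetSum]
    · simp only [intervalIntegral.integral_const_mul]
    · intro i _
      exact (continuous_const.mul ((b i).continuous.mul v.continuous)).intervalIntegrable _ _
  refine ContinuousOn.congr ?_ this
  exact continuousOn_finsetSum _ fun i _ => (hc _ (hx i)).mul continuousOn_const

theorem continuousOn_integral_sq {n : ℕ} {p : ℝ → ℝ[X]} {S : Set ℝ} {l r : ℝ} (hlr : l < r)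
    (hp : ∀ t ∈ S, p t ∈ degreeLT ℝ n)
    (hc : ∀ x ∈ Icc l r, ContinuousOn (fun t => (p t).eval x) S) :
    ContinuousOn (fun t => ∫ x in l..r, (p t).eval x ^ 2) S := by
  obtain ⟨x, b, hx, -, h⟩ := exists_interpolation n hlr
  have : ∀ t ∈ S, ∫ y in l..r, (p t).eval y ^ 2
      = ∑ i, (p t).eval (x i) * ∫ y in l..r, (p t).eval y * (b i).eval y := by
    intro t ht
    have e : ∀ y, (p t).eval y ^ 2 = ∑ i, (p t).eval (x i) * ((p t).eval y * (b i).eval y) := by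
      intro y
      rw [sq]
      conv_lhs => rw [h _ (hp t ht) y, Finset.sum_mul, ← h _ (hp t ht) y]
      exact Finset.sum_congr rfl fun i _ => by ring
    simp only [e]
    rw [intervalIntegral.integral_finsetSum]
    · simp only [intervalIntegral.integral_const_mul]
    · intro i _
      exact (continuous_const.mul
        ((p t).continuous.mul (b i).continuous)).intervalIntegrable _ _
  refine ContinuousOn.congr ?_ this
  exact continuousOn_finsetSum _ fun i _ =>
    (hc _ (hx i)).mul (continuousOn_integral_mul hlr hp hc (b i))

/-- The moments against polynomials of the same degree determine the coefficients with a uniform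
bound, so their continuity is inherited. -/
theorem continuousOn_eval_of_moments {n : ℕ} {p : ℝ → ℝ[X]} {S : Set ℝ} {l r : ℝ} (hlr : l < r)
    (hp : ∀ t ∈ S, p t ∈ degreeLT ℝ n)
    (hc : ∀ v ∈ degreeLT ℝ n, ContinuousOn (fun t => ∫ x in l..r, (p t).eval x * v.eval x) S)
    (x : ℝ) : ContinuousOn (fun t => (p t).eval x) S := by
  obtain ⟨K, -, hK⟩ := exists_coeff_bound n (fun m : Fin n => momentL l r (X ^ (m : ℕ))) (by
    intro p hp h0
    have h2 : ∀ m < n, ∫ x in l..r, p.eval x * x ^ m = 0 := by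
      intro m hm
      simpa [momentL_apply] using h0 ⟨m, hm⟩
    have h3 := integral_mul_eq_zero_of_monomials (intervalIntegrable_eval p l r) h2 hp
    apply eq_zero_of_integral_sq_eq_zero hlr
    simpa [sq] using h3)
  have hcoeff : ∀ m, ContinuousOn (fun t => (p t).coeff m) S := by
    intro m t ht
    have h1 : Filter.Tendsto (fun s => K * ∑ i : Fin n,
        |momentL l r (X ^ (i : ℕ)) (p s) - momentL l r (X ^ (i : ℕ)) (p t)|)
        (nhdsWithin t S) (nhds 0) := by
      have h2 : ContinuousWithinAt (fun s => K * ∑ i : Fin n,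
          |momentL l r (X ^ (i : ℕ)) (p s) - momentL l r (X ^ (i : ℕ)) (p t)|) S t := by
        refine ContinuousWithinAt.mul continuousWithinAt_const ?_
        refine ContinuousOn.continuousWithinAt (continuousOn_finsetSum _ fun i _ => ?_) ht
        exact ((hc _ (X_pow_mem_degreeLT i.2)).sub continuousOn_const).abs
      simpa [ContinuousWithinAt] using h2
    rw [ContinuousWithinAt, tendsto_iff_dist_tendsto_zero]
    refine squeeze_zero' (Filter.Eventually.of_forall fun s => dist_nonneg) ?_ h1
    filter_upwards [self_mem_nhdsWithin] with s hs
    have := hK (p s - p t) (Submodule.sub_mem _ (hp s hs) (hp t ht)) _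
      (Finset.sum_nonneg fun i _ => abs_nonneg
        (momentL l r (X ^ ((i : Fin n) : ℕ)) (p s) - momentL l r (X ^ (i : ℕ)) (p t)))
      (fun i => by
        rw [map_sub]
        exact Finset.single_le_sum (f := fun i : Fin n =>
          |momentL l r (X ^ (i : ℕ)) (p s) - momentL l r (X ^ (i : ℕ)) (p t)|)
          (fun i _ => abs_nonneg _) (Finset.mem_univ i)) m
    rwa [coeff_sub] at this
  refine ContinuousOn.congr ?_ fun t ht => eval_eq_sum_of_mem_degreeLT (hp t ht) x
  exact continuousOn_finsetSum _ fun m _ => (hcoeff m).mul continuousOn_const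

namespace Mesh

section Solution

variable {𝓜 : Mesh} {k : ℕ} {lam θ T B : ℝ} {D : ℝ → ℕ → ℝ → ℝ} {uh qh : ℝ → 𝓜.PiecePoly}

theorem IsLDGSolution.hasDerivWithinAt (h : 𝓜.IsLDGSolution k lam θ T uh qh) {t : ℝ}
    (ht : t ∈ Icc 0 T) (j : Fin 𝓜.N) (x : ℝ) : HasDerivWithinAt (fun s => (uh s j).eval x)
      (𝓜.timeDeriv T (fun s => 𝓜.toBroken (uh s)) t j x) (Icc 0 T) t :=
  (h.time_reg t ht j x).hasDerivWithinAt

theorem IsLDGSolution.continuousOn_eval_u (h : 𝓜.IsLDGSolution k lam θ T uh qh) (j : Fin 𝓜.N)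
    (x : ℝ) : ContinuousOn (fun t => (uh t j).eval x) (Icc 0 T) :=
  fun t ht => (h.time_reg t ht j x).continuousWithinAt

/-- Differentiability is given pointwise in x only. Interpolation at k + 1 nodes makes the time
derivative a polynomial in x, and the differentiability uniform in x. -/
theorem IsLDGSolution.timeDeriv_eq_sum (h : 𝓜.IsLDGSolution k lam θ T uh qh) (hT : 0 < T)
    {x : Fin (k + 1) → ℝ} {b : Fin (k + 1) → ℝ[X]}
    (hb : ∀ p ∈ degreeLT ℝ (k + 1), ∀ y, p.eval y = ∑ i, p.eval (x i) * (b i).eval y)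
    {t : ℝ} (ht : t ∈ Icc 0 T) (j : Fin 𝓜.N) (y : ℝ) :
    𝓜.timeDeriv T (fun s => 𝓜.toBroken (uh s)) t j y
      = ∑ i, 𝓜.timeDeriv T (fun s => 𝓜.toBroken (uh s)) t j (x i) * (b i).eval y := by
  have h1 : HasDerivWithinAt (fun s => ∑ i, (uh s j).eval (x i) * (b i).eval y)
      (∑ i, 𝓜.timeDeriv T (fun s => 𝓜.toBroken (uh s)) t j (x i) * (b i).eval y) (Icc 0 T) t :=
    HasDerivWithinAt.fun_sum fun i _ => (h.hasDerivWithinAt ht j (x i)).mul_const _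
  have h2 := h1.congr_of_mem (fun s hs => hb _ (h.mem_u s hs j) y) ht
  exact (uniqueDiffOn_Icc hT t ht).eq_deriv _ (h.hasDerivWithinAt ht j y) h2

theorem IsLDGSolution.cellCont_timeDeriv (h : 𝓜.IsLDGSolution k lam θ T uh qh) (hT : 0 < T)
    {t : ℝ} (ht : t ∈ Icc 0 T) :
    𝓜.CellCont (𝓜.timeDeriv T (fun s => 𝓜.toBroken (uh s)) t) := by
  obtain ⟨x, b, -, -, hb⟩ := exists_interpolation (k + 1) two_pi_pos'
  intro j
  refine ContinuousOn.congr ?_ fun y _ => h.timeDeriv_eq_sum hT hb ht j y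
  exact continuousOn_finsetSum _ fun i _ =>
    continuousOn_const.mul (b i).continuous.continuousOn

theorem IsLDGSolution.eventually_deriv (h : 𝓜.IsLDGSolution k lam θ T uh qh) (hT : 0 < T) {t : ℝ}
    (ht : t ∈ Icc 0 T) {ε : ℝ} (hε : 0 < ε) :
    ∀ᶠ s in nhdsWithin t (Icc 0 T), ∀ j, ∀ x ∈ 𝓜.cell j,
      |(uh s j).eval x - (uh t j).eval x
        - (s - t) * 𝓜.timeDeriv T (fun s => 𝓜.toBroken (uh s)) t j x| ≤ ε * |s - t| := by
  obtain ⟨x, b, -, -, hb⟩ := exists_interpolation (k + 1) two_pi_pos'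
  have hbd : ∀ i, ∃ M, ∀ y ∈ Icc 0 (2 * π), ‖(b i).eval y‖ ≤ M := fun i =>
    isCompact_Icc.exists_bound_of_continuousOn (b i).continuous.continuousOn
  choose M hM using hbd
  have hM0 : ∀ i, 0 ≤ M i := fun i =>
    (norm_nonneg _).trans (hM i 0 (left_mem_Icc.2 two_pi_pos'.le))
  have hS : 0 ≤ ∑ i, M i := Finset.sum_nonneg fun i _ => hM0 i
  set c := ε / (∑ i, M i + 1) with hc
  have hc0 : 0 < c := by positivity
  have h1 : ∀ᶠ s in nhdsWithin t (Icc 0 T), ∀ j, ∀ i,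
      ‖(uh s j).eval (x i) - (uh t j).eval (x i)
        - (s - t) • 𝓜.timeDeriv T (fun s => 𝓜.toBroken (uh s)) t j (x i)‖ ≤ c * ‖s - t‖ :=
    Filter.eventually_all.2 fun j => Filter.eventually_all.2 fun i =>
      (hasDerivWithinAt_iff_isLittleO.1 (h.hasDerivWithinAt ht j (x i))).def hc0
  filter_upwards [h1, self_mem_nhdsWithin] with s hs hsT j y hy
  rw [hb _ (h.mem_u s hsT j), hb _ (h.mem_u t ht j), h.timeDeriv_eq_sum hT hb ht j y,
    ← Finset.sum_sub_distrib, Finset.mul_sum, ← Finset.sum_sub_distrib]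
  refine (Finset.abs_sum_le_sum_abs _ _).trans ?_
  have h2 : ∀ i, |(uh s j).eval (x i) * (b i).eval y - (uh t j).eval (x i) * (b i).eval y
      - (s - t) * (𝓜.timeDeriv T (fun s => 𝓜.toBroken (uh s)) t j (x i) * (b i).eval y)|
      ≤ c * |s - t| * M i := by
    intro i
    rw [← mul_assoc, ← sub_mul, ← sub_mul, abs_mul]
    exact mul_le_mul (hs j i) (hM i y (𝓜.cell_subset j hy)) (abs_nonneg _) (by positivity)
  refine (Finset.sum_le_sum fun i _ => h2 i).trans ?_
  rw [← Finset.mul_sum]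
  have h3 : c * (∑ i, M i + 1) = ε := by
    rw [hc]
    field_simp
  have h4 : c * ∑ i, M i ≤ ε := by linarith
  calc c * |s - t| * ∑ i, M i = c * (∑ i, M i) * |s - t| := by ring
    _ ≤ ε * |s - t| := by gcongr

/-- No regularity of q_h in time is assumed; the second equation expresses its moments through u_h.
-/
theorem IsLDGSolution.continuousOn_eval_q (h : 𝓜.IsLDGSolution k lam θ T uh qh) (j : Fin 𝓜.N)
    (x : ℝ) : ContinuousOn (fun t => (qh t j).eval x) (Icc 0 T) := by
  have havg : ∀ i, ContinuousOn (fun t => 𝓜.avg θ (𝓜.toBroken (uh t)) i) (Icc 0 T) := fun i =>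
    (continuousOn_const.mul (h.continuousOn_eval_u _ _)).add
      (continuousOn_const.mul (h.continuousOn_eval_u _ _))
  refine continuousOn_eval_of_moments (n := k + 1) (𝓜.left_lt_right j)
    (fun t ht => h.mem_q t ht j) (fun v hv => ?_) x
  have h1 := continuousOn_integral_mul (𝓜.left_lt_right j) (fun t ht => h.mem_u t ht j)
    (fun x _ => h.continuousOn_eval_u j x) (derivative v)
  refine ContinuousOn.congr (f := fun t => 𝓜.avg θ (𝓜.toBroken (uh t)) j * v.eval (𝓜.right j)
    - 𝓜.avg θ (𝓜.toBroken (uh t)) (𝓜.prev j) * v.eval (𝓜.left j)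
    - ∫ x in 𝓜.left j..𝓜.right j, (uh t j).eval x * (derivative v).eval x) ?_ fun t ht => ?_
  · exact (((havg j).mul continuousOn_const).sub ((havg _).mul continuousOn_const)).sub h1
  · have := h.eq_q t ht j v hv
    simp only
    linarith

theorem continuousOn_errQ (hθ : θ ≠ 1 / 2) (hD : IsJetSolution (2 * k) T B D)
    (h : 𝓜.IsLDGSolution k lam θ T uh qh) (j : Fin 𝓜.N) {x : ℝ} (hx : x ∈ 𝓜.cell j) :
    ContinuousOn (fun t => (𝓜.errQ k lam θ (D t) (qh t) j).eval x) (Icc 0 T) := by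
  simp only [eval_errQ, etaQ]
  refine (ContinuousOn.sub ?_ (continuousOn_finsetSum _ fun i hi => ?_)).sub
    (h.continuousOn_eval_q j x)
  · refine continuousOn_of_uniform fun ε hε => ?_
    obtain ⟨δ, hδ, h'⟩ := hD.equicontinuous 1 (by omega) ε hε
    exact ⟨δ, hδ, fun s hs t ht hst => h' s hs t ht hst x (𝓜.cell_subset j hx)⟩
  · refine continuousOn_of_uniform fun ε hε => ?_
    obtain ⟨δ, hδ, h'⟩ := op_uniform_continuous (𝓜 := 𝓜) (lam := lam) hθ
      (Nat.lt_succ_iff.1 (Finset.mem_range.1 hi)) hD ε hε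
    exact ⟨δ, hδ, fun s hs t ht hst => (h' s hs t ht hst j x hx).2⟩

/-- The residual of the equation for `u_h`. -/
def residual (𝓜 : Mesh) (k : ℕ) (lam θ T : ℝ) (D : ℝ → ℕ → ℝ → ℝ) (uh : ℝ → 𝓜.PiecePoly)
    (t : ℝ) : 𝓜.Broken := fun j x => advDiff (D t) 0 x
  - ∑ i ∈ Finset.range k, (𝓜.op k lam θ i (advDiff (D t))).1 j x
  - 𝓜.timeDeriv T (fun s => 𝓜.toBroken (uh s)) t j x

/-- Adding w_{u,k} back to ξ_u leaves u - u_h minus the corrections with i < k, all of which are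
differentiable in time. -/
theorem residual_uniform_deriv (hθ : θ ≠ 1 / 2) (hT : 0 < T) (hD : IsJetSolution (2 * k) T B D)
    (h : 𝓜.IsLDGSolution k lam θ T uh qh) : ∀ t ∈ Icc 0 T, ∀ ε > 0, ∃ δ > 0, ∀ s ∈ Icc 0 T,
      |s - t| < δ → ∀ j, ∀ x ∈ 𝓜.cell j,
        |(𝓜.errU k lam θ (D s) (uh s) j).eval x + (𝓜.op k lam θ k (D s)).1 j x
          - ((𝓜.errU k lam θ (D t) (uh t) j).eval x + (𝓜.op k lam θ k (D t)).1 j x)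
          - (s - t) * 𝓜.residual k lam θ T D uh t j x| ≤ ε * |s - t| := by
  intro t ht ε hε
  -- The k + 2 contributions are u, the k corrections with i < k, and u_h.
  set c := ε / (k + 2) with hc
  have hc0 : 0 < c := by positivity
  have h1 : ∀ᶠ s in nhdsWithin t (Icc 0 T), ∀ x ∈ Icc 0 (2 * π),
      |D s 0 x - D t 0 x - (s - t) * advDiff (D t) 0 x| ≤ c * |s - t| := by
    obtain ⟨δ, hδ, h'⟩ := hD.uniform_deriv 0 (by omega) c hc0
    exact eventually_nhdsWithin_iff_exists_delta.2 ⟨δ, hδ, fun s hs => h' s hs t ht⟩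
  have h2 : ∀ᶠ s in nhdsWithin t (Icc 0 T), ∀ i ∈ Finset.range k, ∀ j, ∀ x ∈ 𝓜.cell j,
      |(𝓜.op k lam θ i (D s)).1 j x - (𝓜.op k lam θ i (D t)).1 j x
          - (s - t) * (𝓜.op k lam θ i (advDiff (D t))).1 j x| ≤ c * |s - t| := by
    rw [Filter.eventually_all_finset]
    intro i hi
    obtain ⟨δ, hδ, h'⟩ := op_uniform_deriv (𝓜 := 𝓜) (lam := lam) hθ (Finset.mem_range.1 hi) hD
      c hc0
    exact eventually_nhdsWithin_iff_exists_delta.2 ⟨δ, hδ, fun s hs => h' s hs t ht⟩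
  rw [← eventually_nhdsWithin_iff_exists_delta]
  filter_upwards [h1, h2, h.eventually_deriv hT ht hc0] with s h1 h2 h3 j x hx
  have e : (𝓜.errU k lam θ (D s) (uh s) j).eval x + (𝓜.op k lam θ k (D s)).1 j x
      - ((𝓜.errU k lam θ (D t) (uh t) j).eval x + (𝓜.op k lam θ k (D t)).1 j x)
      - (s - t) * 𝓜.residual k lam θ T D uh t j x
      = (D s 0 x - D t 0 x - (s - t) * advDiff (D t) 0 x)
        - ∑ i ∈ Finset.range k, ((𝓜.op k lam θ i (D s)).1 j x - (𝓜.op k lam θ i (D t)).1 j x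
          - (s - t) * (𝓜.op k lam θ i (advDiff (D t))).1 j x)
        - ((uh s j).eval x - (uh t j).eval x
          - (s - t) * 𝓜.timeDeriv T (fun s => 𝓜.toBroken (uh s)) t j x) := by
    simp only [eval_errU, etaU, residual, Finset.sum_range_succ, Finset.sum_sub_distrib,
      ← Finset.mul_sum]
    ring
  rw [e]
  have h4 : |∑ i ∈ Finset.range k, ((𝓜.op k lam θ i (D s)).1 j x - (𝓜.op k lam θ i (D t)).1 j x
      - (s - t) * (𝓜.op k lam θ i (advDiff (D t))).1 j x)| ≤ k * (c * |s - t|) := by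
    refine (Finset.abs_sum_le_sum_abs _ _).trans
      ((Finset.sum_le_sum fun i hi => h2 i hi j x hx).trans ?_)
    simp
  refine ((abs_sub _ _).trans (add_le_add ((abs_sub _ _).trans
    (add_le_add (h1 x (𝓜.cell_subset j hx)) h4)) (h3 j x hx))).trans (le_of_eq ?_)
  have : c * (k + 2) = ε := by
    rw [hc]
    field_simp
  rw [← this]
  ring

theorem cellCont_residual (hT : 0 < T) (hD : IsJetSolution (2 * k) T B D) (hk : 1 ≤ k)
    (h : 𝓜.IsLDGSolution k lam θ T uh qh) {t : ℝ} (ht : t ∈ Icc 0 T) :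
    𝓜.CellCont (𝓜.residual k lam θ T D uh t) := fun j => by
  have hA := ((hD.jet t ht).mono (by omega : 1 + 2 ≤ _)).advDiff
  exact ((hA.cellCont (by omega) j).sub
    (continuousOn_finsetSum _ fun i _ => (cellCont_op i _ _ hA).1 j)).sub
    (h.cellCont_timeDeriv hT ht j)

/-- Half of ‖ξ_q‖² absorbs the pairing with w_{q,k}. After doubling, one full ‖ξ_q‖² remains on the
left and 2πL² on the right. -/
theorem energy_dissipation (hk : 1 ≤ k) (hlam : 1 / 2 ≤ lam) (hθ : θ ≠ 1 / 2) (hT : 0 < T)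
    (hD : IsJetSolution (2 * k) T B D) (hper0 : ∀ t ∈ Icc 0 T, D t 0 0 = D t 0 (2 * π))
    (hper1 : ∀ t ∈ Icc 0 T, D t 1 0 = D t 1 (2 * π)) (h : 𝓜.IsLDGSolution k lam θ T uh qh)
    {L : ℝ} {t : ℝ} (ht : t ∈ Icc 0 T)
    (hL : ∀ j, ∀ x ∈ 𝓜.cell j, |(𝓜.op k lam θ k (D t)).2 j x| ≤ L) :
    2 * 𝓜.total (fun j x => 𝓜.residual k lam θ T D uh t j x
        * (𝓜.errU k lam θ (D t) (uh t) j).eval x)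
      + 𝓜.total (fun j x => (𝓜.errQ k lam θ (D t) (qh t) j).eval x ^ 2) ≤ 2 * π * L ^ 2 := by
  have hJ := hD.jet t ht
  have hW := (cellCont_op (𝓜 := 𝓜) (k := k) (lam := lam) (θ := θ) k (D t) B
    (hJ.mono (by omega))).2
  have h1 := energy_inequality (θ := θ) hlam
    (errU_mem (lam := lam) hθ (hJ.mono (by omega : 1 ≤ _)) (h.mem_u t ht))
    (errQ_mem (lam := lam) hθ (hJ.mono (by omega : 3 ≤ _)) (h.mem_q t ht))
    (ρ := 𝓜.residual k lam θ T D uh t) (W := (𝓜.op k lam θ k (D t)).2)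
    (fun j v hv => error_equation_u hθ (hJ.mono (by omega)) (hper0 t ht) (hper1 t ht)
      (h.cellCont_timeDeriv hT ht j) hv (by
        rw [← cellInt_sub (uh t j).continuous.continuousOn (qh t j).continuous.continuousOn]
        exact h.eq_u t ht j v hv))
    (fun j v hv => error_equation_q hθ (hJ.mono (by omega)) (hper0 t ht) hv (h.eq_q t ht j v hv))
  have e1 : ∑ j, 𝓜.cellInt j (𝓜.residual k lam θ T D uh t j) (𝓜.errU k lam θ (D t) (uh t) j)
      = 𝓜.total (fun j x => 𝓜.residual k lam θ T D uh t j x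
        * (𝓜.errU k lam θ (D t) (uh t) j).eval x) := rfl
  have e2 : ∑ j, 𝓜.cellInt j (fun x => (𝓜.errQ k lam θ (D t) (qh t) j).eval x)
        (𝓜.errQ k lam θ (D t) (qh t) j)
      = 𝓜.total (fun j x => (𝓜.errQ k lam θ (D t) (qh t) j).eval x ^ 2) := by
    simp only [cellInt, total, sq]
  set q := 𝓜.errQ k lam θ (D t) (qh t)
  have cq2 : 𝓜.CellCont fun j x => (q j).eval x ^ 2 := fun j =>
    (q j).continuous.continuousOn.pow 2
  have h2 : -∑ j, 𝓜.cellInt j ((𝓜.op k lam θ k (D t)).2 j) (q j)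
      ≤ 𝓜.total fun j x => 1 / 2 * L ^ 2 + 1 / 2 * (q j).eval x ^ 2 := by
    have e3 : -∑ j, 𝓜.cellInt j ((𝓜.op k lam θ k (D t)).2 j) (q j)
        = 𝓜.total fun j x => -1 * ((𝓜.op k lam θ k (D t)).2 j x * (q j).eval x) := by
      rw [total_const_mul, neg_one_mul]
      rfl
    rw [e3]
    refine total_mono
      (fun j => continuousOn_const.mul ((hW j).mul (q j).continuous.continuousOn))
      (fun j => continuousOn_const.add (continuousOn_const.mul (cq2 j))) fun j x hx => ?_
    have h3 := sq_le_sq' (neg_le_of_abs_le (hL j x hx)) (le_of_abs_le (hL j x hx))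
    linarith [sq_nonneg ((𝓜.op k lam θ k (D t)).2 j x + (q j).eval x)]
  rw [total_add (f := fun _ _ => 1 / 2 * L ^ 2) (g := fun j x => 1 / 2 * (q j).eval x ^ 2)
    (fun j => continuousOn_const) (fun j => continuousOn_const.mul (cq2 j)), total_const,
    total_const_mul] at h2
  rw [e1, e2] at h1
  linarith

theorem exists_energy_bound (hk : 1 ≤ k) (hlam : 1 / 2 ≤ lam) (hθ : θ ≠ 1 / 2) :
    ∃ C : ℝ, 0 < C ∧ ∀ (𝓜 : Mesh) (T B : ℝ) (D : ℝ → ℕ → ℝ → ℝ) (uh qh : ℝ → 𝓜.PiecePoly),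
      0 < T → IsJetSolution (2 * k) T B D → (∀ t ∈ Icc 0 T, D t 0 0 = D t 0 (2 * π)) →
      (∀ t ∈ Icc 0 T, D t 1 0 = D t 1 (2 * π)) → 𝓜.IsLDGSolution k lam θ T uh qh →
      𝓜.errU k lam θ (D 0) (uh 0) = 0 → ∀ t ∈ Icc 0 T,
        𝓜.total (fun j x => (𝓜.errU k lam θ (D t) (uh t) j).eval x ^ 2)
          + ∫ τ in (0 : ℝ)..t, 𝓜.total (fun j x => (𝓜.errQ k lam θ (D τ) (qh τ) j).eval x ^ 2)
          ≤ 16 * (C * 𝓜.maxSize ^ (2 * k + 1) * (B + 1)) ^ 2 * (1 + t) ^ 2 := by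
  obtain ⟨C, hC0, hC⟩ := exists_last_bound k lam hθ
  refine ⟨C, hC0, fun 𝓜 T B D uh qh hT hD hper0 hper1 h h0 t ht => ?_⟩
  have hB : 0 ≤ B := (hD.jet 0 (left_mem_Icc.2 hT.le)).nonneg
  have hh := 𝓜.maxSize_pos
  obtain ⟨hC1, hC2⟩ := hC 𝓜 T B D hD
  -- B + 1 instead of B, because `energy_estimate` needs L > 0 and B may be zero.
  set L := C * 𝓜.maxSize ^ (2 * k + 1) * (B + 1) with hL
  have hL0 : 0 < L := by positivity
  have hBL : C * 𝓜.maxSize ^ (2 * k + 1) * B ≤ L :=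
    mul_le_mul_of_nonneg_left (by linarith) (by positivity)
  set Q : ℝ → ℝ := fun τ => 𝓜.total (fun j x => (𝓜.errQ k lam θ (D τ) (qh τ) j).eval x ^ 2) with hQ
  have hQ0 : ∀ τ, 0 ≤ Q τ := fun τ => total_nonneg fun j x _ => sq_nonneg _
  have hQc : ContinuousOn Q (Icc 0 T) := continuousOn_finsetSum _ fun j _ =>
    continuousOn_integral_sq (n := k + 1) (𝓜.left_lt_right j)
      (fun s hs => errQ_mem hθ ((hD.jet s hs).mono (by omega)) (h.mem_q s hs) j)
      (fun x hx => continuousOn_errQ hθ hD h j hx)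
  have hE := energy_estimate (𝓜 := 𝓜) (T := T) hL0
    (ξ := fun t => 𝓜.toBroken (𝓜.errU k lam θ (D t) (uh t)))
    (w := fun t => (𝓜.op k lam θ k (D t)).1) (ρ := 𝓜.residual k lam θ T D uh)
    -- Q is known to be continuous on [0, T] only; the constant extension is continuous on the line
    -- and has the same integrals over [0, t].
    (Q := IccExtend hT.le ((Icc 0 T).domRestrict Q))
    (fun t _ => 𝓜.cellCont_toBroken _) (fun t ht => cellCont_residual hT hD hk h ht)
    (residual_uniform_deriv hθ hT hD h)
    (fun s hs t ht j x hx => (hC2 s hs t ht j x hx).trans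
      (mul_le_mul_of_nonneg_right hBL (abs_nonneg _)))
    (continuousOn_iff_continuous_domRestrict.1 hQc).Icc_extend' (fun _ => hQ0 _)
    (fun t ht => by
      rw [IccExtend_of_mem hT.le _ ht]
      exact energy_dissipation hk hlam hθ hT hD hper0 hper1 h ht
        fun j x hx => (hC1 t ht j x hx).trans hBL)
    (by simp [toBroken, h0, total]) t ht
  have e : ∫ τ in (0 : ℝ)..t, IccExtend hT.le ((Icc 0 T).domRestrict Q) τ
      = ∫ τ in (0 : ℝ)..t, Q τ := by
    refine intervalIntegral.integral_congr fun τ hτ => ?_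
    rw [uIcc_of_le ht.1] at hτ
    exact IccExtend_of_mem hT.le _ ⟨hτ.1, hτ.2.trans ht.2⟩
  rw [e] at hE
  exact hE

/-! ## Errors of the numerical traces -/

/-- The inverse estimate with σh ≤ h_j controls h times the squared traces by the cell integrals,
and 1/N ≤ h/(2π) supplies the factor h. -/
theorem exists_avg_bound (k : ℕ) (α : ℝ) {σ : ℝ} (hσ : 0 < σ) : ∃ A : ℝ, 0 < A ∧
    ∀ 𝓜 : Mesh, 𝓜.QuasiUniform σ → ∀ p : 𝓜.PiecePoly, 𝓜.InSpace k p →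
      1 / (𝓜.N : ℝ) * ∑ j, 𝓜.avg α (𝓜.toBroken p) j ^ 2
        ≤ A * 𝓜.total fun j x => (p j).eval x ^ 2 := by
  obtain ⟨K, hK0, hK⟩ := exists_sq_eval_le (k + 1)
  refine ⟨(2 * (α ^ 2 + (1 - α) ^ 2) + 1) * K / (2 * π * σ), by positivity,
    fun 𝓜 hq p hp => ?_⟩
  have hh := 𝓜.maxSize_pos
  have hN : (0 : ℝ) < 𝓜.N := by exact_mod_cast 𝓜.N_pos
  set I : Fin 𝓜.N → ℝ := fun j => ∫ x in 𝓜.left j..𝓜.right j, (p j).eval x ^ 2 with hI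
  have hI0 : ∀ j, 0 ≤ I j := fun j =>
    intervalIntegral.integral_nonneg (𝓜.left_le_right j) fun x _ => sq_nonneg _
  have h1 : ∀ j, ∀ x ∈ 𝓜.cell j, σ * 𝓜.maxSize * (p j).eval x ^ 2 ≤ K * I j := fun j x hx =>
    (mul_le_mul_of_nonneg_right (hq j) (sq_nonneg _)).trans
      (hK _ (hp j) _ _ (𝓜.left_lt_right j) x hx)
  have h2 : ∀ j, σ * 𝓜.maxSize * 𝓜.avg α (𝓜.toBroken p) j ^ 2
      ≤ 2 * α ^ 2 * K * I j + 2 * (1 - α) ^ 2 * K * I (𝓜.next j) := by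
    intro j
    have a1 := mul_le_mul_of_nonneg_left (h1 _ _ (𝓜.right_mem_cell j)) (sq_nonneg α)
    have a2 := mul_le_mul_of_nonneg_left (h1 _ _ (𝓜.left_mem_cell (𝓜.next j)))
      (sq_nonneg (1 - α))
    have a3 := mul_nonneg (mul_pos hσ hh).le (sq_nonneg
      (α * (p j).eval (𝓜.right j) - (1 - α) * (p (𝓜.next j)).eval (𝓜.left (𝓜.next j))))
    simp only [avg, toBroken]
    nlinarith
  have h3 : σ * 𝓜.maxSize * ∑ j, 𝓜.avg α (𝓜.toBroken p) j ^ 2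
      ≤ (2 * (α ^ 2 + (1 - α) ^ 2) + 1) * K * ∑ j, I j := by
    rw [Finset.mul_sum]
    refine (Finset.sum_le_sum fun j _ => h2 j).trans ?_
    rw [Finset.sum_add_distrib, ← Finset.mul_sum, ← Finset.mul_sum, 𝓜.sum_next I]
    nlinarith [mul_nonneg hK0.le (Finset.sum_nonneg fun j (_ : j ∈ Finset.univ) => hI0 j)]
  have h4 : 2 * π * σ * ∑ j, 𝓜.avg α (𝓜.toBroken p) j ^ 2
      ≤ 𝓜.N * ((2 * (α ^ 2 + (1 - α) ^ 2) + 1) * K * ∑ j, I j) := by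
    have hS : 0 ≤ ∑ j, 𝓜.avg α (𝓜.toBroken p) j ^ 2 := Finset.sum_nonneg fun j _ => sq_nonneg _
    have := mul_le_mul_of_nonneg_right 𝓜.two_pi_le (mul_nonneg hσ.le hS)
    have := mul_le_mul_of_nonneg_left h3 hN.le
    linarith
  change _ ≤ _ * ∑ j, I j
  rw [one_div, inv_mul_le_iff₀ hN, div_mul_eq_mul_div, ← mul_div_assoc, le_div_iff₀ (by positivity)]
  linarith

/-- The superconvergence mechanism: η_u is in general only O(h^{k+1}) inside the cells, but its
θ-average vanishes at every node. -/
theorem traceError_u (hθ : θ ≠ 1 / 2) {F : ℕ → ℝ → ℝ} (hF : IsJet (1 + 2 * k) F B)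
    (hper : F 0 0 = F 0 (2 * π)) (p : 𝓜.PiecePoly) :
    𝓜.traceError θ (F 0) p
      = √(1 / (𝓜.N : ℝ) * ∑ j, 𝓜.avg θ (𝓜.toBroken (𝓜.errU k lam θ F p)) j ^ 2) := by
  rw [traceError]
  congr 2
  refine Finset.sum_congr rfl fun j _ => ?_
  rw [avg_errU, avg_etaU hθ hF, avg_restrict 𝓜 hper, sub_zero, sq_abs]

/-- For λ = θ the average of η_q equals that of η_u, which is zero. For λ ≠ θ the term η_u^{(λ)}
would remain. -/
theorem traceError_q (hθ : θ ≠ 1 / 2) {F : ℕ → ℝ → ℝ} (hF : IsJet (1 + 2 * k) F B)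
    (hper : F 1 0 = F 1 (2 * π)) (p : 𝓜.PiecePoly) {f : ℝ → ℝ}
    (hf : EqOn f (F 1) (Icc 0 (2 * π))) :
    𝓜.traceError (1 - θ) f p ^ 2 = 1 / (𝓜.N : ℝ)
      * ∑ j, 𝓜.avg (1 - θ) (𝓜.toBroken (𝓜.errQ k θ θ F p)) j ^ 2 := by
  rw [traceError, Real.sq_sqrt (by positivity)]
  congr 1
  refine Finset.sum_congr rfl fun j _ => ?_
  rw [avg_errQ, avg_etaQ hθ hF, avg_etaU hθ hF, avg_restrict 𝓜 hper, sub_zero, sq_abs,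
    hf (𝓜.cell_subset j (𝓜.right_mem_cell j))]

theorem errU_initial (hθ : θ ≠ 1 / 2) (hT : 0 < T) {u : ℝ → ℝ → ℝ}
    (hD : IsJetSolution (2 * k) T B D) (h0 : ∀ t ∈ Icc 0 T, D t 0 = u t)
    (h1 : ∀ t ∈ Icc 0 T, EqOn (auxVar u t) (D t 1) (Icc 0 (2 * π)))
    (hi : ∀ j, ∀ x ∈ Ioo (𝓜.left j) (𝓜.right j),
      (uh 0 j).eval x = 𝓜.interp k k lam θ T u 0 j x) :
    𝓜.errU k lam θ (D 0) (uh 0) = 0 := by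
  have hz : (0 : ℝ) ∈ Icc 0 T := left_mem_Icc.2 hT.le
  funext j
  -- Agreement on the open cells suffices, because ξ_u is polynomial on each cell.
  refine poly_eq_of_eqOn_cell (𝓜 := 𝓜) j fun x hx => ?_
  have hx' : x ∈ 𝓜.cell j := Ioo_subset_Icc_self hx
  have e : ∑ i ∈ Finset.Icc 1 k, (𝓜.corr k lam θ T u i).1 0 j x
      = ∑ i ∈ Finset.range k, (𝓜.op k lam θ (i + 1) (D 0)).1 j x := by
    rw [Finset.range_eq_Ico, Finset.sum_Ico_add' (fun i => (𝓜.op k lam θ i (D 0)).1 j x)]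
    refine Finset.sum_congr (by ext; simp) fun i hi => ?_
    exact (corr_eqOn hθ hD hT h0 h1 i (by simp at hi; omega) 0 hz j).1 hx'
  rw [eval_errU, hi j x hx, etaU, Finset.sum_range_succ']
  simp only [interp, Pi.sub_apply, Finset.sum_apply, e, op, h0 0 hz, restrict, Pi.zero_apply,
    eval_zero]
  ring

end Solution

end Mesh

end LDG

end

/-! ### The superconvergence theorem. -/

theorem mainTheorem3 (k : ℕ) (hk : 1 ≤ k) (lam θ : ℝ) (hlam : 1 / 2 ≤ lam) (hθ : θ ≠ 1 / 2)
    (σ : ℝ) (hσ : 0 < σ) (B : ℝ) :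
    ∃ C : ℝ, 0 < C ∧
      ∀ (T : ℝ), 0 < T →
      ∀ u : ℝ → ℝ → ℝ, LDG.IsPeriodicSolution T u →
      (∀ t ∈ Set.Icc 0 T, LDG.SobolevNormLE 0 (2 * Real.pi) (2 * k + 3) (u t) B) →
      ∀ 𝓜 : LDG.Mesh, 𝓜.QuasiUniform σ →
      ∀ uh qh : ℝ → 𝓜.PiecePoly, 𝓜.IsLDGSolution k lam θ T uh qh →
      (∀ j, ∀ x ∈ Set.Ioo (𝓜.left j) (𝓜.right j),
        (uh 0 j).eval x = 𝓜.interp k k lam θ T u 0 j x) →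
      ∀ t ∈ Set.Icc 0 T,
        𝓜.traceError θ (u t) (uh t) ≤ C * (1 + t) * 𝓜.maxSize ^ (2 * k + 1) ∧
        (lam = θ →
          IntervalIntegrable
            (fun τ => 𝓜.traceError (1 - θ) (LDG.auxVar u τ) (qh τ) ^ 2) MeasureTheory.volume 0 t ∧
          √(∫ τ in (0 : ℝ)..t, 𝓜.traceError (1 - θ) (LDG.auxVar u τ) (qh τ) ^ 2)
            ≤ C * (1 + t) * 𝓜.maxSize ^ (2 * k + 1)) := by
  obtain ⟨C, hC0, hC⟩ := LDG.Mesh.exists_energy_bound (lam := lam) hk hlam hθ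
  obtain ⟨A, hA0, hA⟩ := LDG.Mesh.exists_avg_bound k θ hσ
  obtain ⟨A', hA0', hA'⟩ := LDG.Mesh.exists_avg_bound k (1 - θ) hσ
  -- The factor 4 is the root of the 16 in the energy bound. The absolute value keeps the constant
  -- positive for negative B, a case which the Sobolev bound later excludes.
  refine ⟨4 * (√A + √A') * C * (|B| + 1), by positivity, ?_⟩
  intro T hT u hu hB 𝓜 hq uh qh h hi t ht
  obtain ⟨D, hD, h0, h1⟩ := hu.exists_jetSolution (n := 2 * k) hB
  have hB0 : 0 ≤ B := (hD.jet 0 (Set.left_mem_Icc.2 hT.le)).nonneg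
  have hh := 𝓜.maxSize_pos
  have hper0 : ∀ t ∈ Set.Icc 0 T, D t 0 0 = D t 0 (2 * Real.pi) := fun t ht => by
    rw [h0 t ht, hu.periodic t ht]
  have hper1 : ∀ t ∈ Set.Icc 0 T, D t 1 0 = D t 1 (2 * Real.pi) := fun t ht => by
    rw [← h1 t ht (Set.left_mem_Icc.2 LDG.two_pi_pos'.le),
      ← h1 t ht (Set.right_mem_Icc.2 LDG.two_pi_pos'.le), hu.periodic_aux t ht]
  have hE := hC 𝓜 T B D uh qh hT hD hper0 hper1 h
    (LDG.Mesh.errU_initial hθ hT hD h0 h1 hi) t ht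
  have ht1 : 0 < 1 + t := by linarith [ht.1]
  rw [abs_of_nonneg hB0]
  set L := C * 𝓜.maxSize ^ (2 * k + 1) * (B + 1) with hL
  have hL0 : 0 < L := by positivity
  have hsub : Set.Icc 0 t ⊆ Set.Icc 0 T := Set.Icc_subset_Icc_right ht.2
  have hQ0 : 0 ≤ ∫ τ in (0 : ℝ)..t,
      𝓜.total (fun j x => (𝓜.errQ k lam θ (D τ) (qh τ) j).eval x ^ 2) :=
    intervalIntegral.integral_nonneg ht.1 fun τ _ =>
      LDG.Mesh.total_nonneg fun j x _ => sq_nonneg _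
  have hU0 : 0 ≤ 𝓜.total (fun j x => (𝓜.errU k lam θ (D t) (uh t) j).eval x ^ 2) :=
    LDG.Mesh.total_nonneg fun j x _ => sq_nonneg _
  have hsqrt : ∀ a : ℝ, 0 < a → √(a * (16 * L ^ 2 * (1 + t) ^ 2)) = 4 * √a * L * (1 + t) := by
    intro a ha
    rw [Real.sqrt_mul ha.le, (by ring : 16 * L ^ 2 * (1 + t) ^ 2 = (4 * L * (1 + t)) ^ 2),
      Real.sqrt_sq (by positivity)]
    ring
  have hfin : 4 * (√A + √A') * C * (B + 1) * (1 + t) * 𝓜.maxSize ^ (2 * k + 1)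
      = 4 * √A * L * (1 + t) + 4 * √A' * L * (1 + t) := by
    rw [hL]
    ring
  rw [hfin]
  constructor
  · rw [← h0 t ht, LDG.Mesh.traceError_u (lam := lam) hθ
      ((hD.jet t ht).mono (by omega : 1 + 2 * k ≤ 2 * k + 2)) (hper0 t ht)]
    have hmem := LDG.Mesh.errU_mem (lam := lam) hθ
      ((hD.jet t ht).mono (by omega : 1 ≤ 2 * k + 2)) (h.mem_u t ht)
    have hle := (hA 𝓜 hq _ hmem).trans
      (mul_le_mul_of_nonneg_left ((le_add_of_nonneg_right hQ0).trans hE) hA0.le)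
    exact (Real.sqrt_le_sqrt hle).trans ((hsqrt A hA0).le.trans
      (le_add_of_nonneg_right (by positivity)))
  · rintro rfl
    have hJ : ∀ τ ∈ Set.Icc 0 t, 𝓜.traceError (1 - lam) (LDG.auxVar u τ) (qh τ) ^ 2
        = 1 / (𝓜.N : ℝ) * ∑ j, 𝓜.avg (1 - lam)
          (𝓜.toBroken (𝓜.errQ k lam lam (D τ) (qh τ))) j ^ 2 := fun τ hτ =>
      LDG.Mesh.traceError_q hθ ((hD.jet τ (hsub hτ)).mono (by omega)) (hper1 τ (hsub hτ)) _
        (h1 τ (hsub hτ))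
    have hev : ∀ j, ∀ x ∈ 𝓜.cell j, ContinuousOn
        (fun τ => (𝓜.errQ k lam lam (D τ) (qh τ) j).eval x) (Set.Icc 0 t) := fun j x hx =>
      (LDG.Mesh.continuousOn_errQ hθ hD h j hx).mono hsub
    have hcont : ContinuousOn (fun τ => 𝓜.traceError (1 - lam) (LDG.auxVar u τ) (qh τ) ^ 2)
        (Set.Icc 0 t) := by
      refine ContinuousOn.congr ?_ hJ
      refine continuousOn_const.mul (continuousOn_finsetSum _ fun j _ => ContinuousOn.pow ?_ 2)
      exact (continuousOn_const.mul (hev _ _ (𝓜.right_mem_cell j))).add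
        (continuousOn_const.mul (hev _ _ (𝓜.left_mem_cell (𝓜.next j))))
    have hQc : ContinuousOn (fun τ => A' * 𝓜.total
        (fun j x => (𝓜.errQ k lam lam (D τ) (qh τ) j).eval x ^ 2)) (Set.Icc 0 t) :=
      continuousOn_const.mul (continuousOn_finsetSum _ fun j _ =>
        LDG.continuousOn_integral_sq (n := k + 1) (𝓜.left_lt_right j)
          (fun s hs => LDG.Mesh.errQ_mem hθ ((hD.jet s (hsub hs)).mono (by omega))
            (h.mem_q s (hsub hs)) j) (hev j))
    -- Integrability is proved separately, since the integral of a non-integrable function is 0 by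
    -- convention and the bound would then say nothing.
    have hint := hcont.intervalIntegrable_of_Icc ht.1 (μ := MeasureTheory.volume)
    refine ⟨hint, ?_⟩
    refine (Real.sqrt_le_sqrt ?_).trans ((hsqrt A' hA0').le.trans
      (le_add_of_nonneg_left (by positivity)))
    refine (intervalIntegral.integral_mono_on ht.1 hint (hQc.intervalIntegrable_of_Icc ht.1)
      fun τ hτ => ?_).trans ?_
    · rw [hJ τ hτ]
      exact hA' 𝓜 hq _ (LDG.Mesh.errQ_mem hθ ((hD.jet τ (hsub hτ)).mono (by omega))
        (h.mem_q τ (hsub hτ)))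
    · rw [intervalIntegral.integral_const_mul]
      exact mul_le_mul_of_nonneg_left (by linarith) hA0'.le
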